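/- Let $\mu_0,\mu_1$ be absolutely continuous probability measures on $\mathbb{R}$ whose (closed) supports are convex, with densities $\bar\mu_0,\bar\mu_1$ such that, for $i=0,1$, $\bar\mu_i$ is continuous and strictly positive on $\operatorname{supp}\mu_i$. Let $$T(x)=\sup\{z\in\operatorname{supp}\mu_1:\ \mu_1((-\infty,z])\le \mu_0((-\infty,x])\}\in[-\infty,+\infty],\qquad x\in\operatorname{supp}\mu_0,$$ (with $\sup\emptyset=-\infty$) be the monotone transport map from $\mu_0$ to $\mu_1$; it is finite except possibly at an end point of $\operatorname{supp}\mu_0$. Let $\mathcal S=\{x\in\operatorname{supp}\mu_0:\ T(x)=x\}$, let $\partial\mathcal S$ be its boundary in $\mathbb R$, and let $C=\operatorname{Conv}(\operatorname{supp}\mu_0\cup\operatorname{supp}\mu_1)$. For $v:C\to\mathbb R$ and $x\in C$, a solution of $\partial_t\phi(t,x)=v(\phi(t,x))$, $\phi(0,x)=x$, on a time interval $I=[0,\tau]$ or $I=[0,\tau)$ is a curve $\phi(\cdot,x):I\to C$ such that $v(\phi(\cdot,x))$ is integrable on $[0,t]$ and $\phi(t,x)=x+\int_0^t v(\phi(s,x))\,ds$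 for all $t\in I$. Then there exists an autonomous velocity field $v:C\to\mathbb R$ such that: 1. $|v|>0$ on $C\setminus\mathcal S$ and $v=0$ on $\mathcal S$. 2. For every $x\in\operatorname{supp}\mu_0$ with $T(x)$ finite there is a solution $\phi(\cdot,x)$ on $[0,1]$, and $\phi(1,x)=T(x)$. If $x\in\operatorname{supp}\mu_0$ and $T(x)=\pm\infty$, there is a solution $\phi(\cdot,x)$ on $[0,1)$, and $\phi(t,x)\to T(x)$ as $t\uparrow1$. 3. This flow is unique: for every $x\in\operatorname{supp}\mu_0$ and $\tau\in[0,1]$, every solution on $[0,\tau]$ starting at $x$ coincides with $\phi(\cdot,x)$ (in particular there is no solution on $[0,1]$ starting at $x$ if $T(x)=\pm\infty$). 4. $v$ is continuous on $C\setminus\partial\mathcal S$. If, additionally, $|\bar\mu_0-\bar\mu_1|>0$ on $\partial\mathcal S$, then $v$ can be taken continuous on all of $C$. If, furthermore, $\bar\mu_0$ and $\bar\mu_1$ are Lipschitz continuous on their respective supports, then $v$ can be taken locally Lipschitz continuous on all of $C$ (that is, up to and including $\partial\mathcal S$). -/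

import Mathlib

open MeasureTheory Set Filter Topology

/-- The monotone (non-decreasing) transport map from `μ₀` to `μ₁`,
`T x = sup {z ∈ supp μ₁ : μ₁ (-∞, z] ≤ μ₀ (-∞, x]}`, with values in `[-∞, ∞]`.
For measures with positive densities on interval supports this is the map matching the cumulative
distribution functions; the only points of `supp μ₀` where an infinite value can occur are its end
points (when `supp μ₁` is unbounded on that side). Restricting the supremum to `supp μ₁` only
matters at a right end point of `supp μ₀`, which is sent to the right end point of `supp μ₁`. -/
noncomputable def monotoneTransport (μ₀ μ₁ : Measure ℝ) (x : ℝ) : EReal :=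
  sSup ((fun z : ℝ => (z : EReal)) '' {z : ℝ | z ∈ μ₁.support ∧ μ₁ (Iic z) ≤ μ₀ (Iic x)})

/-- The set `𝒮` of fixed points of the monotone transport map in `supp μ₀`. -/
def fixedSet (μ₀ μ₁ : Measure ℝ) : Set ℝ :=
  {x : ℝ | x ∈ μ₀.support ∧ monotoneTransport μ₀ μ₁ x = (x : EReal)}

/-- The interval `Conv (supp μ₀ ∪ supp μ₁)` on which the velocity field lives. -/
def transportHull (μ₀ μ₁ : Measure ℝ) : Set ℝ :=
  convexHull ℝ (μ₀.support ∪ μ₁.support)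

/-- `γ` solves `γ' = v(γ)`, `γ(0) = x` on the time interval `I` (an interval with left end point
`0 ∈ I`), inside the domain `C` of `v`, in the integral (Carathéodory) sense. The integrability of
`v ∘ γ` together with the integral equation makes `γ` absolutely continuous. -/
def IsSolutionOn (v : ℝ → ℝ) (C : Set ℝ) (x : ℝ) (I : Set ℝ) (γ : ℝ → ℝ) : Prop :=
  ∀ t ∈ I, γ t ∈ C ∧ IntervalIntegrable (fun s => v (γ s)) volume 0 t ∧
    γ t = x + ∫ s in (0 : ℝ)..t, v (γ s)

/-- `f` is Lipschitz on `s` for some constant. -/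
def LipOn (f : ℝ → ℝ) (s : Set ℝ) : Prop :=
  ∃ K : ℝ, 0 ≤ K ∧ ∀ x ∈ s, ∀ y ∈ s, |f x - f y| ≤ K * |x - y|

namespace LipOn

theorem mono {f : ℝ → ℝ} {s t : Set ℝ} (h : LipOn f t) (hst : s ⊆ t) : LipOn f s := by
  obtain ⟨K, hK, h⟩ := h
  exact ⟨K, hK, fun x hx y hy => h x (hst hx) y (hst hy)⟩

theorem congr {f g : ℝ → ℝ} {s : Set ℝ} (h : LipOn f s) (hfg : EqOn g f s) : LipOn g s := by
  obtain ⟨K, hK, h⟩ := h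
  exact ⟨K, hK, fun x hx y hy => by rw [hfg hx, hfg hy]; exact h x hx y hy⟩

theorem exists_lipschitzOnWith {f : ℝ → ℝ} {s : Set ℝ} (h : LipOn f s) :
    ∃ K, LipschitzOnWith K f s := by
  obtain ⟨K, hK, h⟩ := h
  refine ⟨K.toNNReal, LipschitzOnWith.of_dist_le_mul fun x hx y hy => ?_⟩
  rw [Real.dist_eq, Real.dist_eq, Real.coe_toNNReal K hK]
  exact h x hx y hy

theorem of_lipschitzOnWith {f : ℝ → ℝ} {s : Set ℝ} (h : ∃ K, LipschitzOnWith K f s) :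
    LipOn f s := by
  obtain ⟨K, h⟩ := h
  refine ⟨K, K.2, fun x hx y hy => ?_⟩
  simpa [Real.dist_eq] using h.dist_le_mul x hx y hy

theorem mul {f g : ℝ → ℝ} {s : Set ℝ} (hf : LipOn f s) (hg : LipOn g s)
    (bf : ∃ M, ∀ x ∈ s, |f x| ≤ M) (bg : ∃ M, ∀ x ∈ s, |g x| ≤ M) :
    LipOn (fun x => f x * g x) s := by
  obtain ⟨K, hK, hf⟩ := hf
  obtain ⟨K', hK', hg⟩ := hg
  obtain ⟨M, bf⟩ := bf
  obtain ⟨M', bg⟩ := bg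
  refine ⟨|M| * K' + |M'| * K, by positivity, fun x hx y hy => ?_⟩
  have e : f x * g x - f y * g y = f x * (g x - g y) + g y * (f x - f y) := by ring
  rw [e]
  refine (abs_add_le _ _).trans ?_
  rw [abs_mul, abs_mul, add_mul, mul_assoc, mul_assoc]
  exact add_le_add
    (mul_le_mul ((bf x hx).trans (le_abs_self _)) (hg x hx y hy) (abs_nonneg _) (abs_nonneg _))
    (mul_le_mul ((bg y hy).trans (le_abs_self _)) (hf x hx y hy) (abs_nonneg _) (abs_nonneg _))

theorem inv {f : ℝ → ℝ} {s : Set ℝ} (hf : LipOn f s) (bf : ∃ m, 0 < m ∧ ∀ x ∈ s, m ≤ f x) :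
    LipOn (fun x => (f x)⁻¹) s := by
  obtain ⟨K, hK, hf⟩ := hf
  obtain ⟨m, hm, bf⟩ := bf
  refine ⟨K / (m * m), by positivity, fun x hx y hy => ?_⟩
  have hx0 : 0 < f x := hm.trans_le (bf x hx)
  have hy0 : 0 < f y := hm.trans_le (bf y hy)
  have e : (f x)⁻¹ - (f y)⁻¹ = (f y - f x) / (f x * f y) := by field_simp
  rw [e, abs_div, abs_of_pos (mul_pos hx0 hy0), abs_sub_comm, div_mul_eq_mul_div]
  gcongr
  · exact hf x hx y hy
  · exact bf x hx
  · exact bf y hy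

theorem comp {f g : ℝ → ℝ} {s t : Set ℝ} (hf : LipOn f t) (hg : LipOn g s) (h : MapsTo g s t) :
    LipOn (fun x => f (g x)) s := by
  obtain ⟨K, hK, hf⟩ := hf
  obtain ⟨K', hK', hg⟩ := hg
  refine ⟨K * K', by positivity, fun x hx y hy => (hf _ (h hx) _ (h hy)).trans ?_⟩
  rw [mul_assoc]
  gcongr
  exact hg x hx y hy

theorem const_mul {f : ℝ → ℝ} {s : Set ℝ} (c : ℝ) (hf : LipOn f s) :
    LipOn (fun x => c * f x) s := by
  obtain ⟨K, hK, hf⟩ := hf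
  refine ⟨|c| * K, by positivity, fun x hx y hy => ?_⟩
  rw [← mul_sub, abs_mul, mul_assoc]
  gcongr
  exact hf x hx y hy

theorem continuousOn {f : ℝ → ℝ} {s : Set ℝ} (hf : LipOn f s) : ContinuousOn f s := by
  obtain ⟨K, hK⟩ := hf.exists_lipschitzOnWith
  exact hK.continuousOn

/-- Gluing Lipschitz estimates on both sides of a point, with the same constant. -/
theorem glue_bound {f : ℝ → ℝ} {s : Set ℝ} {m K : ℝ} (hm : m ∈ s)
    (h₁ : ∀ x ∈ s ∩ Iic m, ∀ y ∈ s ∩ Iic m, |f x - f y| ≤ K * |x - y|)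
    (h₂ : ∀ x ∈ s ∩ Ici m, ∀ y ∈ s ∩ Ici m, |f x - f y| ≤ K * |x - y|) :
    ∀ x ∈ s, ∀ y ∈ s, |f x - f y| ≤ K * |x - y| := by
  have key : ∀ x ∈ s, ∀ y ∈ s, x ≤ m → m ≤ y → |f x - f y| ≤ K * |x - y| := by
    intro x hx y hy hxm hmy
    have a := h₁ x ⟨hx, hxm⟩ m ⟨hm, self_mem_Iic⟩
    have b := h₂ m ⟨hm, self_mem_Ici⟩ y ⟨hy, hmy⟩
    rw [abs_of_nonpos (by linarith : x - m ≤ 0)] at a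
    rw [abs_of_nonpos (by linarith : m - y ≤ 0)] at b
    rw [abs_of_nonpos (by linarith : x - y ≤ 0)]
    calc |f x - f y| ≤ |f x - f m| + |f m - f y| := abs_sub_le _ _ _
      _ ≤ K * -(x - m) + K * -(m - y) := add_le_add a b
      _ = K * -(x - y) := by ring
  intro x hx y hy
  rcases le_total x m with h | h <;> rcases le_total y m with h' | h'
  · exact h₁ x ⟨hx, h⟩ y ⟨hy, h'⟩
  · exact key x hx y hy h h'
  · rw [abs_sub_comm, abs_sub_comm x]
    exact key y hy x hx h' h
  · exact h₂ x ⟨hx, h⟩ y ⟨hy, h'⟩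

theorem glue {f : ℝ → ℝ} {s : Set ℝ} {m : ℝ} (hm : m ∈ s)
    (h₁ : LipOn f (s ∩ Iic m)) (h₂ : LipOn f (s ∩ Ici m)) : LipOn f s := by
  obtain ⟨K, hK, h₁⟩ := h₁
  obtain ⟨K', hK', h₂⟩ := h₂
  refine ⟨max K K', le_max_of_le_left hK, glue_bound hm (fun x hx y hy => ?_) (fun x hx y hy => ?_)⟩
  · exact (h₁ x hx y hy).trans (by gcongr; exact le_max_left _ _)
  · exact (h₂ x hx y hy).trans (by gcongr; exact le_max_right _ _)

end LipOn

theorem exists_abs_le_of_continuousOn_Icc {f : ℝ → ℝ} {a b : ℝ} (h : ContinuousOn f (Icc a b)) :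
    ∃ M, ∀ x ∈ Icc a b, |f x| ≤ M := by
  obtain ⟨M, hM⟩ := isCompact_Icc.exists_bound_of_continuousOn h
  exact ⟨M, fun x hx => hM x hx⟩

theorem exists_pos_le_of_continuousOn_Icc {f : ℝ → ℝ} {a b : ℝ} (h : ContinuousOn f (Icc a b))
    (hpos : ∀ x ∈ Icc a b, 0 < f x) : ∃ m, 0 < m ∧ ∀ x ∈ Icc a b, m ≤ f x := by
  rcases (Icc a b).eq_empty_or_nonempty with he | hne
  · exact ⟨1, one_pos, by simp [he]⟩
  · obtain ⟨z, hz, hmin⟩ := isCompact_Icc.exists_isMinOn hne h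
    exact ⟨f z, hpos z hz, fun x hx => hmin hx⟩

/-- A map decreasing every point of `K ∩ [x₁, ∞)` brings every point of `K` below `x₁` after
finitely many steps. -/
theorem exists_iterate_le {K : Set ℝ} (hK : K.OrdConnected) {x₁ : ℝ} {σ : ℝ → ℝ} (hx₁ : x₁ ∈ K)
    (hσ : ContinuousOn σ (K ∩ Ici x₁)) (hmaps : ∀ y ∈ K, x₁ ≤ y → σ y ∈ K)
    (hlt : ∀ y ∈ K, x₁ ≤ y → σ y < y) {P : ℝ → Prop} (base : ∀ y ∈ K, y ≤ x₁ → P y)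
    (step : ∀ y ∈ K, x₁ < y → P (σ y) → P y) : ∀ y ∈ K, P y := by
  intro q hq
  have hsub : Icc x₁ q ⊆ K ∩ Ici x₁ := fun z hz => ⟨hK.out hx₁ hq hz, hz.1⟩
  obtain ⟨δ, hδ, hmin⟩ := exists_pos_le_of_continuousOn_Icc (f := fun y => y - σ y)
    (continuousOn_id.sub (hσ.mono hsub)) (a := x₁) (b := q)
    (fun y hy => sub_pos.2 (hlt y (hsub hy).1 hy.1))
  have key : ∀ n : ℕ, ∀ y ∈ K, y ≤ q → y ≤ x₁ + n * δ → P y := by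
    intro n
    induction n with
    | zero => intro y hy _ h; exact base y hy (by simpa using h)
    | succ n ih =>
      intro y hy hyq h
      rcases le_or_gt y x₁ with h1 | h1
      · exact base y hy h1
      · have := hmin y ⟨h1.le, hyq⟩
        push_cast at h
        exact step y hy h1 (ih _ (hmaps y hy h1.le) (by linarith) (by linarith))
  obtain ⟨n, hn⟩ := exists_nat_ge ((q - x₁) / δ)
  rw [div_le_iff₀ hδ] at hn
  exact key n q hq le_rfl (by linarith)

/-- Finite stages of the extension of `v₀` along `σ` with multiplier `s`. -/
noncomputable def ladderStage (x₁ : ℝ) (σ s v₀ : ℝ → ℝ) : ℕ → ℝ → ℝ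
  | 0, y => v₀ y
  | n + 1, y => if y ≤ x₁ then v₀ y else ladderStage x₁ σ s v₀ n (σ y) * s y

theorem exists_ladder_fun {K : Set ℝ} (hK : K.OrdConnected) {x₁ : ℝ} {σ : ℝ → ℝ} (hx₁ : x₁ ∈ K)
    (hσ : ContinuousOn σ (K ∩ Ici x₁)) (hmaps : ∀ y ∈ K, x₁ ≤ y → σ y ∈ K)
    (hlt : ∀ y ∈ K, x₁ ≤ y → σ y < y) (s v₀ : ℝ → ℝ) :
    ∃ v : ℝ → ℝ, (∀ y ∈ K, y ≤ x₁ → v y = v₀ y) ∧ ∀ y ∈ K, x₁ < y → v y = v (σ y) * s y := by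
  have hex : ∀ y ∈ K, ∃ n, ∀ m, n ≤ m →
      ladderStage x₁ σ s v₀ m y = ladderStage x₁ σ s v₀ n y := by
    refine exists_iterate_le hK hx₁ hσ hmaps hlt (fun y _ h => ⟨0, fun m _ => ?_⟩) ?_
    · cases m <;> simp [ladderStage, h]
    · rintro y hy hy1 ⟨n, hn⟩
      refine ⟨n + 1, fun m hm => ?_⟩
      obtain ⟨m, rfl⟩ : ∃ k, m = k + 1 := ⟨m - 1, by omega⟩
      simp only [ladderStage, if_neg hy1.not_ge]
      rw [hn m (by omega)]
  choose! N hN using hex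
  refine ⟨fun y => ladderStage x₁ σ s v₀ (N y) y, fun y hy h => ?_, fun y hy h => ?_⟩
  · cases hn : N y <;> simp [ladderStage, h, hn]
  · have hσy := hmaps y hy h.le
    have e1 := hN y hy (N y + N (σ y) + 1) (by omega)
    have e2 := hN (σ y) hσy (N y + N (σ y)) (by omega)
    simp only
    rw [← e1, ← e2]
    simp [ladderStage, h.not_ge]

theorem continuousOn_Icc_glue {f : ℝ → ℝ} {a m b : ℝ} (h₁ : ContinuousOn f (Icc a m))
    (h₂ : ContinuousOn f (Icc m b)) : ContinuousOn f (Icc a b) := by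
  refine (h₁.union_of_isClosed h₂ isClosed_Icc isClosed_Icc).mono fun z hz => ?_
  rcases le_total z m with h | h
  · exact Or.inl ⟨hz.1, h⟩
  · exact Or.inr ⟨h, hz.2⟩

theorem continuousOn_of_Icc {f : ℝ → ℝ} {K : Set ℝ} {x₀ : ℝ} (hx₀ : ∀ y ∈ K, x₀ ≤ y)
    (h : ∀ q ∈ K, ContinuousOn f (Icc x₀ q)) : ContinuousOn f K := by
  intro y hy
  by_cases hq : ∃ q ∈ K, y < q
  · obtain ⟨q, hq, hyq⟩ := hq
    refine ((h q hq) y ⟨hx₀ y hy, hyq.le⟩).mono_of_mem_nhdsWithin ?_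
    filter_upwards [self_mem_nhdsWithin, mem_nhdsWithin_of_mem_nhds (Iio_mem_nhds hyq)]
      with z hz hzq using ⟨hx₀ z hz, le_of_lt hzq⟩
  · push Not at hq
    exact ((h y hy) y ⟨hx₀ y hy, le_rfl⟩).mono fun z hz => ⟨hx₀ z hz, hq z hz⟩

/-- Extension of a positive function from a fundamental domain `[x₀, x₁]` to `K ⊆ [x₀, ∞)`, along
`σ` and with multiplier `s`. -/
theorem exists_ladder {K : Set ℝ} (hK : K.OrdConnected) {x₀ x₁ : ℝ} {σ s v₀ : ℝ → ℝ}
    (hx₀ : ∀ y ∈ K, x₀ ≤ y) (hx₀K : x₀ ∈ K) (hx₁ : x₁ ∈ K)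
    (hσ : ContinuousOn σ (K ∩ Ici x₁)) (hmaps : ∀ y ∈ K, x₁ ≤ y → σ y ∈ K)
    (hmono : MonotoneOn σ (K ∩ Ici x₁))
    (hlt : ∀ y ∈ K, x₁ ≤ y → σ y < y) (hs : ContinuousOn s (K ∩ Ici x₁))
    (hspos : ∀ y ∈ K, x₁ ≤ y → 0 < s y) (hv₀ : ContinuousOn v₀ (Icc x₀ x₁))
    (hv₀pos : ∀ y ∈ Icc x₀ x₁, 0 < v₀ y) (hσx₁ : σ x₁ = x₀) (hcompat : v₀ x₁ = v₀ x₀ * s x₁) :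
    ∃ v : ℝ → ℝ, EqOn v v₀ (Icc x₀ x₁) ∧ (∀ y ∈ K, 0 < v y) ∧ ContinuousOn v K ∧
      (∀ y ∈ K, x₁ ≤ y → v y = v (σ y) * s y) ∧
      (LipOn v₀ (Icc x₀ x₁) → (∀ q ∈ K, LipOn σ (Icc x₁ q)) → (∀ q ∈ K, LipOn s (Icc x₁ q)) →
        ∀ q ∈ K, LipOn v (Icc x₀ q)) := by
  obtain ⟨v, hv1, hv2⟩ := exists_ladder_fun hK hx₁ hσ hmaps hlt s v₀
  have hIcc : ∀ q ∈ K, Icc x₀ q ⊆ K := fun q hq => hK.out hx₀K hq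
  have hx₀₁ : x₀ ≤ x₁ := hx₀ _ hx₁
  have hE : EqOn v v₀ (Icc x₀ x₁) := fun y hy => hv1 y (hIcc _ hx₁ hy) hy.2
  have hfe : ∀ y ∈ K, x₁ ≤ y → v y = v (σ y) * s y := by
    intro y hy h
    rcases h.eq_or_lt with rfl | h
    · rw [hσx₁, hE ⟨hx₀₁, le_rfl⟩, hE ⟨le_rfl, hx₀₁⟩, hcompat]
    · exact hv2 y hy h
  have hsub : ∀ q ∈ K, Icc x₁ q ⊆ K ∩ Ici x₁ := fun q hq z hz => ⟨hK.out hx₁ hq hz, hz.1⟩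
  have hmapsIcc : ∀ q ∈ K, MapsTo σ (Icc x₁ q) (Icc x₀ (σ q)) := fun q hq z hz =>
    ⟨hx₀ _ (hmaps z (hsub q hq hz).1 hz.1),
      hmono (hsub q hq hz) ⟨hq, hz.1.trans hz.2⟩ hz.2⟩
  have hc : ∀ q ∈ K, ContinuousOn v (Icc x₀ q) := by
    refine exists_iterate_le hK hx₁ hσ hmaps hlt (fun q hq h => ?_) (fun q hq h ih => ?_)
    · exact (hv₀.congr hE).mono (Icc_subset_Icc_right h)
    · refine continuousOn_Icc_glue (hv₀.congr hE) ?_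
      refine ContinuousOn.congr ?_ (fun y hy => hfe y (hsub q hq hy).1 hy.1)
      exact (ih.comp (hσ.mono (hsub q hq)) (hmapsIcc q hq)).mul (hs.mono (hsub q hq))
  refine ⟨v, hE, ?_, continuousOn_of_Icc hx₀ hc, hfe, fun hL hLσ hLs => ?_⟩
  · refine exists_iterate_le hK hx₁ hσ hmaps hlt (fun q hq h => ?_) (fun q hq h ih => ?_)
    · rw [hE ⟨hx₀ q hq, h⟩]; exact hv₀pos q ⟨hx₀ q hq, h⟩
    · rw [hfe q hq h.le]; exact mul_pos ih (hspos q hq h.le)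
  · refine exists_iterate_le hK hx₁ hσ hmaps hlt (fun q hq h => ?_) (fun q hq h ih => ?_)
    · exact (hL.congr hE).mono (Icc_subset_Icc_right h)
    · refine LipOn.glue (m := x₁) ⟨hx₀₁, h.le⟩ ((hL.congr hE).mono fun z hz => ⟨hz.1.1, hz.2⟩) ?_
      refine LipOn.mono (t := Icc x₁ q) ?_ fun z hz => ⟨hz.2, hz.1.2⟩
      refine LipOn.congr ?_ (fun y hy => hfe y (hsub q hq hy).1 hy.1)
      refine (ih.comp (hLσ q hq) (hmapsIcc q hq)).mul (hLs q hq) ?_ ?_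
      · exact exists_abs_le_of_continuousOn_Icc (ih.comp (hLσ q hq) (hmapsIcc q hq)).continuousOn
      · exact exists_abs_le_of_continuousOn_Icc (hLs q hq).continuousOn

/-- Behaviour of a solution of `v ∘ τ = v * t` near an attracting fixed point `b` of `τ` at which
the multiplier `t` stays below `r < 1`. -/
theorem ladder_end {c b r : ℝ} {τ t v : ℝ → ℝ} (hcb : c < b) (hr : r < 1)
    (hτc : ContinuousOn τ (Ico c b)) (hτm : MapsTo τ (Ico c b) (Ico c b))
    (hτlt : ∀ x ∈ Ico c b, x < τ x)
    (hτd : ∀ x ∈ Ioo c b, HasDerivAt τ (t x) x) (htpos : ∀ x ∈ Ico c b, 0 < t x)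
    (htr : ∀ x ∈ Ico c b, t x ≤ r) (hvc : ContinuousOn v (Ico c b))
    (hv : ∀ x ∈ Ico c b, v (τ x) = v x * t x) :
    Tendsto v (𝓝[<] b) (𝓝 0) ∧
      (LipOn t (Ico c b) → (∃ κ, 0 < κ ∧ ∀ x ∈ Ico c b, κ ≤ t x) → LipOn v (Icc c (τ c)) →
        LipOn v (Ico c b)) := by
  have hcI : c ∈ Ico c b := ⟨le_rfl, hcb⟩
  have hr0 : 0 < r := (htpos c hcI).trans_le (htr c hcI)
  set Y : ℕ → ℝ := fun n => τ^[n] c with hY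
  have hY0 : Y 0 = c := rfl
  have hYs : ∀ n, Y (n + 1) = τ (Y n) := fun n => Function.iterate_succ_apply' τ n c
  have hYm : ∀ n, Y n ∈ Ico c b := by
    intro n
    induction n with
    | zero => exact hcI
    | succ n ih => rw [hYs]; exact hτm ih
  have hYlt : ∀ n, Y n < Y (n + 1) := fun n => by rw [hYs]; exact hτlt _ (hYm n)
  have hYmono : StrictMono Y := strictMono_nat_of_lt_succ hYlt
  have hYsub : ∀ m n, Icc (Y m) (Y n) ⊆ Ico c b := fun m n z hz =>
    ⟨(hYm m).1.trans hz.1, hz.2.trans_lt (hYm n).2⟩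
  have hex : ∀ z ∈ Ico c b, ∃ n, z < Y n := by
    intro z hz
    have hsub : Icc c z ⊆ Ico c b := fun w hw => ⟨hw.1, hw.2.trans_lt hz.2⟩
    obtain ⟨δ, hδ, hmin⟩ := exists_pos_le_of_continuousOn_Icc (f := fun y => τ y - y) (a := c)
      (b := z) ((hτc.mono hsub).sub continuousOn_id) (fun y hy => sub_pos.2 (hτlt y (hsub hy)))
    by_contra! hcon
    have key : ∀ n : ℕ, c + n * δ ≤ Y n := by
      intro n
      induction n with
      | zero => simp [hY0]
      | succ n ih =>
        have := hmin (Y n) ⟨(hYm n).1, hcon n⟩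
        rw [hYs]; push_cast; linarith
    obtain ⟨n, hn⟩ := exists_nat_gt ((z - c) / δ)
    rw [div_lt_iff₀ hδ] at hn
    linarith [key n, hcon n]
  have hcover : ∀ z ∈ Ico c b, ∃ n, z ∈ Icc (Y n) (Y (n + 1)) := by
    intro z hz
    classical
    have h := hex z hz
    have h1 := Nat.find_spec h
    cases hn : Nat.find h with
    | zero => rw [hn, hY0] at h1; exact absurd hz.1 (not_le.2 h1)
    | succ n =>
      rw [hn] at h1
      exact ⟨n, not_lt.1 (Nat.find_min h (by omega)), h1.le⟩
  have hsurj : ∀ n, ∀ y ∈ Icc (Y (n + 1)) (Y (n + 2)), ∃ x ∈ Icc (Y n) (Y (n + 1)), τ x = y := by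
    intro n y hy
    rw [hYs n, hYs (n + 1)] at hy
    exact intermediate_value_Icc (hYlt n).le (hτc.mono (hYsub n (n + 1))) hy
  obtain ⟨M, hM⟩ := exists_abs_le_of_continuousOn_Icc (hvc.mono (hYsub 0 1))
  have hM0 : 0 ≤ M := (abs_nonneg _).trans (hM c ⟨hY0.le, by rw [← hY0]; exact (hYlt 0).le⟩)
  have hVn : ∀ n, ∀ y ∈ Icc (Y n) (Y (n + 1)), |v y| ≤ M * r ^ n := by
    intro n
    induction n with
    | zero => intro y hy; simpa using hM y hy
    | succ n ih =>
      intro y hy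
      obtain ⟨x, hx, rfl⟩ := hsurj n y hy
      have hxI := hYsub _ _ hx
      rw [hv x hxI, abs_mul, abs_of_pos (htpos x hxI), pow_succ, ← mul_assoc]
      exact mul_le_mul (ih x hx) (htr x hxI) (htpos x hxI).le (by positivity)
  refine ⟨?_, fun ⟨K, hK, hLt⟩ ⟨κ, hκ, hκt⟩ ⟨B₀, hB₀, hLv⟩ => ?_⟩
  · rw [Metric.tendsto_nhds]
    intro ε hε
    have hlim : Tendsto (fun n : ℕ => M * r ^ n) atTop (𝓝 0) := by
      simpa using (tendsto_pow_atTop_nhds_zero_of_lt_one hr0.le hr).const_mul M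
    obtain ⟨n, hn⟩ := (hlim.eventually (gt_mem_nhds hε)).exists
    filter_upwards [Ioo_mem_nhdsLT (hYm n).2] with y hy
    obtain ⟨m, hm⟩ := hcover y ⟨(hYm n).1.trans hy.1.le, hy.2⟩
    have hnm : n < m + 1 := hYmono.lt_iff_lt.1 (hy.1.trans_le hm.2)
    rw [Real.dist_eq, sub_zero]
    refine (hVn m y hm).trans_lt (lt_of_le_of_lt ?_ hn)
    exact mul_le_mul_of_nonneg_left (pow_le_pow_of_le_one hr0.le hr.le (by omega)) hM0
  · have hmvt : ∀ x ∈ Ico c b, ∀ x' ∈ Ico c b, x < x' →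
        ∃ ξ ∈ Ioo x x', τ x' - τ x = t ξ * (x' - x) := by
      intro x hx x' hx' hlt
      obtain ⟨ξ, hξ, h⟩ := exists_hasDerivAt_eq_slope τ t hlt
        (hτc.mono fun z hz => ⟨hx.1.trans hz.1, hz.2.trans_lt hx'.2⟩)
        (fun z hz => hτd z ⟨hx.1.trans_lt hz.1, hz.2.trans hx'.2⟩)
      refine ⟨ξ, hξ, ?_⟩
      rw [h, div_mul_cancel₀ _ (sub_pos.2 hlt).ne']
    set l := Y 1 - Y 0 with hl
    have hl0 : 0 < l := sub_pos.2 (hYlt 0)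
    have hln : ∀ n, Y (n + 1) - Y n ≤ l * r ^ n := by
      intro n
      induction n with
      | zero => simp [hl]
      | succ n ih =>
        obtain ⟨ξ, hξ, h⟩ := hmvt _ (hYm n) _ (hYm (n + 1)) (hYlt n)
        have hξI : ξ ∈ Ico c b := hYsub n (n + 1) ⟨hξ.1.le, hξ.2.le⟩
        rw [← hYs (n + 1), ← hYs n] at h
        rw [h, pow_succ, ← mul_assoc, mul_comm]
        exact mul_le_mul ih (htr ξ hξI) (htpos ξ hξI).le (by positivity)
    set a := K * (l + M) / κ with ha
    have ha0 : 0 ≤ a := by positivity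
    set κ' := a / (1 - r) with hκ'
    have h1r : 0 < 1 - r := sub_pos.2 hr
    have hκ'0 : 0 ≤ κ' := by positivity
    have hκ'a : κ' * (1 - r) = a := div_mul_cancel₀ _ h1r.ne'
    set B := max B₀ 1 with hB
    have hB1 : 1 ≤ B := le_max_right _ _
    set L : ℕ → ℝ := fun n => B * Real.exp (κ' * (1 - r ^ n)) with hLdef
    have hrn : ∀ n, 0 < r ^ n := fun n => pow_pos hr0 n
    have hrn1 : ∀ n, r ^ n ≤ 1 := fun n => pow_le_one₀ hr0.le hr.le
    have hL1 : ∀ n, 1 ≤ L n := fun n => one_le_mul_of_one_le_of_one_le hB1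
      (Real.one_le_exp (mul_nonneg hκ'0 (sub_nonneg.2 (hrn1 n))))
    have hLs : ∀ n, L (n + 1) = L n * Real.exp (a * r ^ n) := by
      intro n
      simp only [hLdef]
      rw [mul_assoc, ← Real.exp_add, ← hκ'a]
      congr 2
      ring
    have hstep : ∀ n, ∀ x ∈ Icc (Y n) (Y (n + 1)), ∀ y ∈ Icc (Y n) (Y (n + 1)),
        |v x - v y| ≤ L n * |x - y| := by
      intro n
      induction n with
      | zero =>
        intro x hx y hy
        refine (hLv x hx y hy).trans ?_
        simp only [hLdef, pow_zero, sub_self, mul_zero, Real.exp_zero, mul_one]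
        gcongr
        exact le_max_left _ _
      | succ n ih =>
        have main : ∀ x ∈ Icc (Y n) (Y (n + 1)), ∀ x' ∈ Icc (Y n) (Y (n + 1)), x < x' →
            |v (τ x) - v (τ x')| ≤ L (n + 1) * |τ x - τ x'| := by
          intro x hx x' hx' hlt
          have hxI := hYsub _ _ hx
          have hxI' := hYsub _ _ hx'
          obtain ⟨ξ, hξ, h⟩ := hmvt x hxI x' hxI' hlt
          have hξI : ξ ∈ Ico c b := ⟨hxI.1.trans hξ.1.le, hξ.2.trans hxI'.2⟩
          have htξ := htpos ξ hξI
          have hd : |x - x'| = x' - x := by rw [abs_sub_comm, abs_of_pos (sub_pos.2 hlt)]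
          rw [abs_sub_comm (τ x), h, abs_of_pos (mul_pos htξ (sub_pos.2 hlt)), hv x hxI, hv x' hxI']
          have e : v x * t x - v x' * t x' = (v x - v x') * t x + v x' * (t x - t x') := by ring
          have h1 : |v x - v x'| * t x ≤ L n * (x' - x) * t x := by
            rw [← hd]
            exact mul_le_mul_of_nonneg_right (ih x hx x' hx') (htpos x hxI).le
          have h2 : |v x'| * |t x - t x'| ≤ M * r ^ n * (K * (x' - x)) := by
            rw [← hd]
            exact mul_le_mul (hVn n x' hx') (hLt x hxI x' hxI') (abs_nonneg _)
              (mul_nonneg hM0 (hrn n).le)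
          have h3 : t x ≤ t ξ + K * (l * r ^ n) := by
            have h4 := hLt x hxI ξ hξI
            have h5 : |x - ξ| ≤ l * r ^ n := by
              rw [abs_sub_comm, abs_of_pos (sub_pos.2 hξ.1)]
              linarith [hln n, hξ.2, hx.1, hx'.2]
            have h6 := le_abs_self (t x - t ξ)
            have h7 := mul_le_mul_of_nonneg_left h5 hK
            linarith
          have h8 : L n * t x + M * r ^ n * K ≤ L (n + 1) * t ξ := by
            have h9 : L n * (1 + a * r ^ n) ≤ L (n + 1) := by
              rw [hLs]
              refine mul_le_mul_of_nonneg_left ?_ (zero_le_one.trans (hL1 n))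
              linarith [Real.add_one_le_exp (a * r ^ n)]
            have h10 := mul_le_mul_of_nonneg_right h9 htξ.le
            have h11 : K * (l + M) ≤ a * t ξ := by
              rw [ha, div_mul_eq_mul_div, le_div_iff₀ hκ]
              exact mul_le_mul_of_nonneg_left (hκt ξ hξI) (by positivity)
            have h12 : L n * t x ≤ L n * (t ξ + K * (l * r ^ n)) :=
              mul_le_mul_of_nonneg_left h3 (zero_le_one.trans (hL1 n))
            have h13 : M * r ^ n * K ≤ L n * (M * r ^ n * K) :=
              le_mul_of_one_le_left (mul_nonneg (mul_nonneg hM0 (hrn n).le) hK) (hL1 n)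
            have h14 : L n * r ^ n * (K * (l + M)) ≤ L n * r ^ n * (a * t ξ) :=
              mul_le_mul_of_nonneg_left h11
                (mul_nonneg (zero_le_one.trans (hL1 n)) (hrn n).le)
            linarith
          rw [e]
          refine (abs_add_le _ _).trans ?_
          rw [abs_mul, abs_mul, abs_of_pos (htpos x hxI)]
          have := mul_le_mul_of_nonneg_right h8 (sub_pos.2 hlt).le
          linarith
        intro y hy y' hy'
        obtain ⟨x, hx, rfl⟩ := hsurj n y hy
        obtain ⟨x', hx', rfl⟩ := hsurj n y' hy'
        rcases lt_trichotomy x x' with h | rfl | h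
        · exact main x hx x' hx' h
        · simp
        · rw [abs_sub_comm, abs_sub_comm (τ x)]
          exact main x' hx' x hx h
    have hall : ∀ n, ∀ x ∈ Icc c (Y n), ∀ y ∈ Icc c (Y n),
        |v x - v y| ≤ B * Real.exp κ' * |x - y| := by
      have hLn : ∀ n, L n ≤ B * Real.exp κ' := by
        intro n
        simp only [hLdef]
        gcongr
        have := mul_nonneg hκ'0 (hrn n).le
        linarith
      intro n
      induction n with
      | zero =>
        intro x hx y hy
        have hx' : x = c := le_antisymm hx.2 hx.1
        have hy' : y = c := le_antisymm hy.2 hy.1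
        simp [hx', hy']
      | succ n ih =>
        refine LipOn.glue_bound (m := Y n) ⟨(hYm n).1, (hYlt n).le⟩ ?_ ?_
        · intro x hx y hy
          exact ih x ⟨hx.1.1, hx.2⟩ y ⟨hy.1.1, hy.2⟩
        · intro x hx y hy
          exact (hstep n x ⟨hx.2, hx.1.2⟩ y ⟨hy.2, hy.1.2⟩).trans
            (mul_le_mul_of_nonneg_right (hLn n) (abs_nonneg _))
    refine ⟨B * Real.exp κ', by positivity, fun x hx y hy => ?_⟩
    obtain ⟨n, hn⟩ := hex x hx
    obtain ⟨m, hm⟩ := hex y hy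
    refine hall (max n m) x ⟨hx.1, hn.le.trans (hYmono.monotone (le_max_left _ _))⟩ y
      ⟨hy.1, hm.le.trans (hYmono.monotone (le_max_right _ _))⟩

/-- The properties of a support `I`, a cumulative distribution function `F` and a density `ρ` used
in the construction of the velocity field. -/
structure Profile (I : Set ℝ) (F ρ : ℝ → ℝ) : Prop where
  closed : IsClosed I
  ord : I.OrdConnected
  cont : Continuous F
  mono : Monotone F
  strict : StrictMonoOn F I
  deriv : ∀ x ∈ interior I, HasDerivAt F (ρ x) x
  contρ : ContinuousOn ρ I
  pos : ∀ x ∈ I, 0 < ρ x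
  nonneg : ∀ x, 0 ≤ F x
  le_one : ∀ x, F x ≤ 1
  surj : ∀ m ∈ Ioo (0 : ℝ) 1, ∃ x ∈ I, F x = m
  bot : ∀ x ∈ lowerBounds I, F x = 0
  top : ∀ x ∈ upperBounds I, F x = 1

/-- Continuity of a right inverse of a continuous strictly monotone function. -/
theorem continuousOn_of_comp_strictMonoOn {I E : Set ℝ} {G g : ℝ → ℝ} (hI : I.OrdConnected)
    (hG : StrictMonoOn G I) (hg : MapsTo g E I) (hc : ContinuousOn (fun y => G (g y)) E) :
    ContinuousOn g E := by
  intro y hy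
  rw [ContinuousWithinAt, tendsto_order]
  constructor
  · intro l hl
    by_cases hlI : l ∈ I
    · filter_upwards [self_mem_nhdsWithin, (hc y hy).eventually (lt_mem_nhds (hG hlI (hg hy) hl))]
        with z hz h using (hG.lt_iff_lt hlI (hg hz)).1 h
    · filter_upwards [self_mem_nhdsWithin] with z hz
      by_contra! hcon
      exact hlI (hI.out (hg hz) (hg hy) ⟨hcon, hl.le⟩)
  · intro l hl
    by_cases hlI : l ∈ I
    · filter_upwards [self_mem_nhdsWithin, (hc y hy).eventually (gt_mem_nhds (hG (hg hy) hlI hl))]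
        with z hz h using (hG.lt_iff_lt (hg hz) hlI).1 h
    · filter_upwards [self_mem_nhdsWithin] with z hz
      by_contra! hcon
      exact hlI (hI.out (hg hy) (hg hz) ⟨hl.le, hcon⟩)

namespace Profile

variable {I : Set ℝ} {F ρ : ℝ → ℝ}

theorem reflect (p : Profile I F ρ) :
    Profile (Neg.neg ⁻¹' I) (fun x => 1 - F (-x)) (fun x => ρ (-x)) where
  closed := p.closed.preimage continuous_neg
  ord := ⟨fun x hx y hy z hz => p.ord.out hy hx ⟨neg_le_neg hz.2, neg_le_neg hz.1⟩⟩
  cont := continuous_const.sub (p.cont.comp continuous_neg)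
  mono := fun x y h => sub_le_sub_left (p.mono (neg_le_neg h)) 1
  strict := fun x hx y hy h => sub_lt_sub_left (p.strict hy hx (neg_lt_neg h)) 1
  deriv := by
    intro x hx
    have hx' : -x ∈ interior I := by
      have := (Homeomorph.neg ℝ).preimage_interior I
      have h2 : x ∈ (Homeomorph.neg ℝ) ⁻¹' interior I := by
        rw [this]; exact hx
      exact h2
    have h := ((p.deriv _ hx').comp x (hasDerivAt_neg x)).const_sub 1
    simpa using h
  contρ := p.contρ.comp continuous_neg.continuousOn fun x hx => hx
  pos := fun x hx => p.pos _ hx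
  nonneg := fun x => sub_nonneg.2 (p.le_one _)
  le_one := fun x => sub_le_self _ (p.nonneg _)
  surj := by
    intro m hm
    obtain ⟨x, hx, h⟩ := p.surj (1 - m) ⟨by linarith [hm.2], by linarith [hm.1]⟩
    exact ⟨-x, by simpa using hx, by simp [h]⟩
  bot := by
    intro x hx
    rw [p.top, sub_self]
    intro y hy
    exact le_neg.1 (hx (show -y ∈ _ by simpa using hy))
  top := by
    intro x hx
    rw [p.bot, sub_zero]
    intro y hy
    exact neg_le.1 (hx (show -y ∈ _ by simpa using hy))

theorem mem_of_pos_of_lt_one (p : Profile I F ρ) {x : ℝ} (h0 : 0 < F x) (h1 : F x < 1) :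
    x ∈ I := by
  have h2 : x ∉ lowerBounds I := fun h => h0.ne' (p.bot x h)
  have h3 : x ∉ upperBounds I := fun h => h1.ne (p.top x h)
  simp only [lowerBounds, upperBounds, mem_ofPred_eq, not_forall, not_le] at h2 h3
  obtain ⟨a, ha, hax⟩ := h2
  obtain ⟨b, hb, hxb⟩ := h3
  exact p.ord.out ha hb ⟨hax.le, hxb.le⟩

theorem mem_interior (p : Profile I F ρ) {x : ℝ} (h0 : 0 < F x) (h1 : F x < 1) :
    x ∈ interior I := by
  rw [mem_interior_iff_mem_nhds]
  filter_upwards [p.cont.continuousAt.eventually (lt_mem_nhds h0),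
    p.cont.continuousAt.eventually (gt_mem_nhds h1)] with z hz hz'
    using p.mem_of_pos_of_lt_one hz hz'

theorem invFunOn_apply (p : Profile I F ρ) {x : ℝ} (hx : x ∈ I) :
    Function.invFunOn F I (F x) = x := p.strict.injOn.leftInvOn_invFunOn hx

theorem continuousOn_invFunOn (p : Profile I F ρ) :
    ContinuousOn (Function.invFunOn F I) (F '' I) :=
  continuousOn_of_comp_strictMonoOn p.ord p.strict (fun _ h => Function.invFunOn_mem h)
    (continuousOn_id.congr fun _ h => Function.invFunOn_eq h)

theorem Ioo_subset_image (p : Profile I F ρ) : Ioo 0 1 ⊆ F '' I := fun m hm => p.surj m hm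

theorem hasDerivAt_invFunOn (p : Profile I F ρ) {m : ℝ} (hm : m ∈ Ioo (0 : ℝ) 1) :
    HasDerivAt (Function.invFunOn F I) (ρ (Function.invFunOn F I m))⁻¹ m := by
  have hmem : ∀ m ∈ Ioo (0 : ℝ) 1, F (Function.invFunOn F I m) = m := fun m hm =>
    Function.invFunOn_eq (p.Ioo_subset_image hm)
  have hI : Function.invFunOn F I m ∈ interior I := by
    apply p.mem_interior <;> rw [hmem m hm]
    exacts [hm.1, hm.2]
  refine HasDerivAt.of_local_left_inverse ?_ (p.deriv _ hI) (p.pos _ (interior_subset hI)).ne' ?_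
  · exact p.continuousOn_invFunOn.continuousAt
      (mem_of_superset (isOpen_Ioo.mem_nhds hm) p.Ioo_subset_image)
  · filter_upwards [isOpen_Ioo.mem_nhds hm] with z hz using hmem z hz

/-- Mean value theorem for the distribution function. -/
theorem exists_sub_eq (p : Profile I F ρ) {x y : ℝ} (hx : x ∈ I) (hy : y ∈ I) (h : x < y) :
    ∃ ξ ∈ Ioo x y, F y - F x = ρ ξ * (y - x) := by
  have hsub : Icc x y ⊆ I := p.ord.out hx hy
  obtain ⟨ξ, hξ, h'⟩ := exists_hasDerivAt_eq_slope F ρ h p.cont.continuousOn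
    (fun z hz => p.deriv z (interior_maximal (Ioo_subset_Icc_self.trans hsub) isOpen_Ioo hz))
  exact ⟨ξ, hξ, by rw [h', div_mul_cancel₀ _ (sub_pos.2 h).ne']⟩

theorem lipOn (p : Profile I F ρ) {x y : ℝ} (hx : x ∈ I) (hy : y ∈ I) : LipOn F (Icc x y) := by
  have hsub : Icc x y ⊆ I := p.ord.out hx hy
  obtain ⟨M, hM⟩ := exists_abs_le_of_continuousOn_Icc (p.contρ.mono hsub)
  refine ⟨|M|, abs_nonneg _, ?_⟩
  have key : ∀ u ∈ Icc x y, ∀ w ∈ Icc x y, u < w → |F w - F u| ≤ |M| * |w - u| := by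
    intro u hu w hw huw
    obtain ⟨ξ, hξ, h⟩ := p.exists_sub_eq (hsub hu) (hsub hw) huw
    rw [h, abs_mul]
    refine mul_le_mul_of_nonneg_right ?_ (abs_nonneg _)
    exact (hM ξ ⟨hu.1.trans hξ.1.le, hξ.2.le.trans hw.2⟩).trans (le_abs_self _)
  intro u hu w hw
  rcases lt_trichotomy u w with h | rfl | h
  · rw [abs_sub_comm, abs_sub_comm u]; exact key u hu w hw h
  · simp
  · exact key w hw u hu h

/-- The distribution function is bi-Lipschitz on compact intervals. -/
theorem exists_mul_abs_le (p : Profile I F ρ) {x y : ℝ} (hx : x ∈ I) (hy : y ∈ I) :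
    ∃ κ, 0 < κ ∧ ∀ u ∈ Icc x y, ∀ w ∈ Icc x y, κ * |u - w| ≤ |F u - F w| := by
  have hsub : Icc x y ⊆ I := p.ord.out hx hy
  obtain ⟨κ, hκ, hM⟩ := exists_pos_le_of_continuousOn_Icc (p.contρ.mono hsub)
    (fun z hz => p.pos z (hsub hz))
  refine ⟨κ, hκ, ?_⟩
  have key : ∀ u ∈ Icc x y, ∀ w ∈ Icc x y, u < w → κ * |w - u| ≤ |F w - F u| := by
    intro u hu w hw huw
    obtain ⟨ξ, hξ, h⟩ := p.exists_sub_eq (hsub hu) (hsub hw) huw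
    have hξ' := hM ξ ⟨hu.1.trans hξ.1.le, hξ.2.le.trans hw.2⟩
    rw [h, abs_mul, abs_of_pos (hκ.trans_le hξ')]
    gcongr
  intro u hu w hw
  rcases lt_trichotomy u w with h | rfl | h
  · rw [abs_sub_comm, abs_sub_comm (F u)]; exact key u hu w hw h
  · simp
  · exact key w hw u hu h

end Profile

/-- A function `g` with `F₀ (g y) = F₁ y` between compact intervals of two profiles is Lipschitz. -/
theorem lipOn_of_comp_eq {I₀ I₁ : Set ℝ} {F₀ F₁ ρ₀ ρ₁ : ℝ → ℝ} (p₀ : Profile I₀ F₀ ρ₀)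
    (p₁ : Profile I₁ F₁ ρ₁) {g : ℝ → ℝ} {a b c d : ℝ} (ha : a ∈ I₀) (hb : b ∈ I₀) (hc : c ∈ I₁)
    (hd : d ∈ I₁) (hg : MapsTo g (Icc c d) (Icc a b)) (h : ∀ y ∈ Icc c d, F₀ (g y) = F₁ y) :
    LipOn g (Icc c d) := by
  obtain ⟨K, hK, hL⟩ := p₁.lipOn hc hd
  obtain ⟨κ, hκ, hκL⟩ := p₀.exists_mul_abs_le ha hb
  refine ⟨K / κ, by positivity, fun x hx y hy => ?_⟩
  have h1 := hκL _ (hg hx) _ (hg hy)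
  rw [h x hx, h y hy] at h1
  have h2 := h1.trans (hL x hx y hy)
  rw [div_mul_eq_mul_div, le_div_iff₀ hκ]
  linarith

/-- A piece `J` of the line without fixed points on which the transport from the profile
`(I₀, F₀, ρ₀)` to `(I₁, F₁, ρ₁)` moves to the right. -/
structure PosComp (I₀ : Set ℝ) (F₀ ρ₀ : ℝ → ℝ) (I₁ : Set ℝ) (F₁ ρ₁ : ℝ → ℝ) (J : Set ℝ) :
    Prop where
  p₀ : Profile I₀ F₀ ρ₀
  p₁ : Profile I₁ F₁ ρ₁
  ord : J.OrdConnected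
  pair_lt : ∀ x ∈ J, x ∈ I₀ → ∀ y ∈ J, y ∈ I₁ → F₀ x = F₁ y → x < y
  fwd : ∀ x ∈ J, x ∈ I₀ → F₀ x < 1 → ∃ y ∈ J, y ∈ I₁ ∧ F₁ y = F₀ x
  bwd : ∀ y ∈ J, y ∈ I₁ → 0 < F₁ y → ∃ x ∈ J, x ∈ I₀ ∧ F₀ x = F₁ y
  lower : ∀ z ∈ J, ∀ x ∈ I₀, z ≤ x → z ∈ I₀
  upper : ∀ z ∈ J, ∀ y ∈ I₁, y ≤ z → z ∈ I₁
  base : ∃ x ∈ J, x ∈ I₀ ∧ ∃ y ∈ J, y ∈ I₁ ∧ F₀ x = F₁ y ∧ 0 < F₀ x ∧ F₀ x < 1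

theorem PosComp.reflect {I₀ I₁ J : Set ℝ} {F₀ F₁ ρ₀ ρ₁ : ℝ → ℝ}
    (h : PosComp I₀ F₀ ρ₀ I₁ F₁ ρ₁ J) :
    PosComp (Neg.neg ⁻¹' I₁) (fun x => 1 - F₁ (-x)) (fun x => ρ₁ (-x))
      (Neg.neg ⁻¹' I₀) (fun x => 1 - F₀ (-x)) (fun x => ρ₀ (-x)) (Neg.neg ⁻¹' J) where
  p₀ := h.p₁.reflect
  p₁ := h.p₀.reflect
  ord := ⟨fun x hx y hy z hz => h.ord.out hy hx ⟨neg_le_neg hz.2, neg_le_neg hz.1⟩⟩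
  pair_lt := fun x hx hxI y hy hyI e =>
    neg_lt_neg_iff.1 (h.pair_lt _ hy hyI _ hx hxI (by linarith))
  fwd := by
    intro x hx hxI hlt
    obtain ⟨y, hy, hyI, e⟩ := h.bwd _ hx hxI (by linarith)
    exact ⟨-y, by simpa using hy, by simpa using hyI, by simp [e]⟩
  bwd := by
    intro x hx hxI hlt
    obtain ⟨y, hy, hyI, e⟩ := h.fwd _ hx hxI (by linarith)
    exact ⟨-y, by simpa using hy, by simpa using hyI, by simp [e]⟩
  lower := fun z hz x hx hzx => h.upper _ hz _ hx (neg_le_neg hzx)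
  upper := fun z hz x hx hzx => h.lower _ hz _ hx (neg_le_neg hzx)
  base := by
    obtain ⟨x, hx, hxI, y, hy, hyI, e, h0, h1⟩ := h.base
    exact ⟨-y, by simpa using hy, by simpa using hyI, -x, by simpa using hx, by simpa using hxI,
      by simp [e], by simp [← e, h1], by simp [← e, h0]⟩

namespace PosComp

variable {I₀ I₁ J : Set ℝ} {F₀ F₁ ρ₀ ρ₁ : ℝ → ℝ}

theorem sigma_spec (h : PosComp I₀ F₀ ρ₀ I₁ F₁ ρ₁ J) {y : ℝ} (hy : y ∈ J) (hyI : y ∈ I₁)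
    (h0 : 0 < F₁ y) :
    Function.invFunOn F₀ I₀ (F₁ y) ∈ J ∧ Function.invFunOn F₀ I₀ (F₁ y) ∈ I₀ ∧
      F₀ (Function.invFunOn F₀ I₀ (F₁ y)) = F₁ y ∧ Function.invFunOn F₀ I₀ (F₁ y) < y := by
  obtain ⟨x, hx, hxI, e⟩ := h.bwd y hy hyI h0
  have e' : Function.invFunOn F₀ I₀ (F₁ y) = x := by rw [← e, h.p₀.invFunOn_apply hxI]
  rw [e']
  exact ⟨hx, hxI, e, h.pair_lt x hx hxI y hy hyI e⟩

theorem tau_spec (h : PosComp I₀ F₀ ρ₀ I₁ F₁ ρ₁ J) {x : ℝ} (hx : x ∈ J) (hxI : x ∈ I₀)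
    (h1 : F₀ x < 1) :
    Function.invFunOn F₁ I₁ (F₀ x) ∈ J ∧ Function.invFunOn F₁ I₁ (F₀ x) ∈ I₁ ∧
      F₁ (Function.invFunOn F₁ I₁ (F₀ x)) = F₀ x ∧ x < Function.invFunOn F₁ I₁ (F₀ x) := by
  obtain ⟨y, hy, hyI, e⟩ := h.fwd x hx hxI h1
  have e' : Function.invFunOn F₁ I₁ (F₀ x) = y := by rw [← e, h.p₁.invFunOn_apply hyI]
  rw [e']
  exact ⟨hy, hyI, e, h.pair_lt x hx hxI y hy hyI e.symm⟩

/-- At the right end `b` of a component, the transport contracts: `ρ₀ b ≤ ρ₁ b`. -/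
theorem density_le (h : PosComp I₀ F₀ ρ₀ I₁ F₁ ρ₁ J) {x b : ℝ} (hxb : x < b)
    (hsub : Ico x b ⊆ J) (hxI : x ∈ I₁) (hb₀ : b ∈ I₀) (hb₁ : b ∈ I₁) (hb : F₀ b = F₁ b) :
    ρ₀ b ≤ ρ₁ b := by
  by_contra! hcon
  have hxI₀ : x ∈ I₀ := h.lower x (hsub ⟨le_rfl, hxb⟩) b hb₀ hxb.le
  have hs₀ : Icc x b ⊆ I₀ := h.p₀.ord.out hxI₀ hb₀
  have hs₁ : Icc x b ⊆ I₁ := h.p₁.ord.out hxI hb₁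
  have hcont : ContinuousOn (fun z => ρ₀ z - ρ₁ z) (Icc x b) :=
    (h.p₀.contρ.mono hs₀).sub (h.p₁.contρ.mono hs₁)
  have hev : ∀ᶠ z in 𝓝[<] b, 0 < ρ₀ z - ρ₁ z := by
    have h1 := (hcont b ⟨hxb.le, le_rfl⟩).eventually (lt_mem_nhds (sub_pos.2 hcon))
    rw [nhdsWithin_Icc_eq_nhdsLE hxb] at h1
    exact nhdsWithin_mono _ Iio_subset_Iic_self h1
  obtain ⟨l, hl, hls⟩ := (mem_nhdsLT_iff_exists_Ico_subset).1 hev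
  set c := max l x with hc
  have hcb : c < b := max_lt hl hxb
  have hxc : x ≤ c := le_max_right _ _
  have hcJ : c ∈ J := hsub ⟨hxc, hcb⟩
  have hcI₀ : c ∈ I₀ := hs₀ ⟨hxc, hcb.le⟩
  have hcI₁ : c ∈ I₁ := hs₁ ⟨hxc, hcb.le⟩
  obtain ⟨-, hτI, hτe, hτ⟩ := h.tau_spec hcJ hcI₀
    ((h.p₀.strict hcI₀ hb₀ hcb).trans_le (h.p₀.le_one b))
  have hlt := h.p₁.strict hcI₁ hτI hτ
  rw [hτe] at hlt
  have hint : ∀ z ∈ Ioo c b, HasDerivAt (fun z => F₀ z - F₁ z) (ρ₀ z - ρ₁ z) z := by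
    intro z hz
    have hz' : Ioo c b ⊆ Icc x b := fun w hw => ⟨hxc.trans hw.1.le, hw.2.le⟩
    exact (h.p₀.deriv z (interior_maximal (hz'.trans hs₀) isOpen_Ioo hz)).sub
      (h.p₁.deriv z (interior_maximal (hz'.trans hs₁) isOpen_Ioo hz))
  obtain ⟨ξ, hξ, e⟩ := exists_hasDerivAt_eq_slope (fun z => F₀ z - F₁ z) (fun z => ρ₀ z - ρ₁ z) hcb
    (h.p₀.cont.sub h.p₁.cont).continuousOn hint
  have h1 : 0 < ρ₀ ξ - ρ₁ ξ := hls ⟨(le_max_left _ _).trans hξ.1.le, hξ.2⟩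
  simp only [hb, sub_self, zero_sub] at e
  rw [e, lt_div_iff₀ (sub_pos.2 hcb)] at h1
  linarith

/-- Extension of a velocity from a fundamental domain to everything on its right. -/
theorem exists_right (h : PosComp I₀ F₀ ρ₀ I₁ F₁ ρ₁ J) {x₀ x₁ : ℝ} (hx₀ : x₀ ∈ J)
    (hx₀I : x₀ ∈ I₀) (hx₁ : x₁ ∈ J) (hx₁I : x₁ ∈ I₁) (he : F₀ x₀ = F₁ x₁) (h0 : 0 < F₀ x₀)
    {v₀ : ℝ → ℝ} (hv₀ : ContinuousOn v₀ (Icc x₀ x₁)) (hv₀pos : ∀ y ∈ Icc x₀ x₁, 0 < v₀ y)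
    (hcompat : v₀ x₁ * ρ₁ x₁ = v₀ x₀ * ρ₀ x₀) :
    ∃ v : ℝ → ℝ, EqOn v v₀ (Icc x₀ x₁) ∧ (∀ y ∈ J, x₀ ≤ y → 0 < v y) ∧
      ContinuousOn v (J ∩ Ici x₀) ∧
      (∀ x ∈ J, x ∈ I₀ → ∀ y ∈ J, y ∈ I₁ → F₀ x = F₁ y → x₀ ≤ x → v y * ρ₁ y = v x * ρ₀ x) ∧
      (LipOn v₀ (Icc x₀ x₁) → LipOn ρ₀ I₀ → LipOn ρ₁ I₁ → ∀ q ∈ J, LipOn v (Icc x₀ q)) ∧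
      (∀ b ∈ I₀, b ∈ I₁ → F₀ b = F₁ b → x₁ < b → Ico x₀ b ⊆ J → ρ₀ b ≠ ρ₁ b →
        Tendsto v (𝓝[<] b) (𝓝 0) ∧
        (LipOn v₀ (Icc x₀ x₁) → LipOn ρ₀ I₀ → LipOn ρ₁ I₁ → LipOn v (Ico x₀ b))) := by
  have hlt : x₀ < x₁ := h.pair_lt _ hx₀ hx₀I _ hx₁ hx₁I he
  set σ : ℝ → ℝ := fun y => Function.invFunOn F₀ I₀ (F₁ y) with hσdef
  set K := J ∩ Ici x₀ with hKdef
  have hK : K.OrdConnected := h.ord.inter ordConnected_Ici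
  have hyI : ∀ y ∈ J, x₁ ≤ y → y ∈ I₁ := fun y hy hy1 => h.upper y hy x₁ hx₁I hy1
  have hσ : ∀ y ∈ K, x₁ ≤ y → σ y ∈ J ∧ σ y ∈ I₀ ∧ F₀ (σ y) = F₁ y ∧ σ y < y := by
    intro y hy hy1
    exact h.sigma_spec hy.1 (hyI y hy.1 hy1) ((he ▸ h0).trans_le (h.p₁.mono hy1))
  have hσcont : ContinuousOn σ (K ∩ Ici x₁) :=
    continuousOn_of_comp_strictMonoOn h.p₀.ord h.p₀.strict (fun y hy => (hσ y hy.1 hy.2).2.1)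
      (h.p₁.cont.continuousOn.congr fun y hy => (hσ y hy.1 hy.2).2.2.1)
  have hσmono : MonotoneOn σ (K ∩ Ici x₁) := by
    intro y hy z hz hyz
    obtain ⟨-, hyI, hye, -⟩ := hσ y hy.1 hy.2
    obtain ⟨-, hzI, hze, -⟩ := hσ z hz.1 hz.2
    rw [← h.p₀.strict.le_iff_le hyI hzI, hye, hze]
    exact h.p₁.mono hyz
  have hσx₁ : σ x₁ = x₀ := by rw [hσdef]; simp only; rw [← he, h.p₀.invFunOn_apply hx₀I]
  have hx₁K : x₁ ∈ K := ⟨hx₁, hlt.le⟩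
  have hσK : ∀ y ∈ K, x₁ ≤ y → σ y ∈ K := fun y hy hy1 =>
    ⟨(hσ y hy hy1).1, by
      rw [← hσx₁]; exact hσmono ⟨hx₁K, self_mem_Ici⟩ ⟨hy, hy1⟩ hy1⟩
  have hρ₁pos : ∀ y ∈ J, x₁ ≤ y → 0 < ρ₁ y := fun y hy hy1 => h.p₁.pos y (hyI y hy hy1)
  have hscont : ContinuousOn (fun y => ρ₀ (σ y) * (ρ₁ y)⁻¹) (K ∩ Ici x₁) :=
    (h.p₀.contρ.comp hσcont fun y hy => (hσ y hy.1 hy.2).2.1).mul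
      ((h.p₁.contρ.mono fun y hy => hyI y hy.1.1 hy.2).inv₀
        fun y hy => (hρ₁pos y hy.1.1 hy.2).ne')
  obtain ⟨v, hE, hpos, hcont, hfe, hLip⟩ := exists_ladder (σ := σ)
    (s := fun y => ρ₀ (σ y) * (ρ₁ y)⁻¹) hK (x₀ := x₀) (x₁ := x₁) (fun y hy => hy.2)
    ⟨hx₀, self_mem_Ici⟩ hx₁K hσcont hσK hσmono (fun y hy hy1 => (hσ y hy hy1).2.2.2) hscont
    (fun y hy hy1 => mul_pos (h.p₀.pos _ (hσ y hy hy1).2.1) (inv_pos.2 (hρ₁pos y hy.1 hy1)))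
    hv₀ hv₀pos hσx₁
    (by
      have h1 := (hρ₁pos x₁ hx₁ le_rfl).ne'
      rw [hσx₁, ← mul_assoc, ← hcompat, mul_assoc, mul_inv_cancel₀ h1, mul_one])
  have hsub : ∀ q ∈ J, x₁ ≤ q → Icc x₁ q ⊆ K ∩ Ici x₁ := fun q hq h1 z hz =>
    ⟨⟨h.ord.out hx₁ hq hz, hlt.le.trans hz.1⟩, hz.1⟩
  have hpair : ∀ x ∈ J, x ∈ I₀ → ∀ y ∈ J, y ∈ I₁ → F₀ x = F₁ y → x₀ ≤ x →
      v y * ρ₁ y = v x * ρ₀ x := by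
    intro x hx hxI y hy hyI e hx0
    have hy1 : x₁ ≤ y := by
      rw [← h.p₁.strict.le_iff_le hx₁I hyI, ← he, ← e]
      exact h.p₀.mono hx0
    have hσy : σ y = x := by rw [hσdef]; simp only; rw [← e, h.p₀.invFunOn_apply hxI]
    rw [hfe y ⟨hy, hlt.le.trans hy1⟩ hy1, hσy, mul_assoc, mul_assoc,
      inv_mul_cancel₀ (hρ₁pos y hy hy1).ne', mul_one]
  have hvLip : LipOn v₀ (Icc x₀ x₁) → LipOn ρ₀ I₀ → LipOn ρ₁ I₁ →
      ∀ q ∈ J, LipOn v (Icc x₀ q) := by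
    intro hL hL₀ hL₁ q hq
    rcases lt_or_ge q x₁ with hq1 | hq1
    · exact (hL.congr hE).mono (Icc_subset_Icc_right hq1.le)
    have hσL : ∀ q ∈ K, LipOn σ (Icc x₁ q) := by
      intro q hq
      rcases lt_or_ge q x₁ with hq1 | hq1
      · exact ⟨0, le_rfl, fun x hx => absurd (hx.1.trans hx.2) hq1.not_ge⟩
      refine lipOn_of_comp_eq h.p₀ h.p₁ (g := σ) hx₀I (hσ q hq hq1).2.1 hx₁I (hyI q hq.1 hq1)
        (fun y hy => ⟨(hσK y (hsub q hq.1 hq1 hy).1 hy.1).2,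
          hσmono (hsub q hq.1 hq1 hy) ⟨hq, hq1⟩ hy.2⟩)
        fun y hy => (hσ y (hsub q hq.1 hq1 hy).1 hy.1).2.2.1
    refine hLip hL hσL ?_ q ⟨hq, hlt.le.trans hq1⟩
    intro q hq
    rcases lt_or_ge q x₁ with hq1 | hq1
    · exact ⟨0, le_rfl, fun x hx => absurd (hx.1.trans hx.2) hq1.not_ge⟩
    have hs₁ : Icc x₁ q ⊆ I₁ := fun y hy => hyI y (hsub q hq.1 hq1 hy).1.1 hy.1
    have hL1 : LipOn (fun y => ρ₀ (σ y)) (Icc x₁ q) :=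
      hL₀.comp (hσL q hq) fun y hy => (hσ y (hsub q hq.1 hq1 hy).1 hy.1).2.1
    have hL2 : LipOn (fun y => (ρ₁ y)⁻¹) (Icc x₁ q) := (hL₁.mono hs₁).inv
      (exists_pos_le_of_continuousOn_Icc (h.p₁.contρ.mono hs₁) fun y hy => h.p₁.pos y (hs₁ hy))
    exact hL1.mul hL2 (exists_abs_le_of_continuousOn_Icc hL1.continuousOn)
      (exists_abs_le_of_continuousOn_Icc hL2.continuousOn)
  refine ⟨v, hE, fun y hy hy0 => hpos y ⟨hy, hy0⟩, hcont, hpair, hvLip, ?_⟩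
  intro b hb₀ hb₁ hb hx₁b hsubJ hne
  have hx₀b : x₀ < b := hlt.trans hx₁b
  have hρlt : ρ₀ b < ρ₁ b := lt_of_le_of_ne
    (h.density_le hx₁b (fun z hz => hsubJ ⟨hlt.le.trans hz.1, hz.2⟩) hx₁I hb₀ hb₁ hb) hne
  have hs₀ : Icc x₀ b ⊆ I₀ := h.p₀.ord.out hx₀I hb₀
  set τ : ℝ → ℝ := fun x => Function.invFunOn F₁ I₁ (F₀ x) with hτdef
  have hlt1 : ∀ x ∈ Ico x₀ b, F₀ x < F₀ b := fun x hx =>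
    h.p₀.strict (hs₀ ⟨hx.1, hx.2.le⟩) hb₀ hx.2
  have hτ : ∀ x ∈ Ico x₀ b, τ x ∈ J ∧ τ x ∈ I₁ ∧ F₁ (τ x) = F₀ x ∧ x < τ x := fun x hx =>
    h.tau_spec (hsubJ hx) (hs₀ ⟨hx.1, hx.2.le⟩) ((hlt1 x hx).trans_le (h.p₀.le_one b))
  have hτb : τ b = b := by rw [hτdef]; simp only; rw [hb, h.p₁.invFunOn_apply hb₁]
  have hτI : ∀ x ∈ Icc x₀ b, τ x ∈ I₁ ∧ F₁ (τ x) = F₀ x := by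
    intro x hx
    rcases hx.2.eq_or_lt with rfl | hxb
    · rw [hτb]; exact ⟨hb₁, hb.symm⟩
    · exact ⟨(hτ x ⟨hx.1, hxb⟩).2.1, (hτ x ⟨hx.1, hxb⟩).2.2.1⟩
  have hτcont : ContinuousOn τ (Icc x₀ b) :=
    continuousOn_of_comp_strictMonoOn h.p₁.ord h.p₁.strict (fun x hx => (hτI x hx).1)
      (h.p₀.cont.continuousOn.congr fun x hx => (hτI x hx).2)
  have hτmono : MonotoneOn τ (Icc x₀ b) := by
    intro x hx y hy hxy
    rw [← h.p₁.strict.le_iff_le (hτI x hx).1 (hτI y hy).1, (hτI x hx).2, (hτI y hy).2]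
    exact h.p₀.mono hxy
  have hτltb : ∀ x ∈ Ico x₀ b, τ x < b := by
    intro x hx
    rw [← h.p₁.strict.lt_iff_lt (hτ x hx).2.1 hb₁, (hτ x hx).2.2.1, ← hb]
    exact hlt1 x hx
  set t : ℝ → ℝ := fun x => ρ₀ x * (ρ₁ (τ x))⁻¹ with htdef
  have htcont : ContinuousOn t (Icc x₀ b) := (h.p₀.contρ.mono hs₀).mul
    ((h.p₁.contρ.comp hτcont fun x hx => (hτI x hx).1).inv₀
      fun x hx => (h.p₁.pos _ (hτI x hx).1).ne')
  have htpos : ∀ x ∈ Icc x₀ b, 0 < t x := fun x hx =>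
    mul_pos (h.p₀.pos x (hs₀ hx)) (inv_pos.2 (h.p₁.pos _ (hτI x hx).1))
  have htb : t b < 1 := by
    rw [htdef]
    simp only [hτb]
    rwa [← div_eq_mul_inv, div_lt_one (h.p₁.pos b hb₁)]
  obtain ⟨r, hr, hr1⟩ := exists_between htb
  have hev : ∀ᶠ z in 𝓝[<] b, t z < r := by
    have h1 := (htcont b ⟨hx₀b.le, le_rfl⟩).eventually (gt_mem_nhds hr)
    rw [nhdsWithin_Icc_eq_nhdsLE hx₀b] at h1
    exact nhdsWithin_mono _ Iio_subset_Iic_self h1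
  obtain ⟨l, hl, hls⟩ := (mem_nhdsLT_iff_exists_Ico_subset).1 hev
  set c := max l x₁ with hc
  have hcb : c < b := max_lt hl hx₁b
  have hx₁c : x₁ ≤ c := le_max_right _ _
  have hx₀c : x₀ ≤ c := hlt.le.trans hx₁c
  have hcsub : Ico c b ⊆ Ico x₀ b := Ico_subset_Ico_left hx₀c
  have hcsub' : Icc c b ⊆ Icc x₀ b := Icc_subset_Icc_left hx₀c
  have hend := ladder_end (c := c) (b := b) (r := r) (τ := τ) (t := t) (v := v) hcb hr1
    (hτcont.mono fun z hz => ⟨hx₀c.trans hz.1, hz.2.le⟩)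
    (fun x hx => ⟨hx.1.trans (hτ x (hcsub hx)).2.2.2.le, hτltb x (hcsub hx)⟩)
    (fun x hx => (hτ x (hcsub hx)).2.2.2)
    (fun x hx => by
      have hxI : x ∈ Ico x₀ b := hcsub ⟨hx.1.le, hx.2⟩
      have hint : x ∈ interior I₀ := interior_maximal
        (fun z hz => hs₀ ⟨hx₀c.trans hz.1.le, hz.2.le⟩ : Ioo c b ⊆ I₀) isOpen_Ioo hx
      have hm : F₀ x ∈ Ioo (0 : ℝ) 1 :=
        ⟨h0.trans_le (h.p₀.mono hxI.1), (hlt1 x hxI).trans_le (h.p₀.le_one b)⟩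
      have := (h.p₁.hasDerivAt_invFunOn hm).comp x (h.p₀.deriv x hint)
      rw [mul_comm] at this
      exact this)
    (fun x hx => htpos x ⟨(hcsub hx).1, hx.2.le⟩)
    (fun x hx => le_of_lt (hls ⟨(le_max_left _ _).trans hx.1, hx.2⟩))
    (hcont.mono fun z hz => ⟨hsubJ (hcsub hz), (hcsub hz).1⟩)
    (fun x hx => by
      have hxI := hcsub hx
      obtain ⟨h1, h2, h3, -⟩ := hτ x hxI
      have h4 := hpair x (hsubJ hxI) (hs₀ ⟨hxI.1, hxI.2.le⟩) _ h1 h2 h3.symm hxI.1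
      have h5 := (h.p₁.pos _ h2).ne'
      rw [htdef]
      simp only
      rw [← mul_assoc, ← h4, mul_assoc, mul_inv_cancel₀ h5, mul_one])
  refine ⟨hend.1, fun hL hL₀ hL₁ => ?_⟩
  have hcI : c ∈ Ico x₀ b := ⟨hx₀c, hcb⟩
  have hcI₁ : c ∈ I₁ := hyI c (hsubJ hcI) hx₁c
  have hτL : LipOn τ (Icc c b) := by
    refine lipOn_of_comp_eq h.p₁ h.p₀ (g := τ) hcI₁ hb₁ (hs₀ ⟨hx₀c, hcb.le⟩) hb₀ ?_
      fun x hx => (hτI x (hcsub' hx)).2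
    intro x hx
    refine ⟨?_, ?_⟩
    · exact (hτ c hcI).2.2.2.le.trans (hτmono ⟨hx₀c, hcb.le⟩ (hcsub' hx) hx.1)
    · exact (hτmono (hcsub' hx) ⟨hx₀b.le, le_rfl⟩ hx.2).trans_eq hτb
  have hL2 : LipOn (fun x => (ρ₁ (τ x))⁻¹) (Icc c b) := by
    refine LipOn.inv (hL₁.comp hτL fun x hx => (hτI x (hcsub' hx)).1) ?_
    exact exists_pos_le_of_continuousOn_Icc
      (h.p₁.contρ.comp (hτcont.mono hcsub') fun x hx => (hτI x (hcsub' hx)).1)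
      fun x hx => h.p₁.pos _ (hτI x (hcsub' hx)).1
  have hL1 : LipOn ρ₀ (Icc c b) := hL₀.mono (hcsub'.trans hs₀)
  have htL : LipOn t (Icc c b) :=
    hL1.mul hL2 (exists_abs_le_of_continuousOn_Icc hL1.continuousOn)
      (exists_abs_le_of_continuousOn_Icc hL2.continuousOn)
  obtain ⟨κ, hκ, hκt⟩ := exists_pos_le_of_continuousOn_Icc (htcont.mono hcsub')
    fun x hx => htpos x (hcsub' hx)
  refine LipOn.glue (m := c) hcI ((hvLip hL hL₀ hL₁ c (hsubJ hcI)).mono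
    fun z hz => ⟨hz.1.1, hz.2⟩) (LipOn.mono (t := Ico c b) ?_ fun z hz => ⟨hz.2, hz.1.2⟩)
  exact hend.2 (htL.mono Ico_subset_Icc_self)
    ⟨κ, hκ, fun x hx => hκt x (Ico_subset_Icc_self hx)⟩
    ((hvLip hL hL₀ hL₁ _ (hτ c hcI).1).mono (Icc_subset_Icc_left hx₀c))

/-- Extension of a velocity from a fundamental domain to everything on its left. -/
theorem exists_left (h : PosComp I₀ F₀ ρ₀ I₁ F₁ ρ₁ J) {x₀ x₁ : ℝ} (hx₀ : x₀ ∈ J)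
    (hx₀I : x₀ ∈ I₀) (hx₁ : x₁ ∈ J) (hx₁I : x₁ ∈ I₁) (he : F₀ x₀ = F₁ x₁) (h1 : F₀ x₀ < 1)
    {v₀ : ℝ → ℝ} (hv₀ : ContinuousOn v₀ (Icc x₀ x₁)) (hv₀pos : ∀ y ∈ Icc x₀ x₁, 0 < v₀ y)
    (hcompat : v₀ x₁ * ρ₁ x₁ = v₀ x₀ * ρ₀ x₀) :
    ∃ v : ℝ → ℝ, EqOn v v₀ (Icc x₀ x₁) ∧ (∀ y ∈ J, y ≤ x₁ → 0 < v y) ∧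
      ContinuousOn v (J ∩ Iic x₁) ∧
      (∀ x ∈ J, x ∈ I₀ → ∀ y ∈ J, y ∈ I₁ → F₀ x = F₁ y → y ≤ x₁ → v y * ρ₁ y = v x * ρ₀ x) ∧
      (LipOn v₀ (Icc x₀ x₁) → LipOn ρ₀ I₀ → LipOn ρ₁ I₁ → ∀ q ∈ J, LipOn v (Icc q x₁)) ∧
      (∀ b ∈ I₀, b ∈ I₁ → F₀ b = F₁ b → b < x₀ → Ioc b x₁ ⊆ J → ρ₀ b ≠ ρ₁ b →
        Tendsto v (𝓝[>] b) (𝓝 0) ∧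
        (LipOn v₀ (Icc x₀ x₁) → LipOn ρ₀ I₀ → LipOn ρ₁ I₁ → LipOn v (Ioc b x₁))) := by
  have hneg : ∀ s : Set ℝ, LipOn (fun x : ℝ => -x) s := fun s =>
    ⟨1, zero_le_one, fun x _ y _ => by rw [one_mul, neg_sub_neg, abs_sub_comm]⟩
  have hLneg : ∀ {f : ℝ → ℝ} {s t : Set ℝ}, LipOn f t → (∀ x ∈ s, -x ∈ t) →
      LipOn (fun x => f (-x)) s := fun hf hst => hf.comp (hneg _) hst
  have hIcc : ∀ y : ℝ, y ∈ Icc (-x₁) (-x₀) → -y ∈ Icc x₀ x₁ := fun y hy =>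
    ⟨by linarith [hy.2], by linarith [hy.1]⟩
  obtain ⟨w, hE, hpos, hcont, hpair, hLip, hend⟩ := h.reflect.exists_right
    (x₀ := -x₁) (x₁ := -x₀) (v₀ := fun y => v₀ (-y)) (by simpa using hx₁) (by simpa using hx₁I)
    (by simpa using hx₀) (by simpa using hx₀I) (by simp [he]) (by simp [← he, h1])
    (hv₀.comp continuous_neg.continuousOn hIcc) (fun y hy => hv₀pos _ (hIcc y hy))
    (by simpa using hcompat.symm)
  refine ⟨fun y => w (-y), fun y hy => ?_, fun y hy hy1 => ?_, ?_, ?_, ?_, ?_⟩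
  · have := hE (x := -y) ⟨neg_le_neg hy.2, neg_le_neg hy.1⟩
    simpa using this
  · exact hpos (-y) (by simpa using hy) (neg_le_neg hy1)
  · exact hcont.comp continuous_neg.continuousOn fun y hy =>
      ⟨by simpa using hy.1, neg_le_neg (mem_Iic.1 hy.2)⟩
  · intro x hx hxI y hy hyI e hy1
    have := hpair (-y) (by simpa using hy) (by simpa using hyI) (-x) (by simpa using hx)
      (by simpa using hxI) (by simp [e]) (neg_le_neg hy1)
    simpa using this.symm
  · intro hL hL₀ hL₁ q hq
    have := hLip (hLneg hL hIcc) (hLneg hL₁ fun x hx => hx) (hLneg hL₀ fun x hx => hx) (-q)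
      (by simpa using hq)
    exact hLneg this fun x hx => ⟨neg_le_neg hx.2, neg_le_neg hx.1⟩
  · intro b hb₀ hb₁ hb hbx hsub hne
    have := hend (-b) (by simpa using hb₁) (by simpa using hb₀) (by simp [hb]) (neg_lt_neg hbx)
      (fun z hz => hsub ⟨by linarith [hz.2], by linarith [hz.1]⟩) (by simpa using hne.symm)
    refine ⟨this.1.comp ?_, fun hL hL₀ hL₁ => ?_⟩
    · exact tendsto_neg_nhdsGT
    · exact hLneg (this.2 (hLneg hL hIcc) (hLneg hL₁ fun x hx => hx) (hLneg hL₀ fun x hx => hx))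
        fun x hx => ⟨neg_le_neg hx.2, neg_lt_neg hx.1⟩

end PosComp

/-- `v` is a velocity field on the component `J`, and `A` a primitive of `1 / v` on `J` (the time
coordinate of the flow), such that the time one map of `v` is the monotone transport. -/
structure TransportField (I₀ : Set ℝ) (F₀ ρ₀ : ℝ → ℝ) (I₁ : Set ℝ) (F₁ ρ₁ : ℝ → ℝ) (J : Set ℝ)
    (v A : ℝ → ℝ) : Prop where
  sign : (∀ y ∈ J, 0 < v y) ∨ ∀ y ∈ J, v y < 0
  cont : ContinuousOn v J
  deriv : ∀ y ∈ J, HasDerivWithinAt A (v y)⁻¹ J y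
  pair : ∀ x ∈ J, x ∈ I₀ → ∀ y ∈ J, y ∈ I₁ → F₀ x = F₁ y → A y = A x + 1
  unbounded : ∀ b ∈ I₀, b ∈ I₁ → F₀ b = F₁ b → b ∉ J →
    Tendsto (fun z => |A z|) (𝓝[J] b) atTop
  lip : LipOn ρ₀ I₀ → LipOn ρ₁ I₁ → ∀ p ∈ J, ∀ q ∈ J, LipOn v (Icc p q)
  end_left : ∀ b ∈ I₀, b ∈ I₁ → F₀ b = F₁ b → ρ₀ b ≠ ρ₁ b → ∀ z < b, Ico z b ⊆ J → b ∉ J →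
    Tendsto v (𝓝[<] b) (𝓝 0) ∧ (LipOn ρ₀ I₀ → LipOn ρ₁ I₁ → LipOn v (Ico z b))
  end_right : ∀ b ∈ I₀, b ∈ I₁ → F₀ b = F₁ b → ρ₀ b ≠ ρ₁ b → ∀ z > b, Ioc b z ⊆ J → b ∉ J →
    Tendsto v (𝓝[>] b) (𝓝 0) ∧ (LipOn ρ₀ I₀ → LipOn ρ₁ I₁ → LipOn v (Ioc b z))

theorem exists_Icc_mem_nhdsWithin {J : Set ℝ} {z : ℝ} (hz : z ∈ J) :
    ∃ p ∈ J, ∃ q ∈ J, z ∈ Icc p q ∧ Icc p q ∈ 𝓝[J] z := by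
  have hl : ∃ p ∈ J, p ≤ z ∧ Ici p ∈ 𝓝[J] z := by
    by_cases h : ∃ p ∈ J, p < z
    · obtain ⟨p, hp, hpz⟩ := h
      exact ⟨p, hp, hpz.le, mem_nhdsWithin_of_mem_nhds (Ici_mem_nhds hpz)⟩
    · push Not at h
      exact ⟨z, hz, le_rfl, mem_of_superset self_mem_nhdsWithin h⟩
  have hr : ∃ q ∈ J, z ≤ q ∧ Iic q ∈ 𝓝[J] z := by
    by_cases h : ∃ q ∈ J, z < q
    · obtain ⟨q, hq, hqz⟩ := h
      exact ⟨q, hq, hqz.le, mem_nhdsWithin_of_mem_nhds (Iic_mem_nhds hqz)⟩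
    · push Not at h
      exact ⟨z, hz, le_rfl, mem_of_superset self_mem_nhdsWithin h⟩
  obtain ⟨p, hp, hpz, hpn⟩ := hl
  obtain ⟨q, hq, hqz, hqn⟩ := hr
  exact ⟨p, hp, q, hq, ⟨hpz, hqz⟩, inter_mem hpn hqn⟩

theorem ContinuousOn.integral_hasDerivWithinAt_of_ordConnected {J : Set ℝ} (hJ : J.OrdConnected)
    {f : ℝ → ℝ} (hf : ContinuousOn f J) {x₀ z : ℝ} (hx₀ : x₀ ∈ J) (hz : z ∈ J) :
    HasDerivWithinAt (fun u => ∫ x in x₀..u, f x) (f z) J z := by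
  obtain ⟨p, hp, q, hq, hzpq, hn⟩ := exists_Icc_mem_nhdsWithin hz
  have hsub : Icc p q ⊆ J := hJ.out hp hq
  have : Fact (z ∈ Icc p q) := ⟨hzpq⟩
  refine HasDerivWithinAt.mono_of_mem_nhdsWithin (s := J) (t := Icc p q) ?_ hn
  refine intervalIntegral.integral_hasDerivWithinAt_right (t := Icc p q)
    (hf.mono (hJ.uIcc_subset hx₀ hz)).intervalIntegrable ?_ ((hf z hz).mono hsub)
  exact (hf.mono hsub).stronglyMeasurableAtFilter_nhdsWithin measurableSet_Icc z

namespace PosComp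

variable {I₀ I₁ J : Set ℝ} {F₀ F₁ ρ₀ ρ₁ : ℝ → ℝ}

/-- The invariance of `dx / v` under the transport, in integrated form. -/
theorem sub_eq_sub (h : PosComp I₀ F₀ ρ₀ I₁ F₁ ρ₁ J) {v A : ℝ → ℝ}
    (hA : ∀ y ∈ J, HasDerivWithinAt A (v y)⁻¹ J y)
    (hpair : ∀ x ∈ J, x ∈ I₀ → ∀ y ∈ J, y ∈ I₁ → F₀ x = F₁ y → v y * ρ₁ y = v x * ρ₀ x)
    {x y x' y' : ℝ} (hx : x ∈ J) (hxI : x ∈ I₀) (hy : y ∈ J) (hyI : y ∈ I₁) (e : F₀ x = F₁ y)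
    (hx' : x' ∈ J) (hxI' : x' ∈ I₀) (hy' : y' ∈ J) (hyI' : y' ∈ I₁) (e' : F₀ x' = F₁ y')
    (hlt : x < x') : A y - A x = A y' - A x' := by
  have hm : F₀ x < F₀ x' := h.p₀.strict hxI hxI' hlt
  have hlty : y < y' := by rwa [← h.p₁.strict.lt_iff_lt hyI hyI', ← e, ← e']
  have main : ∀ {I : Set ℝ} {F ρ : ℝ → ℝ} (p : Profile I F ρ) {a b : ℝ}, a ∈ J → a ∈ I → b ∈ J →
      b ∈ I → a < b → (∀ m ∈ Icc (F a) (F b), Function.invFunOn F I m ∈ Icc a b ∧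
        Function.invFunOn F I m ∈ I ∧ F (Function.invFunOn F I m) = m) ∧
      ContinuousOn (fun m => A (Function.invFunOn F I m)) (Icc (F a) (F b)) ∧
      ∀ m ∈ Ioo (F a) (F b), HasDerivAt (fun m => A (Function.invFunOn F I m))
        ((v (Function.invFunOn F I m))⁻¹ * (ρ (Function.invFunOn F I m))⁻¹) m := by
    intro I F ρ p a b ha haI hb hbI hab
    have hsub : Icc a b ⊆ J := h.ord.out ha hb
    have himg : ∀ m ∈ Icc (F a) (F b), ∃ z ∈ Icc a b, F z = m := fun m hm =>
      intermediate_value_Icc hab.le p.cont.continuousOn hm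
    have hspec : ∀ m ∈ Icc (F a) (F b), Function.invFunOn F I m ∈ Icc a b ∧
        Function.invFunOn F I m ∈ I ∧ F (Function.invFunOn F I m) = m := by
      intro m hm
      obtain ⟨z, hz, rfl⟩ := himg m hm
      have hzI := p.ord.out haI hbI hz
      rw [p.invFunOn_apply hzI]
      exact ⟨hz, hzI, rfl⟩
    refine ⟨hspec, ?_, fun m hm => ?_⟩
    · have h1 : ContinuousOn A J := fun z hz => (hA z hz).continuousWithinAt
      refine h1.comp (p.continuousOn_invFunOn.mono ?_) fun m hm => hsub (hspec m hm).1
      intro m hm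
      exact ⟨_, (hspec m hm).2.1, (hspec m hm).2.2⟩
    · have hs := hspec m ⟨hm.1.le, hm.2.le⟩
      have hm01 : m ∈ Ioo (0 : ℝ) 1 :=
        ⟨(p.nonneg a).trans_lt hm.1, hm.2.trans_le (p.le_one b)⟩
      have hIoo : Function.invFunOn F I m ∈ Ioo a b := by
        constructor
        · rw [← p.strict.lt_iff_lt haI hs.2.1, hs.2.2]; exact hm.1
        · rw [← p.strict.lt_iff_lt hs.2.1 hbI, hs.2.2]; exact hm.2
      have hd := (hA _ (hsub hs.1)).hasDerivAt
        (mem_of_superset (Ioo_mem_nhds hIoo.1 hIoo.2) (Ioo_subset_Icc_self.trans hsub))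
      exact hd.comp m (p.hasDerivAt_invFunOn hm01)
  obtain ⟨hs0, hc0, hd0⟩ := main h.p₀ hx hxI hx' hxI' hlt
  obtain ⟨hs1, hc1, hd1⟩ := main h.p₁ hy hyI hy' hyI' hlty
  rw [← e, ← e'] at hs1 hc1 hd1
  obtain ⟨μ, hμ, hslope⟩ := exists_hasDerivAt_eq_slope _ _ hm (hc1.sub hc0)
    fun m hm => (hd1 m hm).sub (hd0 m hm)
  have hμ' : μ ∈ Icc (F₀ x) (F₀ x') := ⟨hμ.1.le, hμ.2.le⟩
  have hp := hpair _ (h.ord.out hx hx' (hs0 μ hμ').1) (hs0 μ hμ').2.1 _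
    (h.ord.out hy hy' (hs1 μ hμ').1) (hs1 μ hμ').2.1 ((hs0 μ hμ').2.2.trans (hs1 μ hμ').2.2.symm)
  rw [← mul_inv, ← mul_inv, hp, sub_self, eq_comm, div_eq_zero_iff] at hslope
  have h2 := hslope.resolve_right (sub_pos.2 hm).ne'
  simp only [Pi.sub_apply] at h2
  rw [h.p₀.invFunOn_apply hxI, h.p₀.invFunOn_apply hxI', e, h.p₁.invFunOn_apply hyI, e',
    h.p₁.invFunOn_apply hyI'] at h2
  linarith

/-- Iterating the transport forward from a point left of a fixed point. -/
theorem exists_forward (h : PosComp I₀ F₀ ρ₀ I₁ F₁ ρ₁ J) {A : ℝ → ℝ}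
    (hpair : ∀ x ∈ J, x ∈ I₀ → ∀ y ∈ J, y ∈ I₁ → F₀ x = F₁ y → A y = A x + 1) {b : ℝ}
    (hb : b ∈ I₀) (hJ : J ⊆ Iio b) : ∃ c, ∀ n : ℕ, ∃ x ∈ J, A x = c + n := by
  obtain ⟨x₀, hx₀, -⟩ := h.base
  refine ⟨A x₀, fun n => ?_⟩
  induction n with
  | zero => exact ⟨x₀, hx₀, by simp⟩
  | succ n ih =>
    obtain ⟨x, hx, e⟩ := ih
    have hxI := h.lower x hx b hb (hJ hx).le
    obtain ⟨y, hy, hyI, e'⟩ := h.fwd x hx hxI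
      ((h.p₀.strict hxI hb (hJ hx)).trans_le (h.p₀.le_one b))
    refine ⟨y, hy, ?_⟩
    rw [hpair x hx hxI y hy hyI e'.symm, e]
    push_cast; ring

end PosComp

section

variable {I₀ I₁ J : Set ℝ} {F₀ F₁ ρ₀ ρ₁ : ℝ → ℝ}

theorem PosComp.tendsto_abs_atTop (h : PosComp I₀ F₀ ρ₀ I₁ F₁ ρ₁ J) {A : ℝ → ℝ}
    (hmono : MonotoneOn A J)
    (hpair : ∀ x ∈ J, x ∈ I₀ → ∀ y ∈ J, y ∈ I₁ → F₀ x = F₁ y → A y = A x + 1) {b : ℝ}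
    (hb₀ : b ∈ I₀) (hb₁ : b ∈ I₁) (hbJ : b ∉ J) :
    Tendsto (fun z => |A z|) (𝓝[J] b) atTop := by
  have hdich : J ⊆ Iio b ∨ J ⊆ Ioi b := by
    by_contra! hcon
    obtain ⟨hl, hr⟩ := hcon
    rw [not_subset] at hl hr
    obtain ⟨p, hp, hpb⟩ := hl
    obtain ⟨q, hq, hqb⟩ := hr
    exact hbJ (h.ord.out hq hp ⟨not_lt.1 hqb, not_lt.1 hpb⟩)
  rw [tendsto_atTop]
  intro M
  rcases hdich with hJ | hJ
  · obtain ⟨c, hc⟩ := h.exists_forward hpair hb₀ hJ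
    obtain ⟨n, hn⟩ := exists_nat_ge (M - c)
    obtain ⟨x, hx, e⟩ := hc n
    filter_upwards [self_mem_nhdsWithin, mem_nhdsWithin_of_mem_nhds (Ioi_mem_nhds (hJ hx))]
      with z hz hxz
    have := hmono hx hz (le_of_lt hxz)
    exact le_trans (by linarith) (le_abs_self (A z))
  · obtain ⟨c, hc⟩ := h.reflect.exists_forward (A := fun z => -A (-z)) (b := -b)
      (fun x hx hxI y hy hyI e => by
        have := hpair _ hy hyI _ hx hxI (by linarith)
        linarith) (by simpa using hb₁) (fun z hz => mem_Iio.2 (lt_neg.2 (mem_Ioi.1 (hJ hz))))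
    obtain ⟨n, hn⟩ := exists_nat_ge (M - c)
    obtain ⟨x, hx, e⟩ := hc n
    filter_upwards [self_mem_nhdsWithin, mem_nhdsWithin_of_mem_nhds (Iio_mem_nhds (hJ hx))]
      with z hz hxz
    have := hmono hz hx (le_of_lt hxz)
    exact le_trans (by linarith) (neg_le_abs (A z))

theorem PosComp.exists_field (h : PosComp I₀ F₀ ρ₀ I₁ F₁ ρ₁ J) :
    ∃ v A, TransportField I₀ F₀ ρ₀ I₁ F₁ ρ₁ J v A := by
  obtain ⟨x₀, hx₀, hx₀I, x₁, hx₁, hx₁I, he, h0, h1⟩ := h.base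
  have hlt : x₀ < x₁ := h.pair_lt _ hx₀ hx₀I _ hx₁ hx₁I he
  have ha : 0 < ρ₁ x₁ := h.p₁.pos _ hx₁I
  have hb : 0 < ρ₀ x₀ := h.p₀.pos _ hx₀I
  set v₀ : ℝ → ℝ := fun y => (x₁ - y) * ρ₁ x₁ + (y - x₀) * ρ₀ x₀ with hv₀
  have hv₀c : ContinuousOn v₀ (Icc x₀ x₁) := by fun_prop
  have hv₀pos : ∀ y ∈ Icc x₀ x₁, 0 < v₀ y := by
    intro y hy
    rcases hy.2.eq_or_lt with rfl | hy1
    · simp only [hv₀, sub_self, zero_mul, zero_add]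
      exact mul_pos (sub_pos.2 hlt) hb
    · exact add_pos_of_pos_of_nonneg (mul_pos (sub_pos.2 hy1) ha)
        (mul_nonneg (sub_nonneg.2 hy.1) hb.le)
  have hv₀L : LipOn v₀ (Icc x₀ x₁) := by
    refine ⟨|ρ₀ x₀ - ρ₁ x₁|, abs_nonneg _, fun x _ y _ => le_of_eq ?_⟩
    rw [← abs_mul]
    congr 1
    simp only [hv₀]
    ring
  have hcompat : v₀ x₁ * ρ₁ x₁ = v₀ x₀ * ρ₀ x₀ := by simp only [hv₀]; ring
  obtain ⟨w, hwE, hwpos, hwc, hwp, hwL, hwe⟩ :=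
    h.exists_right hx₀ hx₀I hx₁ hx₁I he h0 hv₀c hv₀pos hcompat
  obtain ⟨u, huE, hupos, huc, hup, huL, hue⟩ :=
    h.exists_left hx₀ hx₀I hx₁ hx₁I he h1 hv₀c hv₀pos hcompat
  set g : ℝ → ℝ := fun y => if y ≤ x₁ then u y else w y with hg
  have hgu : ∀ y, y ≤ x₁ → g y = u y := fun y hy => if_pos hy
  have hgw : ∀ y, x₀ ≤ y → g y = w y := by
    intro y hy
    rcases le_or_gt y x₁ with hy1 | hy1
    · rw [hgu y hy1, huE ⟨hy, hy1⟩, hwE ⟨hy, hy1⟩]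
    · exact if_neg hy1.not_ge
  have hgpos : ∀ y ∈ J, 0 < g y := by
    intro y hy
    rcases le_total y x₁ with hy1 | hy1
    · rw [hgu y hy1]; exact hupos y hy hy1
    · rw [hgw y (hlt.le.trans hy1)]; exact hwpos y hy (hlt.le.trans hy1)
  have hgc : ContinuousOn g J := by
    intro y hy
    rcases lt_or_ge y x₁ with hy1 | hy1
    · refine ((huc.congr fun z hz => hgu z hz.2) y ⟨hy, hy1.le⟩).mono_of_mem_nhdsWithin ?_
      exact inter_mem self_mem_nhdsWithin (mem_nhdsWithin_of_mem_nhds (Iic_mem_nhds hy1))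
    · have hy0 := hlt.trans_le hy1
      refine ((hwc.congr fun z hz => hgw z hz.2) y ⟨hy, hy0.le⟩).mono_of_mem_nhdsWithin ?_
      exact inter_mem self_mem_nhdsWithin (mem_nhdsWithin_of_mem_nhds (Ici_mem_nhds hy0))
  have hgp : ∀ x ∈ J, x ∈ I₀ → ∀ y ∈ J, y ∈ I₁ → F₀ x = F₁ y → g y * ρ₁ y = g x * ρ₀ x := by
    intro x hx hxI y hy hyI e
    have hxy := h.pair_lt x hx hxI y hy hyI e
    rcases le_total x₀ x with hx0 | hx0
    · rw [hgw x hx0, hgw y (hx0.trans hxy.le)]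
      exact hwp x hx hxI y hy hyI e hx0
    · have hy1 : y ≤ x₁ := by
        rw [← h.p₁.strict.le_iff_le hyI hx₁I, ← e, ← he]
        exact h.p₀.mono hx0
      rw [hgu y hy1, hgu x (hxy.le.trans hy1)]
      exact hup x hx hxI y hy hyI e hy1
  have hgL : LipOn ρ₀ I₀ → LipOn ρ₁ I₁ → ∀ p ∈ J, ∀ q ∈ J, LipOn g (Icc p q) := by
    intro hL₀ hL₁ p hp q hq
    have hl : LipOn g (Icc p x₁) := (huL hv₀L hL₀ hL₁ p hp).congr fun z hz => hgu z hz.2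
    have hr : LipOn g (Icc x₀ q) := (hwL hv₀L hL₀ hL₁ q hq).congr fun z hz => hgw z hz.1
    rcases le_or_gt q x₁ with h1 | h1
    · exact hl.mono (Icc_subset_Icc_right h1)
    rcases le_or_gt x₁ p with h2 | h2
    · exact hr.mono (Icc_subset_Icc_left (hlt.le.trans h2))
    · exact LipOn.glue (m := x₁) ⟨h2.le, h1.le⟩ (hl.mono fun z hz => ⟨hz.1.1, hz.2⟩)
        (hr.mono fun z hz => ⟨hlt.le.trans hz.2, hz.1.2⟩)
  have hinvc : ContinuousOn (fun x => (g x)⁻¹) J := hgc.inv₀ fun y hy => (hgpos y hy).ne'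
  set B : ℝ → ℝ := fun z => ∫ x in x₀..z, (g x)⁻¹ with hB
  have hBd : ∀ y ∈ J, HasDerivWithinAt B (g y)⁻¹ J y := fun y hy =>
    hinvc.integral_hasDerivWithinAt_of_ordConnected h.ord hx₀ hy
  set c := B x₁ - B x₀ with hc
  have hBpair : ∀ x ∈ J, x ∈ I₀ → ∀ y ∈ J, y ∈ I₁ → F₀ x = F₁ y → B y - B x = c := by
    intro x hx hxI y hy hyI e
    rcases lt_trichotomy x x₀ with hlt | rfl | hlt
    · exact h.sub_eq_sub hBd hgp hx hxI hy hyI e hx₀ hx₀I hx₁ hx₁I he hlt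
    · rw [h.p₁.strict.injOn hyI hx₁I (e.symm.trans he)]
    · exact (h.sub_eq_sub hBd hgp hx₀ hx₀I hx₁ hx₁I he hx hxI hy hyI e hlt).symm
  have hBmono : StrictMonoOn B J := by
    refine strictMonoOn_of_hasDerivWithinAt_pos h.ord.convex
      (fun y hy => (hBd y hy).continuousWithinAt) (f' := fun y => (g y)⁻¹)
      (fun y hy => (hBd y (interior_subset hy)).mono interior_subset)
      fun y hy => inv_pos.2 (hgpos y (interior_subset hy))
  have hc0 : 0 < c := sub_pos.2 (hBmono hx₀ hx₁ hlt)
  have hApair : ∀ x ∈ J, x ∈ I₀ → ∀ y ∈ J, y ∈ I₁ → F₀ x = F₁ y → B y / c = B x / c + 1 := by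
    intro x hx hxI y hy hyI e
    have := hBpair x hx hxI y hy hyI e
    field_simp
    linarith
  refine ⟨fun y => c * g y, fun y => B y / c, ?_⟩
  refine
    { sign := Or.inl fun y hy => mul_pos hc0 (hgpos y hy)
      cont := continuousOn_const.mul hgc
      deriv := fun y hy => ?_
      pair := hApair
      unbounded := fun b hb₀ hb₁ _ hbJ => h.tendsto_abs_atTop ?_ hApair hb₀ hb₁ hbJ
      lip := fun hL₀ hL₁ p hp q hq => (hgL hL₀ hL₁ p hp q hq).const_mul c
      end_left := ?_
      end_right := ?_ }
  · rw [mul_inv, mul_comm, ← div_eq_mul_inv]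
    exact (hBd y hy).div_const c
  · intro x hx y hy hxy
    exact div_le_div_of_nonneg_right (hBmono.monotoneOn hx hy hxy) hc0.le
  · intro b hb₀ hb₁ hbe hne z hz hsub hbJ
    have hzJ : z ∈ J := hsub ⟨le_rfl, hz⟩
    have hJb : ∀ y ∈ J, y < b := fun y hy => by
      by_contra! hcon
      exact hbJ (h.ord.out hzJ hy ⟨hz.le, hcon⟩)
    have hsub' : Ico x₀ b ⊆ J := fun y hy => h.ord.out hx₀ (hsub (show max y z ∈ Ico z b from
      ⟨le_max_right _ _, max_lt hy.2 hz⟩)) ⟨hy.1, le_max_left _ _⟩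
    obtain ⟨hlim, hLe⟩ := hwe b hb₀ hb₁ hbe (hJb x₁ hx₁) hsub' hne
    refine ⟨?_, fun hL₀ hL₁ => LipOn.const_mul c ?_⟩
    · have h2 : Tendsto g (𝓝[<] b) (𝓝 0) := by
        refine hlim.congr' ?_
        filter_upwards [Ioo_mem_nhdsLT (hJb x₀ hx₀)] with y hy using (hgw y hy.1.le).symm
      simpa using h2.const_mul c
    · have hr : LipOn g (Ico x₀ b) := (hLe hv₀L hL₀ hL₁).congr fun y hy => hgw y hy.1
      rcases le_or_gt x₀ z with h2 | h2
      · exact hr.mono (Ico_subset_Ico_left h2)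
      · exact LipOn.glue (m := x₀) ⟨h2.le, hJb x₀ hx₀⟩
          ((hgL hL₀ hL₁ z hzJ x₀ hx₀).mono fun y hy => ⟨hy.1.1, hy.2⟩)
          (hr.mono fun y hy => ⟨hy.2, hy.1.2⟩)
  · intro b hb₀ hb₁ hbe hne z hz hsub hbJ
    have hzJ : z ∈ J := hsub ⟨hz, le_rfl⟩
    have hJb : ∀ y ∈ J, b < y := fun y hy => by
      by_contra! hcon
      exact hbJ (h.ord.out hy hzJ ⟨hcon, le_of_lt hz⟩)
    have hsub' : Ioc b x₁ ⊆ J := fun y hy => h.ord.out (hsub (show min y z ∈ Ioc b z from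
      ⟨lt_min hy.1 hz, min_le_right _ _⟩)) hx₁ ⟨min_le_left _ _, hy.2⟩
    obtain ⟨hlim, hLe⟩ := hue b hb₀ hb₁ hbe (hJb x₀ hx₀) hsub' hne
    refine ⟨?_, fun hL₀ hL₁ => LipOn.const_mul c ?_⟩
    · have h2 : Tendsto g (𝓝[>] b) (𝓝 0) := by
        refine hlim.congr' ?_
        filter_upwards [Ioo_mem_nhdsGT (hJb x₁ hx₁)] with y hy using (hgu y hy.2.le).symm
      simpa using h2.const_mul c
    · have hr : LipOn g (Ioc b x₁) := (hLe hv₀L hL₀ hL₁).congr fun y hy => hgu y hy.2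
      rcases le_or_gt z x₁ with h2 | h2
      · exact hr.mono (Ioc_subset_Ioc_right h2)
      · exact LipOn.glue (m := x₁) ⟨hJb x₁ hx₁, h2.le⟩ (hr.mono fun y hy => ⟨hy.1.1, hy.2⟩)
          ((hgL hL₀ hL₁ x₁ hx₁ z hzJ).mono fun y hy => ⟨hy.2, hy.1.2⟩)

/-- Time reversal. -/
theorem TransportField.swap {v A : ℝ → ℝ} (h : TransportField I₁ F₁ ρ₁ I₀ F₀ ρ₀ J v A) :
    TransportField I₀ F₀ ρ₀ I₁ F₁ ρ₁ J (fun y => -v y) (fun y => -A y) where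
  sign := h.sign.symm.imp (fun h y hy => neg_pos.2 (h y hy)) fun h y hy => neg_neg_iff_pos.2 (h y hy)
  cont := h.cont.neg
  deriv := fun y hy => by rw [inv_neg]; exact (h.deriv y hy).neg
  pair := fun x hx hxI y hy hyI e => by rw [h.pair y hy hyI x hx hxI e.symm]; ring
  unbounded := fun b hb₀ hb₁ e hbJ => by
    simpa only [abs_neg] using h.unbounded b hb₁ hb₀ e.symm hbJ
  lip := fun hL₀ hL₁ p hp q hq => by
    simpa using (h.lip hL₁ hL₀ p hp q hq).const_mul (-1)
  end_left := fun b hb₀ hb₁ e hne z hz hsub hbJ => by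
    obtain ⟨h1, h2⟩ := h.end_left b hb₁ hb₀ e.symm hne.symm z hz hsub hbJ
    exact ⟨by simpa using h1.neg, fun hL₀ hL₁ => by simpa using (h2 hL₁ hL₀).const_mul (-1)⟩
  end_right := fun b hb₀ hb₁ e hne z hz hsub hbJ => by
    obtain ⟨h1, h2⟩ := h.end_right b hb₁ hb₀ e.symm hne.symm z hz hsub hbJ
    exact ⟨by simpa using h1.neg, fun hL₀ hL₁ => by simpa using (h2 hL₁ hL₀).const_mul (-1)⟩

end

/-- The points at which two distribution functions agree inside both supports. -/
def coincidenceSet (I₀ : Set ℝ) (F₀ : ℝ → ℝ) (I₁ : Set ℝ) (F₁ : ℝ → ℝ) : Set ℝ :=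
  {x | x ∈ I₀ ∧ x ∈ I₁ ∧ F₀ x = F₁ x}

/-- The smallest order connected set containing `I₀` and `I₁`. -/
def intervalHull (I₀ I₁ : Set ℝ) : Set ℝ :=
  {z | (∃ a ∈ I₀ ∪ I₁, a ≤ z) ∧ ∃ b ∈ I₀ ∪ I₁, z ≤ b}

/-- The points that the transport from `(I₀, F₀)` to `(I₁, F₁)` has to cross to the right. -/
def movingRight (I₀ : Set ℝ) (F₀ : ℝ → ℝ) (I₁ : Set ℝ) (F₁ : ℝ → ℝ) : Set ℝ :=
  {z | F₁ z < F₀ z ∨ (∀ y ∈ I₁, z < y) ∨ ∀ x ∈ I₀, x < z}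

theorem coincidenceSet_comm (I₀ I₁ : Set ℝ) (F₀ F₁ : ℝ → ℝ) :
    coincidenceSet I₀ F₀ I₁ F₁ = coincidenceSet I₁ F₁ I₀ F₀ := by
  ext x
  exact ⟨fun h => ⟨h.2.1, h.1, h.2.2.symm⟩, fun h => ⟨h.2.1, h.1, h.2.2.symm⟩⟩

theorem intervalHull_comm (I₀ I₁ : Set ℝ) : intervalHull I₀ I₁ = intervalHull I₁ I₀ := by
  rw [intervalHull, intervalHull, union_comm]

theorem ordConnected_intervalHull (I₀ I₁ : Set ℝ) : (intervalHull I₀ I₁).OrdConnected := by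
  refine ⟨fun x hx y hy z hz => ?_⟩
  obtain ⟨a, ha, hax⟩ := hx.1
  obtain ⟨b, hb, hyb⟩ := hy.2
  exact ⟨⟨a, ha, hax.trans hz.1⟩, b, hb, hz.2.trans hyb⟩

theorem subset_intervalHull_left {I₀ I₁ : Set ℝ} : I₀ ⊆ intervalHull I₀ I₁ := fun x hx =>
  ⟨⟨x, Or.inl hx, le_rfl⟩, x, Or.inl hx, le_rfl⟩

theorem subset_intervalHull_right {I₀ I₁ : Set ℝ} : I₁ ⊆ intervalHull I₀ I₁ := fun x hx =>
  ⟨⟨x, Or.inr hx, le_rfl⟩, x, Or.inr hx, le_rfl⟩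

theorem isOpen_strictLowerBounds {I : Set ℝ} (hI : IsClosed I) : IsOpen {z | ∀ y ∈ I, z < y} := by
  rw [isOpen_iff_mem_nhds]
  intro z hz
  have hzI : z ∈ Iᶜ := fun h => (hz z h).false
  obtain ⟨ε, hε, hs⟩ := Metric.isOpen_iff.1 hI.isOpen_compl z hzI
  filter_upwards [Ioo_mem_nhds (sub_lt_self z hε) (lt_add_of_pos_right z hε)] with w hw y hy
  by_contra! hcon
  rw [Real.ball_eq_Ioo] at hs
  exact hs ⟨by linarith [hz y hy], hcon.trans_lt hw.2⟩ hy

theorem isOpen_strictUpperBounds {I : Set ℝ} (hI : IsClosed I) : IsOpen {z | ∀ y ∈ I, y < z} := by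
  rw [isOpen_iff_mem_nhds]
  intro z hz
  have hzI : z ∈ Iᶜ := fun h => (hz z h).false
  obtain ⟨ε, hε, hs⟩ := Metric.isOpen_iff.1 hI.isOpen_compl z hzI
  filter_upwards [Ioo_mem_nhds (sub_lt_self z hε) (lt_add_of_pos_right z hε)] with w hw y hy
  by_contra! hcon
  rw [Real.ball_eq_Ioo] at hs
  exact hs ⟨hw.1.trans_le hcon, by linarith [hz y hy]⟩ hy

section

variable {I₀ I₁ J : Set ℝ} {F₀ F₁ ρ₀ ρ₁ : ℝ → ℝ}

namespace Profile

theorem nonempty (p : Profile I₀ F₀ ρ₀) : I₀.Nonempty :=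
  let ⟨x, hx, _⟩ := p.surj (1 / 2) (by norm_num)
  ⟨x, hx⟩

theorem lt_or_gt_of_notMem (p : Profile I₀ F₀ ρ₀) {z : ℝ} (hz : z ∉ I₀) :
    (∀ x ∈ I₀, z < x) ∨ ∀ x ∈ I₀, x < z := by
  by_contra! hcon
  obtain ⟨⟨a, ha, haz⟩, b, hb, hzb⟩ := hcon
  exact hz (p.ord.out ha hb ⟨haz, hzb⟩)

theorem exists_eq_zero (p : Profile I₀ F₀ ρ₀) {z : ℝ} (hz : ∀ x ∈ I₀, z ≤ x) :
    ∃ x ∈ I₀, x ∈ lowerBounds I₀ ∧ F₀ x = 0 := by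
  have hl : sInf I₀ ∈ lowerBounds I₀ := fun x hx => csInf_le ⟨z, hz⟩ hx
  exact ⟨sInf I₀, p.closed.csInf_mem p.nonempty ⟨z, hz⟩, hl, p.bot _ hl⟩

theorem exists_eq_one (p : Profile I₀ F₀ ρ₀) {z : ℝ} (hz : ∀ x ∈ I₀, x ≤ z) :
    ∃ x ∈ I₀, x ∈ upperBounds I₀ ∧ F₀ x = 1 := by
  have hl : sSup I₀ ∈ upperBounds I₀ := fun x hx => le_csSup ⟨z, hz⟩ hx
  exact ⟨sSup I₀, p.closed.csSup_mem p.nonempty ⟨z, hz⟩, hl, p.top _ hl⟩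

theorem isClosed_coincidenceSet (p₀ : Profile I₀ F₀ ρ₀) (p₁ : Profile I₁ F₁ ρ₁) :
    IsClosed (coincidenceSet I₀ F₀ I₁ F₁) :=
  p₀.closed.inter (p₁.closed.inter (isClosed_eq p₀.cont p₁.cont))

theorem isOpen_movingRight (p₀ : Profile I₀ F₀ ρ₀) (p₁ : Profile I₁ F₁ ρ₁) :
    IsOpen (movingRight I₀ F₀ I₁ F₁) :=
  (isOpen_lt p₁.cont p₀.cont).union
    ((isOpen_strictLowerBounds p₁.closed).union (isOpen_strictUpperBounds p₀.closed))

theorem movingRight_or (p₀ : Profile I₀ F₀ ρ₀) (p₁ : Profile I₁ F₁ ρ₁) {z : ℝ}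
    (hz : z ∉ coincidenceSet I₀ F₀ I₁ F₁) :
    z ∈ movingRight I₀ F₀ I₁ F₁ ∨ z ∈ movingRight I₁ F₁ I₀ F₀ := by
  rcases lt_trichotomy (F₁ z) (F₀ z) with h | h | h
  · exact Or.inl (Or.inl h)
  · by_cases h0 : z ∈ I₀
    · have h1 : z ∉ I₁ := fun h1 => hz ⟨h0, h1, h.symm⟩
      rcases p₁.lt_or_gt_of_notMem h1 with h2 | h2
      · exact Or.inl (Or.inr (Or.inl h2))
      · exact Or.inr (Or.inr (Or.inr h2))
    · rcases p₀.lt_or_gt_of_notMem h0 with h2 | h2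
      · exact Or.inr (Or.inr (Or.inl h2))
      · exact Or.inl (Or.inr (Or.inr h2))
  · exact Or.inr (Or.inl h)

theorem not_movingRight_both (p₀ : Profile I₀ F₀ ρ₀) (p₁ : Profile I₁ F₁ ρ₁) {z : ℝ}
    (hC : z ∈ intervalHull I₀ I₁) (h : z ∈ movingRight I₀ F₀ I₁ F₁) :
    z ∉ movingRight I₁ F₁ I₀ F₀ := by
  obtain ⟨⟨a, ha, haz⟩, b, hb, hzb⟩ := hC
  have hl₀ : (∀ x ∈ I₀, z < x) → F₀ z = 0 := fun h => p₀.bot z fun x hx => (h x hx).le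
  have hu₀ : (∀ x ∈ I₀, x < z) → F₀ z = 1 := fun h => p₀.top z fun x hx => (h x hx).le
  have hl₁ : (∀ x ∈ I₁, z < x) → F₁ z = 0 := fun h => p₁.bot z fun x hx => (h x hx).le
  have hu₁ : (∀ x ∈ I₁, x < z) → F₁ z = 1 := fun h => p₁.top z fun x hx => (h x hx).le
  have n0 := p₀.nonneg z
  have n1 := p₁.nonneg z
  have m0 := p₀.le_one z
  have m1 := p₁.le_one z
  rintro (h' | h' | h') <;> rcases h with h | h | h
  · linarith
  · linarith [hl₁ h]
  · linarith [hu₀ h]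
  · linarith [hl₀ h']
  · rcases ha with ha | ha
    · linarith [h' a ha]
    · linarith [h a ha]
  · linarith [hl₀ h', hu₀ h]
  · linarith [hu₁ h']
  · linarith [hl₁ h, hu₁ h']
  · rcases hb with hb | hb
    · linarith [h b hb]
    · linarith [h' b hb]

/-- No fixed point lies between a point and its image, unless the point is fixed. -/
theorem eq_of_mem_uIcc (p₀ : Profile I₀ F₀ ρ₀) (p₁ : Profile I₁ F₁ ρ₁) {x y u : ℝ} (hx : x ∈ I₀)
    (hy : y ∈ I₁) (e : F₀ x = F₁ y) (hu : u ∈ coincidenceSet I₀ F₀ I₁ F₁) (hux : u ∈ uIcc x y) :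
    u = x ∧ u = y := by
  obtain ⟨h0, h1, h2⟩ := hu
  rcases mem_uIcc.1 hux with h | h
  · have a := p₀.mono h.1
    have b := p₁.mono h.2
    exact ⟨p₀.strict.injOn h0 hx (by linarith), p₁.strict.injOn h1 hy (by linarith)⟩
  · have a := p₀.mono h.2
    have b := p₁.mono h.1
    exact ⟨p₀.strict.injOn h0 hx (by linarith), p₁.strict.injOn h1 hy (by linarith)⟩

theorem uIcc_subset (p₀ : Profile I₀ F₀ ρ₀) (p₁ : Profile I₁ F₁ ρ₁) {x y : ℝ} (hx : x ∈ I₀)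
    (hy : y ∈ I₁) (e : F₀ x = F₁ y)
    (h : x ∉ coincidenceSet I₀ F₀ I₁ F₁ ∨ y ∉ coincidenceSet I₀ F₀ I₁ F₁) :
    uIcc x y ⊆ intervalHull I₀ I₁ \ coincidenceSet I₀ F₀ I₁ F₁ := by
  refine fun u hu => ⟨(ordConnected_intervalHull I₀ I₁).uIcc_subset (subset_intervalHull_left hx)
    (subset_intervalHull_right hy) hu, fun hS => ?_⟩
  obtain ⟨h1, h2⟩ := p₀.eq_of_mem_uIcc p₁ hx hy e hS hu
  rcases h with h | h
  · exact h (h1 ▸ hS)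
  · exact h (h2 ▸ hS)

theorem exists_lt_of_subset_movingRight (p₀ : Profile I₀ F₀ ρ₀) (p₁ : Profile I₁ F₁ ρ₁)
    (hJC : J ⊆ intervalHull I₀ I₁)
    (hext : ∀ z ∈ J, ∀ w, (uIcc z w ⊆ intervalHull I₀ I₁ \ coincidenceSet I₀ F₀ I₁ F₁) → w ∈ J)
    (hpos : J ⊆ movingRight I₀ F₀ I₁ F₁) (hne : J.Nonempty) : ∃ w ∈ J, F₁ w < F₀ w := by
  obtain ⟨z, hz⟩ := hne
  obtain ⟨⟨a, ha, haz⟩, b, hb, hzb⟩ := hJC hz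
  by_contra! hcon
  have hzc := hcon z hz
  rcases hpos hz with h | h | h
  · exact h.not_ge hzc
  · have ha0 : a ∈ I₀ := ha.resolve_right fun h' => (h a h').not_ge haz
    have hF1 : F₁ z = 0 := p₁.bot z fun y hy => (h y hy).le
    have hF0 : F₀ z = 0 := le_antisymm (hzc.trans hF1.le) (p₀.nonneg z)
    obtain ⟨y₀, hy₀, hy₀l, -⟩ := p₁.exists_eq_zero fun y hy => (h y hy).le
    obtain ⟨x, hx, hFx⟩ := p₀.surj (1 / 2) (by norm_num)
    have hzx : z < x := by
      by_contra! hc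
      have := p₀.mono hc
      linarith
    have hzy := h y₀ hy₀
    obtain ⟨w, hzw, hw⟩ := exists_between (lt_min hzx hzy)
    have hwx : w < x := hw.trans_le (min_le_left _ _)
    have hwy : w < y₀ := hw.trans_le (min_le_right _ _)
    have hsubI : Icc z w ⊆ I₀ := fun u hu => p₀.ord.out ha0 hx ⟨haz.trans hu.1, hu.2.trans hwx.le⟩
    have hwJ : w ∈ J := by
      refine hext z hz w ?_
      rw [uIcc_of_le hzw.le]
      exact fun u hu => ⟨subset_intervalHull_left (hsubI hu),
        fun hS => (hy₀l hS.2.1).not_gt (hu.2.trans_lt hwy)⟩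
    have h1 := hcon w hwJ
    have h2 := p₀.strict (hsubI ⟨le_rfl, hzw.le⟩) (hsubI ⟨hzw.le, le_rfl⟩) hzw
    have h3 := p₁.bot w fun y hy => hwy.le.trans (hy₀l hy)
    linarith
  · have hb1 : b ∈ I₁ := hb.resolve_left fun h' => (h b h').not_ge hzb
    have hF0 : F₀ z = 1 := p₀.top z fun y hy => (h y hy).le
    have hF1 : F₁ z = 1 := le_antisymm (p₁.le_one z) (hF0.symm.le.trans hzc)
    obtain ⟨x₀, hx₀, hx₀l, -⟩ := p₀.exists_eq_one fun y hy => (h y hy).le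
    obtain ⟨y, hy, hFy⟩ := p₁.surj (1 / 2) (by norm_num)
    have hyz : y < z := by
      by_contra! hc
      have := p₁.mono hc
      linarith
    have hzx := h x₀ hx₀
    obtain ⟨w, hw, hwz⟩ := exists_between (max_lt hyz hzx)
    have hyw : y < w := (le_max_left _ _).trans_lt hw
    have hxw : x₀ < w := (le_max_right _ _).trans_lt hw
    have hsubI : Icc w z ⊆ I₁ := fun u hu => p₁.ord.out hy hb1 ⟨hyw.le.trans hu.1, hu.2.trans hzb⟩
    have hwJ : w ∈ J := by
      refine hext z hz w ?_
      rw [uIcc_of_ge hwz.le]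
      exact fun u hu => ⟨subset_intervalHull_right (hsubI hu),
        fun hS => (hx₀l hS.1).not_gt (hxw.trans_le hu.1)⟩
    have h1 := hcon w hwJ
    have h2 := p₁.strict (hsubI ⟨le_rfl, hwz.le⟩) (hsubI ⟨hwz.le, le_rfl⟩) hwz
    have h3 := p₀.top w fun y hy => (hx₀l hy).trans hxw.le
    linarith

theorem posComp (p₀ : Profile I₀ F₀ ρ₀) (p₁ : Profile I₁ F₁ ρ₁) (hord : J.OrdConnected)
    (hJC : J ⊆ intervalHull I₀ I₁ \ coincidenceSet I₀ F₀ I₁ F₁)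
    (hext : ∀ z ∈ J, ∀ w, (uIcc z w ⊆ intervalHull I₀ I₁ \ coincidenceSet I₀ F₀ I₁ F₁) → w ∈ J)
    (hpos : J ⊆ movingRight I₀ F₀ I₁ F₁) (hne : J.Nonempty) :
    PosComp I₀ F₀ ρ₀ I₁ F₁ ρ₁ J := by
  have hmem₁ : ∀ x ∈ J, x ∈ I₀ → ∀ y ∈ I₁, F₀ x = F₁ y → y ∈ J := fun x hx hxI y hy e =>
    hext x hx y (p₀.uIcc_subset p₁ hxI hy e (Or.inl (hJC hx).2))
  have hmem₀ : ∀ y ∈ J, y ∈ I₁ → ∀ x ∈ I₀, F₀ x = F₁ y → x ∈ J := fun y hy hyI x hx e =>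
    hext y hy x (uIcc_comm y x ▸ p₀.uIcc_subset p₁ hx hyI e (Or.inr (hJC hy).2))
  refine
    { p₀ := p₀
      p₁ := p₁
      ord := hord
      pair_lt := fun x hx hxI y hy hyI e => ?_
      fwd := fun x hx hxI hlt => ?_
      bwd := fun y hy hyI hlt => ?_
      lower := fun z hz x hx hzx => ?_
      upper := fun z hz y hy hyz => ?_
      base := ?_ }
  · rcases hpos hx with h | h | h
    · rw [e] at h
      by_contra! hcon
      exact (p₁.mono hcon).not_gt h
    · exact h y hyI
    · exact absurd (h x hxI) (lt_irrefl x)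
  · rcases (p₀.nonneg x).eq_or_lt with h0 | h0
    · rcases hpos hx with h | h | h
      · linarith [p₁.nonneg x]
      · obtain ⟨y, hy, -, e⟩ := p₁.exists_eq_zero fun y hy => (h y hy).le
        exact ⟨y, hmem₁ x hx hxI y hy (h0.symm.trans e.symm), hy, e.trans h0⟩
      · exact absurd (h x hxI) (lt_irrefl x)
    · obtain ⟨y, hy, e⟩ := p₁.surj (F₀ x) ⟨h0, hlt⟩
      exact ⟨y, hmem₁ x hx hxI y hy e.symm, hy, e⟩
  · rcases (p₁.le_one y).eq_or_lt with h1 | h1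
    · rcases hpos hy with h | h | h
      · linarith [p₀.le_one y]
      · exact absurd (h y hyI) (lt_irrefl y)
      · obtain ⟨x, hx, -, e⟩ := p₀.exists_eq_one fun y hy => (h y hy).le
        exact ⟨x, hmem₀ y hy hyI x hx (e.trans h1.symm), hx, e.trans h1.symm⟩
    · obtain ⟨x, hx, e⟩ := p₀.surj (F₁ y) ⟨hlt, h1⟩
      exact ⟨x, hmem₀ y hy hyI x hx e, hx, e⟩
  · by_contra hzI
    have hl : ∀ x ∈ I₀, z < x := (p₀.lt_or_gt_of_notMem hzI).resolve_right
      fun h => (h x hx).not_ge hzx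
    rcases hpos hz with h | h | h
    · linarith [p₁.nonneg z, p₀.bot z fun x hx => (hl x hx).le]
    · obtain ⟨a, ha | ha, haz⟩ := (hJC hz).1.1
      · exact (hl a ha).not_ge haz
      · exact (h a ha).not_ge haz
    · exact (h x hx).not_ge hzx
  · by_contra hzI
    have hl : ∀ x ∈ I₁, x < z := (p₁.lt_or_gt_of_notMem hzI).resolve_left
      fun h => (h y hy).not_ge hyz
    rcases hpos hz with h | h | h
    · linarith [p₀.le_one z, p₁.top z fun x hx => (hl x hx).le]
    · exact (h y hy).not_ge hyz
    · obtain ⟨b, hb | hb, hzb⟩ := (hJC hz).1.2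
      · exact (h b hb).not_ge hzb
      · exact (hl b hb).not_ge hzb
  · obtain ⟨z, hz, hlt⟩ := p₀.exists_lt_of_subset_movingRight p₁
      (fun z hz => (hJC hz).1) hext hpos hne
    obtain ⟨m, hm1, hm0⟩ := exists_between hlt
    have hm : m ∈ Ioo (0 : ℝ) 1 := ⟨(p₁.nonneg z).trans_lt hm1, hm0.trans_le (p₀.le_one z)⟩
    obtain ⟨x, hx, ex⟩ := p₀.surj m hm
    obtain ⟨y, hy, ey⟩ := p₁.surj m hm
    have hxz : x < z := by
      by_contra! hc
      linarith [p₀.mono hc]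
    have hzy : z < y := by
      by_contra! hc
      linarith [p₁.mono hc]
    have hsub := p₀.uIcc_subset p₁ hx hy (ex.trans ey.symm) (Or.inl fun hS => by
      have := p₁.strict.injOn hS.2.1 hy (hS.2.2.symm.trans (ex.trans ey.symm))
      linarith)
    rw [uIcc_of_le (hxz.trans hzy).le] at hsub
    refine ⟨x, hext z hz x ?_, hx, y, hext z hz y ?_, hy, ex.trans ey.symm, ?_, ?_⟩
    · rw [uIcc_of_ge hxz.le]
      exact (Icc_subset_Icc_right hzy.le).trans hsub
    · rw [uIcc_of_le hzy.le]
      exact (Icc_subset_Icc_left hxz.le).trans hsub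
    · rw [ex]; exact hm.1
    · rw [ex]; exact hm.2

/-- Existence of a transporting velocity field on each component without fixed points. -/
theorem exists_field (p₀ : Profile I₀ F₀ ρ₀) (p₁ : Profile I₁ F₁ ρ₁) (hord : J.OrdConnected)
    (hJC : J ⊆ intervalHull I₀ I₁ \ coincidenceSet I₀ F₀ I₁ F₁)
    (hext : ∀ z ∈ J, ∀ w, (uIcc z w ⊆ intervalHull I₀ I₁ \ coincidenceSet I₀ F₀ I₁ F₁) → w ∈ J)
    (hne : J.Nonempty) : ∃ v A, TransportField I₀ F₀ ρ₀ I₁ F₁ ρ₁ J v A := by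
  have hcov : J ⊆ movingRight I₀ F₀ I₁ F₁ ∪ movingRight I₁ F₁ I₀ F₀ := fun z hz =>
    p₀.movingRight_or p₁ (hJC hz).2
  have hdisj : J ∩ (movingRight I₀ F₀ I₁ F₁ ∩ movingRight I₁ F₁ I₀ F₀) = ∅ := by
    rw [eq_empty_iff_forall_notMem]
    exact fun z hz => p₀.not_movingRight_both p₁ (hJC hz.1).1 hz.2.1 hz.2.2
  rcases isPreconnected_iff_subset_of_disjoint.1 hord.isPreconnected _ _
    (p₀.isOpen_movingRight p₁) (p₁.isOpen_movingRight p₀) hcov hdisj with h | h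
  · exact (p₀.posComp p₁ hord hJC hext h hne).exists_field
  · rw [coincidenceSet_comm, intervalHull_comm] at hJC hext
    obtain ⟨v, A, hv⟩ := (p₁.posComp p₀ hord hJC hext h hne).exists_field
    exact ⟨_, _, hv.swap⟩

end Profile

end

/-- A curve whose time coordinate `A` grows at constant rate cannot leave `J`, if `A` is unbounded
near the points outside of `J`. -/
theorem mem_and_eq_of_unbounded {C J : Set ℝ} {A γ : ℝ → ℝ} {τ κ : ℝ}
    (hA : ContinuousOn A J) (hopen : ∀ z ∈ J, J ∈ 𝓝[C] z)
    (hunb : ∀ b ∈ C, b ∉ J → Tendsto (fun z => |A z|) (𝓝[J] b) atTop)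
    (hγ : ContinuousOn γ (Icc 0 τ)) (hγC : MapsTo γ (Icc 0 τ) C)
    (hstep : ∀ a ∈ Icc 0 τ, ∀ b ∈ Icc 0 τ, a < b → (∀ s ∈ Icc a b, γ s ∈ J) →
      A (γ b) - A (γ a) = κ * (b - a)) (h0 : γ 0 ∈ J) :
    ∀ t ∈ Icc 0 τ, γ t ∈ J ∧ A (γ t) = A (γ 0) + κ * t := by
  set s : Set ℝ := {t | γ t ∈ J ∧ A (γ t) = A (γ 0) + κ * t} with hs
  change Icc 0 τ ⊆ s
  refine IsClosed.Icc_subset_of_forall_exists_gt ?_ ⟨h0, by simp⟩ ?_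
  · refine isClosed_of_closure_subset fun t ht => ?_
    have htI : t ∈ Icc 0 τ :=
      isClosed_Icc.closure_subset_iff.2 inter_subset_right ht
    have hne : (𝓝[s ∩ Icc 0 τ] t).NeBot := mem_closure_iff_nhdsWithin_neBot.1 ht
    have hlim : Tendsto γ (𝓝[s ∩ Icc 0 τ] t) (𝓝[J] (γ t)) :=
      tendsto_nhdsWithin_of_tendsto_nhds_of_eventually_within _
        ((hγ t htI).mono_left (nhdsWithin_mono _ inter_subset_right))
        (eventually_mem_nhdsWithin.mono fun u hu => hu.1.1)
    have hlim2 : Tendsto (fun u => A (γ 0) + κ * u) (𝓝[s ∩ Icc 0 τ] t) (𝓝 (A (γ 0) + κ * t)) :=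
      (Continuous.tendsto (by fun_prop) t).mono_left nhdsWithin_le_nhds
    have hlim3 : Tendsto (fun u => A (γ u)) (𝓝[s ∩ Icc 0 τ] t) (𝓝 (A (γ 0) + κ * t)) :=
      hlim2.congr' (eventually_mem_nhdsWithin.mono fun u hu => hu.1.2.symm)
    have htJ : γ t ∈ J := by
      by_contra hcon
      exact not_tendsto_nhds_of_tendsto_atTop ((hunb _ (hγC htI) hcon).comp hlim) _ hlim3.abs
    exact ⟨⟨htJ, tendsto_nhds_unique ((hA _ htJ).tendsto.comp hlim) hlim3⟩, htI⟩
  · rintro t ⟨⟨htJ, hte⟩, ht⟩ y hy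
    have htI : t ∈ Icc 0 τ := ⟨ht.1, ht.2.le⟩
    have hev : ∀ᶠ u in 𝓝[>] t, γ u ∈ J := by
      have h1 : Tendsto γ (𝓝[Icc 0 τ] t) (𝓝[C] (γ t)) :=
        tendsto_nhdsWithin_of_tendsto_nhds_of_eventually_within _ (hγ t htI)
          (eventually_mem_nhdsWithin.mono fun u hu => hγC hu)
      refine (h1.eventually (hopen _ htJ)).filter_mono (nhdsWithin_le_of_mem ?_)
      filter_upwards [Ioo_mem_nhdsGT ht.2] with u hu using ⟨ht.1.trans hu.1.le, hu.2.le⟩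
    obtain ⟨u, hu, hus⟩ := (mem_nhdsGT_iff_exists_Ioc_subset).1 hev
    set w := min u (min y τ) with hw
    have htw : t < w := lt_min hu (lt_min hy ht.2)
    have hwu : w ≤ u := min_le_left _ _
    have hwy : w ≤ y := (min_le_right _ _).trans (min_le_left _ _)
    have hwτ : w ≤ τ := (min_le_right _ _).trans (min_le_right _ _)
    have hJ : ∀ r ∈ Icc t w, γ r ∈ J := by
      intro r hr
      rcases hr.1.eq_or_lt with rfl | hlt
      · exact htJ
      · exact hus ⟨hlt, hr.2.trans hwu⟩
    have := hstep t htI w ⟨ht.1.trans htw.le, hwτ⟩ htw hJ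
    exact ⟨w, ⟨hJ w ⟨htw.le, le_rfl⟩, by linarith⟩, htw, hwy⟩

namespace IsSolutionOn

variable {v γ : ℝ → ℝ} {C : Set ℝ} {x τ : ℝ}

theorem continuousOn (h : IsSolutionOn v C x (Icc 0 τ) γ) : ContinuousOn γ (Icc 0 τ) := by
  rcases lt_or_ge τ 0 with hτ | hτ
  · simp [Icc_eq_empty_of_lt hτ]
  have h1 : ContinuousOn (fun t => x + ∫ s in (0 : ℝ)..t, v (γ s)) (Icc 0 τ) := by
    have := intervalIntegral.continuousOn_primitive_interval
      ((intervalIntegrable_iff' (by simp)).1 (h τ ⟨hτ, le_rfl⟩).2.1)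
    rw [uIcc_of_le hτ] at this
    exact continuousOn_const.add this
  exact h1.congr fun t ht => (h t ht).2.2

theorem apply_zero (h : IsSolutionOn v C x (Icc 0 τ) γ) (hτ : 0 ≤ τ) : γ 0 = x := by
  simpa using (h 0 ⟨le_rfl, hτ⟩).2.2

/-- Along a solution inside `J`, a primitive of `1 / v` grows with slope one. -/
theorem sub_eq (h : IsSolutionOn v C x (Icc 0 τ) γ) {J : Set ℝ} {A : ℝ → ℝ}
    (hv : ContinuousOn v J) (hv0 : ∀ y ∈ J, v y ≠ 0)
    (hA : ∀ y ∈ J, HasDerivWithinAt A (v y)⁻¹ J y) {a b : ℝ} (ha : a ∈ Icc 0 τ)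
    (hb : b ∈ Icc 0 τ) (hab : a < b) (hJ : ∀ s ∈ Icc a b, γ s ∈ J) :
    A (γ b) - A (γ a) = b - a := by
  have hsub : Icc a b ⊆ Icc 0 τ := Icc_subset_Icc ha.1 hb.2
  have hγ : ContinuousOn γ (Icc a b) := h.continuousOn.mono hsub
  have hvγ : ContinuousOn (fun s => v (γ s)) (Icc a b) := hv.comp hγ hJ
  have heq : EqOn γ (fun u => γ a + ∫ s in a..u, v (γ s)) (Icc a b) := by
    intro u hu
    have h1 := h u (hsub hu)
    have h2 := h a ha
    simp only
    rw [h1.2.2, h2.2.2, add_assoc, intervalIntegral.integral_add_adjacent_intervals h2.2.1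
      (h2.2.1.symm.trans h1.2.1)]
  have hd : ∀ u ∈ Icc a b, HasDerivWithinAt γ (v (γ u)) (Icc a b) u := fun u hu =>
    ((hvγ.integral_hasDerivWithinAt_of_ordConnected ordConnected_Icc ⟨le_rfl, hab.le⟩
      hu).const_add (γ a)).congr heq (heq hu)
  have hdA : ∀ u ∈ Icc a b, HasDerivWithinAt (fun u => A (γ u)) 1 (Icc a b) u := by
    intro u hu
    have := (hA _ (hJ u hu)).comp u (hd u hu) hJ
    rwa [inv_mul_cancel₀ (hv0 _ (hJ u hu))] at this
  obtain ⟨ξ, -, hξ⟩ := exists_hasDerivAt_eq_slope (fun u => A (γ u)) (fun _ => 1) hab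
    (fun u hu => (hdA u hu).continuousWithinAt)
    (fun u hu => (hdA u ⟨hu.1.le, hu.2.le⟩).hasDerivAt (Icc_mem_nhds hu.1 hu.2))
  rw [eq_div_iff (sub_pos.2 hab).ne'] at hξ
  linarith

end IsSolutionOn

section

variable {I₀ I₁ J C : Set ℝ} {F₀ F₁ ρ₀ ρ₁ v A : ℝ → ℝ}

namespace TransportField

theorem congr (h : TransportField I₀ F₀ ρ₀ I₁ F₁ ρ₁ J v A) (hJ : J.OrdConnected) {w : ℝ → ℝ} (hw : EqOn w v J) :
    TransportField I₀ F₀ ρ₀ I₁ F₁ ρ₁ J w A where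
  sign := h.sign.imp (fun h y hy => by rw [hw hy]; exact h y hy)
    fun h y hy => by rw [hw hy]; exact h y hy
  cont := h.cont.congr hw
  deriv := fun y hy => by rw [hw hy]; exact h.deriv y hy
  pair := h.pair
  unbounded := h.unbounded
  lip := fun hL₀ hL₁ p hp q hq => (h.lip hL₀ hL₁ p hp q hq).congr (hw.mono (hJ.out hp hq))
  end_left := fun b hb₀ hb₁ e hne z hz hsub hbJ => by
    obtain ⟨h1, h2⟩ := h.end_left b hb₀ hb₁ e hne z hz hsub hbJ
    refine ⟨h1.congr' ?_, fun hL₀ hL₁ => (h2 hL₀ hL₁).congr (hw.mono hsub)⟩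
    filter_upwards [Ioo_mem_nhdsLT hz] with u hu using (hw (hsub ⟨hu.1.le, hu.2⟩)).symm
  end_right := fun b hb₀ hb₁ e hne z hz hsub hbJ => by
    obtain ⟨h1, h2⟩ := h.end_right b hb₀ hb₁ e hne z hz hsub hbJ
    refine ⟨h1.congr' ?_, fun hL₀ hL₁ => (h2 hL₀ hL₁).congr (hw.mono hsub)⟩
    filter_upwards [Ioo_mem_nhdsGT hz] with u hu using (hw (hsub ⟨hu.1, hu.2.le⟩)).symm

theorem ne_zero (h : TransportField I₀ F₀ ρ₀ I₁ F₁ ρ₁ J v A) {y : ℝ} (hy : y ∈ J) : v y ≠ 0 := by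
  rcases h.sign with h | h
  exacts [(h y hy).ne', (h y hy).ne]

theorem continuousOn_time (h : TransportField I₀ F₀ ρ₀ I₁ F₁ ρ₁ J v A) : ContinuousOn A J :=
  fun y hy => (h.deriv y hy).continuousWithinAt

theorem strictMonoOn_or (h : TransportField I₀ F₀ ρ₀ I₁ F₁ ρ₁ J v A) (hJ : J.OrdConnected) :
    StrictMonoOn A J ∨ StrictMonoOn (fun y => -A y) J := by
  rcases h.sign with hs | hs
  · refine Or.inl (strictMonoOn_of_hasDerivWithinAt_pos hJ.convex h.continuousOn_time
      (f' := fun y => (v y)⁻¹)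
      (fun y hy => (h.deriv y (interior_subset hy)).mono interior_subset)
      fun y hy => inv_pos.2 (hs y (interior_subset hy)))
  · refine Or.inr (strictMonoOn_of_hasDerivWithinAt_pos hJ.convex h.continuousOn_time.neg
      (f' := fun y => -(v y)⁻¹)
      (fun y hy => ((h.deriv y (interior_subset hy)).mono interior_subset).neg)
      fun y hy => neg_pos.2 (inv_lt_zero.2 (hs y (interior_subset hy))))

theorem injOn (h : TransportField I₀ F₀ ρ₀ I₁ F₁ ρ₁ J v A) (hJ : J.OrdConnected) : InjOn A J := by
  rcases h.strictMonoOn_or hJ with hm | hm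
  · exact hm.injOn
  · exact fun x hx y hy e => hm.injOn hx hy (congrArg Neg.neg e)

theorem ordConnected_image (h : TransportField I₀ F₀ ρ₀ I₁ F₁ ρ₁ J v A) (hJ : J.OrdConnected) :
    (A '' J).OrdConnected :=
  (hJ.isPreconnected.image A h.continuousOn_time).ordConnected

/-- The inverse of the time coordinate is a solution. -/
theorem isSolutionOn (h : TransportField I₀ F₀ ρ₀ I₁ F₁ ρ₁ J v A) (hJ : J.OrdConnected)
    (hJC : J ⊆ C) {x : ℝ} (hx : x ∈ J) {T : Set ℝ} (hT : ∀ t ∈ T, 0 ≤ t ∧ A x + t ∈ A '' J) :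
    IsSolutionOn v C x T (fun t => Function.invFunOn A J (A x + t)) := by
  intro t ht
  obtain ⟨ht0, htA⟩ := hT t ht
  set γ : ℝ → ℝ := fun t => Function.invFunOn A J (A x + t) with hγdef
  have himg : ∀ s ∈ Icc 0 t, A x + s ∈ A '' J := fun s hs =>
    (h.ordConnected_image hJ).out (mem_image_of_mem A hx) htA
      ⟨by linarith [hs.1], by linarith [hs.2]⟩
  have hγJ : ∀ s ∈ Icc 0 t, γ s ∈ J := fun s hs => Function.invFunOn_mem (himg s hs)
  have hγA : ∀ s ∈ Icc 0 t, A (γ s) = A x + s := fun s hs => Function.invFunOn_eq (himg s hs)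
  have hγ0 : γ 0 = x := h.injOn hJ (hγJ 0 ⟨le_rfl, ht0⟩) hx
    ((hγA 0 ⟨le_rfl, ht0⟩).trans (add_zero _))
  have hcont : ContinuousOn γ (Icc 0 t) := by
    have hc : ContinuousOn (fun s => A (γ s)) (Icc 0 t) :=
      ContinuousOn.congr (by fun_prop) hγA
    rcases h.strictMonoOn_or hJ with hm | hm
    · exact continuousOn_of_comp_strictMonoOn hJ hm hγJ hc
    · exact continuousOn_of_comp_strictMonoOn hJ hm hγJ hc.neg
  have hnhds : ∀ s ∈ Ioo 0 t, J ∈ 𝓝 (γ s) := by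
    intro s hs
    have hsI : s ∈ Icc 0 t := ⟨hs.1.le, hs.2.le⟩
    have h0I : (0 : ℝ) ∈ Icc 0 t := ⟨le_rfl, ht0⟩
    have htI : t ∈ Icc 0 t := ⟨ht0, le_rfl⟩
    have a := hγA s hsI
    have b := hγA 0 h0I
    have c := hγA t htI
    rcases h.strictMonoOn_or hJ with hm | hm
    · refine mem_of_superset (Icc_mem_nhds ?_ ?_) (hJ.out (hγJ 0 h0I) (hγJ t htI))
      · rw [← hm.lt_iff_lt (hγJ 0 h0I) (hγJ s hsI)]; linarith [hs.1]
      · rw [← hm.lt_iff_lt (hγJ s hsI) (hγJ t htI)]; linarith [hs.2]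
    · refine mem_of_superset (Icc_mem_nhds ?_ ?_) (hJ.out (hγJ t htI) (hγJ 0 h0I))
      · rw [← hm.lt_iff_lt (hγJ t htI) (hγJ s hsI)]; linarith [hs.2]
      · rw [← hm.lt_iff_lt (hγJ s hsI) (hγJ 0 h0I)]; linarith [hs.1]
  have hderiv : ∀ s ∈ Ioo 0 t, HasDerivAt γ (v (γ s)) s := by
    intro s hs
    have hsI : s ∈ Icc 0 t := ⟨hs.1.le, hs.2.le⟩
    have hd := (((h.deriv _ (hγJ s hsI)).hasDerivAt (hnhds s hs)).sub_const (A x))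
    rw [← inv_inv (v (γ s))]
    refine HasDerivAt.of_local_left_inverse (hcont.continuousAt (Icc_mem_nhds hs.1 hs.2)) hd
      (inv_ne_zero (h.ne_zero (hγJ s hsI))) ?_
    filter_upwards [Icc_mem_nhds hs.1 hs.2] with u hu
    rw [hγA u hu]; ring
  have hvγ : ContinuousOn (fun s => v (γ s)) (Icc 0 t) := h.cont.comp hcont hγJ
  have hint : IntervalIntegrable (fun s => v (γ s)) volume 0 t := by
    rw [← uIcc_of_le ht0] at hvγ
    exact hvγ.intervalIntegrable
  refine ⟨hJC (hγJ t ⟨ht0, le_rfl⟩), hint, ?_⟩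
  rw [intervalIntegral.integral_eq_sub_of_hasDerivAt_of_le ht0 hcont hderiv hint, hγ0]
  ring

end TransportField

end

section

variable {I₀ I₁ J : Set ℝ} {F₀ F₁ ρ₀ ρ₁ : ℝ → ℝ}

/-- If the right end point `x` of the source is sent to `+∞`, the time coordinate of `+∞` is exactly
one more than that of `x`. -/
theorem Profile.time_at_top (p₀ : Profile I₀ F₀ ρ₀) (p₁ : Profile I₁ F₁ ρ₁) {A : ℝ → ℝ}
    (hJ : J.OrdConnected) (hA : ContinuousOn A J)
    (hmono : StrictMonoOn A J ∨ StrictMonoOn (fun y => -A y) J)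
    (hmem : ∀ y ∈ J, y ∈ I₁ → ∀ x ∈ I₀, F₀ x = F₁ y → x ∈ J)
    (hpair : ∀ x ∈ J, x ∈ I₀ → ∀ y ∈ J, y ∈ I₁ → F₀ x = F₁ y → A y = A x + 1) {x : ℝ}
    (hx : x ∈ I₀) (hFx : F₀ x = 1) (hF₁ : ∀ z, F₁ z < 1) (hxJ : Ici x ⊆ J) :
    (∀ t ∈ Ico (0 : ℝ) 1, A x + t ∈ A '' J) ∧
      ∀ M, ∃ t₀ < 1, ∀ z ∈ J, A x + t₀ < A z → M < z := by
  have hxx : x ∈ J := hxJ self_mem_Ici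
  have hlt1 : ∀ z < x, F₀ z < 1 := by
    intro z hz
    by_cases hzI : z ∈ I₀
    · exact (p₀.strict hzI hx hz).trans_eq hFx
    · have := (p₀.lt_or_gt_of_notMem hzI).resolve_right fun h => (h x hx).not_gt hz
      rw [p₀.bot z fun y hy => (this y hy).le]
      exact one_pos
  have core : ∀ ε > 0, ∀ z ≥ x, ∃ x' ∈ J, x' < x ∧ ∃ y ∈ J, z < y ∧ A y = A x' + 1 ∧
      |A x' - A x| < ε := by
    intro ε hε z hz
    obtain ⟨δ, hδ, hδA⟩ := Metric.continuousWithinAt_iff.1 (hA x hxx) ε hε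
    obtain ⟨m, hm, hm1⟩ := exists_between (max_lt (hlt1 (x - δ) (by linarith)) (hF₁ z))
    have hm0 : m ∈ Ioo (0 : ℝ) 1 :=
      ⟨(p₀.nonneg _).trans_lt ((le_max_left _ _).trans_lt hm), hm1⟩
    obtain ⟨x', hx', ex'⟩ := p₀.surj m hm0
    obtain ⟨y, hy, ey⟩ := p₁.surj m hm0
    have h1 : x - δ < x' := by
      by_contra! hc
      linarith [p₀.mono hc, le_max_left (F₀ (x - δ)) (F₁ z)]
    have h2 : x' < x := by
      rw [← p₀.strict.lt_iff_lt hx' hx, ex', hFx]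
      exact hm1
    have h3 : z < y := by
      by_contra! hc
      linarith [p₁.mono hc, le_max_right (F₀ (x - δ)) (F₁ z)]
    have hyJ : y ∈ J := hxJ (hz.le.trans h3.le)
    have hxJ' : x' ∈ J := hmem y hyJ hy x' hx' (ex'.trans ey.symm)
    refine ⟨x', hxJ', h2, y, hyJ, h3, hpair x' hxJ' hx' y hyJ hy (ex'.trans ey.symm), ?_⟩
    have := hδA hxJ' (by rw [Real.dist_eq, abs_lt]; constructor <;> linarith)
    rwa [Real.dist_eq] at this
  have hm : StrictMonoOn A J := by
    refine hmono.resolve_right fun h => ?_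
    obtain ⟨x', hx', hlt, y, hy, hlt', e, -⟩ := core 1 one_pos x le_rfl
    have := h hx' hy (hlt.trans hlt')
    simp only at this
    linarith
  constructor
  · intro t ht
    obtain ⟨x', -, -, y, hy, -, e, hε⟩ := core (1 - t) (sub_pos.2 ht.2) x le_rfl
    have := (abs_lt.1 hε).1
    exact (hJ.isPreconnected.image A hA).ordConnected.out (mem_image_of_mem A hxx)
      (mem_image_of_mem A hy) ⟨by linarith [ht.1], by linarith⟩
  · intro M
    have hMJ : max M x ∈ J := hxJ (mem_Ici.2 (le_max_right _ _))
    obtain ⟨x', hx', hlt, y, hy, hzy, e, -⟩ := core 1 one_pos (max M x) (le_max_right _ _)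
    have h1 := hm hMJ hy hzy
    have h2 := hm hx' hxx hlt
    refine ⟨A (max M x) - A x, by linarith, fun z hz hlt => ?_⟩
    refine (le_max_left M x).trans_lt ?_
    rw [← hm.lt_iff_lt hMJ hz]
    linarith

theorem Profile.time_at_bot (p₀ : Profile I₀ F₀ ρ₀) (p₁ : Profile I₁ F₁ ρ₁) {A : ℝ → ℝ}
    (hJ : J.OrdConnected) (hA : ContinuousOn A J)
    (hmono : StrictMonoOn A J ∨ StrictMonoOn (fun y => -A y) J)
    (hmem : ∀ y ∈ J, y ∈ I₁ → ∀ x ∈ I₀, F₀ x = F₁ y → x ∈ J)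
    (hpair : ∀ x ∈ J, x ∈ I₀ → ∀ y ∈ J, y ∈ I₁ → F₀ x = F₁ y → A y = A x + 1) {x : ℝ}
    (hx : x ∈ I₀) (hFx : F₀ x = 0) (hF₁ : ∀ z, 0 < F₁ z) (hxJ : Iic x ⊆ J) :
    (∀ t ∈ Ico (0 : ℝ) 1, A x + t ∈ A '' J) ∧
      ∀ M, ∃ t₀ < 1, ∀ z ∈ J, A x + t₀ < A z → z < M := by
  have hneg : MapsTo Neg.neg (Neg.neg ⁻¹' J) J := fun y hy => hy
  obtain ⟨h1, h2⟩ := p₀.reflect.time_at_top p₁.reflect (J := Neg.neg ⁻¹' J)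
    (A := fun y => A (-y)) (x := -x)
    ⟨fun x hx y hy z hz => hJ.out hy hx ⟨neg_le_neg hz.2, neg_le_neg hz.1⟩⟩
    (hA.comp continuous_neg.continuousOn hneg)
    (hmono.symm.imp (fun h a ha b hb hab => neg_lt_neg_iff.1 (h hb ha (neg_lt_neg hab)))
      fun h a ha b hb hab => neg_lt_neg (h hb ha (neg_lt_neg hab)))
    (fun y hy hyI x hx e => hmem _ hy hyI _ hx (by linarith))
    (fun x hx hxI y hy hyI e => hpair _ hx hxI _ hy hyI (by linarith))
    (by simpa using hx) (by simp [hFx]) (fun z => by linarith [hF₁ (-z)])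
    (fun z hz => hxJ (neg_le.1 (mem_Ici.1 hz)))
  constructor
  · intro t ht
    obtain ⟨y, hy, e⟩ := h1 t ht
    exact ⟨-y, hy, by simpa using e⟩
  · intro M
    obtain ⟨t₀, ht₀, h⟩ := h2 (-M)
    refine ⟨t₀, ht₀, fun z hz hlt => ?_⟩
    have := h (-z) (by simpa using hz) (by simpa using hlt)
    linarith

namespace Profile

theorem fields_exist (p₀ : Profile I₀ F₀ ρ₀) (p₁ : Profile I₁ F₁ ρ₁) :
    ∃ (v : ℝ → ℝ) (A : Set ℝ → ℝ → ℝ), (∀ x ∈ coincidenceSet I₀ F₀ I₁ F₁, v x = 0) ∧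
      ∀ z ∈ intervalHull I₀ I₁ \ coincidenceSet I₀ F₀ I₁ F₁,
        TransportField I₀ F₀ ρ₀ I₁ F₁ ρ₁
          (ordConnectedComponent (intervalHull I₀ I₁ \ coincidenceSet I₀ F₀ I₁ F₁) z) v
          (A (ordConnectedComponent (intervalHull I₀ I₁ \ coincidenceSet I₀ F₀ I₁ F₁) z)) := by
  classical
  set U := intervalHull I₀ I₁ \ coincidenceSet I₀ F₀ I₁ F₁ with hU
  have hex : ∀ J : Set ℝ, (∃ z ∈ U, J = ordConnectedComponent U z) →
      ∃ v A, TransportField I₀ F₀ ρ₀ I₁ F₁ ρ₁ J v A := by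
    rintro J ⟨z, hz, rfl⟩
    refine p₀.exists_field p₁ inferInstance ordConnectedComponent_subset ?_
      ⟨z, self_mem_ordConnectedComponent.2 hz⟩
    intro y hy w hw
    have hyw : w ∈ ordConnectedComponent U y := hw
    rwa [ordConnectedComponent_eq hy]
  choose! V A hVA using hex
  refine ⟨fun x => if x ∈ U then V (ordConnectedComponent U x) x else 0, A,
    fun x hx => if_neg fun h => h.2 hx, fun z hz => ?_⟩
  refine (hVA _ ⟨z, hz, rfl⟩).congr inferInstance fun y hy => ?_
  rw [if_pos (ordConnectedComponent_subset hy), ordConnectedComponent_eq hy]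

/-- Components are relatively open. -/
theorem component_mem_nhdsWithin (p₀ : Profile I₀ F₀ ρ₀) (p₁ : Profile I₁ F₁ ρ₁) {z : ℝ}
    (hz : z ∈ intervalHull I₀ I₁ \ coincidenceSet I₀ F₀ I₁ F₁) :
    ordConnectedComponent (intervalHull I₀ I₁ \ coincidenceSet I₀ F₀ I₁ F₁) z ∈
      𝓝[intervalHull I₀ I₁] z := by
  obtain ⟨ε, hε, hs⟩ := Metric.isOpen_iff.1 (p₀.isClosed_coincidenceSet p₁).isOpen_compl z hz.2
  filter_upwards [self_mem_nhdsWithin, mem_nhdsWithin_of_mem_nhds (Metric.ball_mem_nhds z hε)]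
    with w hwC hw
  intro u hu
  refine ⟨(ordConnected_intervalHull I₀ I₁).uIcc_subset hz.1 hwC hu, hs ?_⟩
  rw [Real.ball_eq_Ioo] at hw ⊢
  exact (ordConnected_Ioo (a := z - ε) (b := z + ε)).uIcc_subset
    ⟨by linarith, by linarith⟩ hw hu

end Profile

theorem LipOn.Icc_of_tendsto_left {f : ℝ → ℝ} {z b : ℝ} (h : LipOn f (Ico z b))
    (hf : Tendsto f (𝓝[<] b) (𝓝 (f b))) : LipOn f (Icc z b) := by
  rcases le_or_gt b z with hbz | hzb
  · refine ⟨0, le_rfl, fun x hx y hy => ?_⟩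
    have : x = y := by linarith [hx.1, hx.2, hy.1, hy.2]
    simp [this]
  obtain ⟨K, hK, hL⟩ := h
  refine ⟨K, hK, ?_⟩
  have key : ∀ x ∈ Ico z b, |f x - f b| ≤ K * |x - b| := by
    intro x hx
    have h1 : Tendsto (fun y => |f x - f y|) (𝓝[<] b) (𝓝 |f x - f b|) := (hf.const_sub _).abs
    have h2 : Tendsto (fun y => K * |x - y|) (𝓝[<] b) (𝓝 (K * |x - b|)) :=
      (Continuous.tendsto (by fun_prop) b).mono_left nhdsWithin_le_nhds
    refine le_of_tendsto_of_tendsto h1 h2 ?_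
    filter_upwards [Ioo_mem_nhdsLT hzb] with y hy using hL x hx y ⟨hy.1.le, hy.2⟩
  intro x hx y hy
  rcases hx.2.eq_or_lt with rfl | hxb <;> rcases hy.2.eq_or_lt with rfl | hyb
  · simp
  · rw [abs_sub_comm, abs_sub_comm x]; exact key y ⟨hy.1, hyb⟩
  · exact key x ⟨hx.1, hxb⟩
  · exact hL x ⟨hx.1, hxb⟩ y ⟨hy.1, hyb⟩

theorem LipOn.Icc_of_tendsto_right {f : ℝ → ℝ} {z b : ℝ} (h : LipOn f (Ioc b z))
    (hf : Tendsto f (𝓝[>] b) (𝓝 (f b))) : LipOn f (Icc b z) := by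
  have hneg : ∀ s : Set ℝ, LipOn (fun x : ℝ => -x) s := fun s =>
    ⟨1, zero_le_one, fun x _ y _ => by rw [one_mul, neg_sub_neg, abs_sub_comm]⟩
  have h1 : LipOn (fun x => f (-x)) (Ico (-z) (-b)) := h.comp (hneg _) fun x hx =>
    ⟨lt_neg.1 hx.2, neg_le.1 hx.1⟩
  have h2 := h1.Icc_of_tendsto_left (by
    simp only [neg_neg]
    refine hf.comp ?_
    have := tendsto_neg_nhdsLT (a := -b)
    rwa [neg_neg] at this)
  have h3 := h2.comp (hneg (Icc b z)) fun x hx => ⟨neg_le_neg hx.2, neg_le_neg hx.1⟩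
  simpa using h3

namespace Profile

/-- Fixed points at which the densities differ are isolated. -/
theorem exists_isolated (p₀ : Profile I₀ F₀ ρ₀) (p₁ : Profile I₁ F₁ ρ₁) {b : ℝ}
    (hb : b ∈ coincidenceSet I₀ F₀ I₁ F₁) (hne : ρ₀ b ≠ ρ₁ b) :
    ∃ ε > 0, ∀ u ∈ coincidenceSet I₀ F₀ I₁ F₁, |u - b| < ε → u = b := by
  have hc : ContinuousWithinAt (fun x => ρ₀ x - ρ₁ x) (I₀ ∩ I₁) b :=
    ((p₀.contρ b hb.1).mono inter_subset_left).sub ((p₁.contρ b hb.2.1).mono inter_subset_right)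
  have hev := hc.eventually_ne (sub_ne_zero.2 hne)
  obtain ⟨ε, hε, hs⟩ := Metric.mem_nhdsWithin_iff.1 hev
  rw [Real.ball_eq_Ioo] at hs
  have key : ∀ u ∈ coincidenceSet I₀ F₀ I₁ F₁, ∀ w ∈ coincidenceSet I₀ F₀ I₁ F₁,
      u ∈ Ioo (b - ε) (b + ε) → w ∈ Ioo (b - ε) (b + ε) → ¬ u < w := by
    intro u hu w hw hub hwb hlt
    have hsub₀ : Icc u w ⊆ I₀ := p₀.ord.out hu.1 hw.1
    have hsub₁ : Icc u w ⊆ I₁ := p₁.ord.out hu.2.1 hw.2.1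
    obtain ⟨ξ, hξ, e⟩ := exists_hasDerivAt_eq_slope (fun z => F₀ z - F₁ z)
      (fun z => ρ₀ z - ρ₁ z) hlt (p₀.cont.sub p₁.cont).continuousOn (fun z hz =>
        (p₀.deriv z (interior_maximal (Ioo_subset_Icc_self.trans hsub₀) isOpen_Ioo hz)).sub
        (p₁.deriv z (interior_maximal (Ioo_subset_Icc_self.trans hsub₁) isOpen_Ioo hz)))
    simp only [hu.2.2, hw.2.2, sub_self, zero_div] at e
    exact hs ⟨⟨hub.1.trans hξ.1, hξ.2.trans hwb.2⟩, hsub₀ ⟨hξ.1.le, hξ.2.le⟩,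
      hsub₁ ⟨hξ.1.le, hξ.2.le⟩⟩ e
  refine ⟨ε, hε, fun u hu hub => ?_⟩
  have hbI : b ∈ Ioo (b - ε) (b + ε) := ⟨by linarith, by linarith⟩
  have huI : u ∈ Ioo (b - ε) (b + ε) := by
    obtain ⟨h1, h2⟩ := abs_lt.1 hub
    exact ⟨by linarith, by linarith⟩
  exact le_antisymm (not_lt.1 (key b hb u hu hbI huI)) (not_lt.1 (key u hu b hb huI hbI))

end Profile

end

section

variable {I₀ I₁ : Set ℝ} {F₀ F₁ ρ₀ ρ₁ : ℝ → ℝ}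

namespace Profile

/-- Regularity of the velocity field at a fixed point where the densities differ. -/
theorem regular_at_isolated (p₀ : Profile I₀ F₀ ρ₀) (p₁ : Profile I₁ F₁ ρ₁) {v : ℝ → ℝ}
    {A : Set ℝ → ℝ → ℝ} (hvS : ∀ x ∈ coincidenceSet I₀ F₀ I₁ F₁, v x = 0)
    (hvA : ∀ z ∈ intervalHull I₀ I₁ \ coincidenceSet I₀ F₀ I₁ F₁,
        TransportField I₀ F₀ ρ₀ I₁ F₁ ρ₁
          (ordConnectedComponent (intervalHull I₀ I₁ \ coincidenceSet I₀ F₀ I₁ F₁) z) v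
          (A (ordConnectedComponent (intervalHull I₀ I₁ \ coincidenceSet I₀ F₀ I₁ F₁) z)))
    {b : ℝ} (hb : b ∈ coincidenceSet I₀ F₀ I₁ F₁) (hne : ρ₀ b ≠ ρ₁ b) :
    ContinuousWithinAt v (intervalHull I₀ I₁) b ∧ (LipOn ρ₀ I₀ → LipOn ρ₁ I₁ →
      ∃ t ∈ 𝓝[intervalHull I₀ I₁] b, LipOn v t) := by
  set C := intervalHull I₀ I₁ with hC
  set S := coincidenceSet I₀ F₀ I₁ F₁ with hS
  obtain ⟨ε, hε, hiso⟩ := p₀.exists_isolated p₁ hb hne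
  have hvb : v b = 0 := hvS b hb
  have hbC : b ∈ C := subset_intervalHull_left hb.1
  have hCord : C.OrdConnected := ordConnected_intervalHull I₀ I₁
  have hbJ : ∀ z, b ∉ ordConnectedComponent (C \ S) z := fun z h =>
    (ordConnectedComponent_subset h).2 hb
  have htriv : LipOn v {b} := ⟨0, le_rfl, by simp⟩
  have hleft : Tendsto v (𝓝[C ∩ Iio b] b) (𝓝 0) ∧ ∃ z < b,
      (LipOn ρ₀ I₀ → LipOn ρ₁ I₁ → LipOn v (C ∩ Icc z b)) := by
    by_cases h : ∃ z ∈ C, z ∈ Ioo (b - ε) b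
    · obtain ⟨z, hzC, hz⟩ := h
      have hsub : Ico z b ⊆ C \ S := fun u hu => ⟨hCord.out hzC hbC ⟨hu.1, hu.2.le⟩, fun hu' =>
        hu.2.ne (hiso u hu' (by rw [abs_lt]; constructor <;> linarith [hz.1, hu.1, hu.2]))⟩
      have hsubJ : Ico z b ⊆ ordConnectedComponent (C \ S) z := fun u hu => by
        rw [mem_ordConnectedComponent, uIcc_of_le hu.1]
        exact fun w hw => hsub ⟨hw.1, hw.2.trans_lt hu.2⟩
      obtain ⟨h1, h2⟩ := (hvA z (hsub ⟨le_rfl, hz.2⟩)).end_left b hb.1 hb.2.1 hb.2.2 hne z hz.2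
        hsubJ (hbJ z)
      exact ⟨h1.mono_left (nhdsWithin_mono _ inter_subset_right), z, hz.2, fun hL₀ hL₁ =>
        ((h2 hL₀ hL₁).Icc_of_tendsto_left (hvb.symm ▸ h1)).mono inter_subset_right⟩
    · push Not at h
      refine ⟨tendsto_const_nhds.congr' ?_, b - ε / 2, by linarith, fun _ _ => htriv.mono ?_⟩
      · filter_upwards [self_mem_nhdsWithin, mem_nhdsWithin_of_mem_nhds (Ioi_mem_nhds
          (sub_lt_self b hε))] with u hu hu' using absurd ⟨hu', hu.2⟩ (h u hu.1)
      · rintro u ⟨huC, hu⟩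
        by_contra hub
        exact h u huC ⟨by linarith [hu.1], lt_of_le_of_ne hu.2 hub⟩
  have hright : Tendsto v (𝓝[C ∩ Ioi b] b) (𝓝 0) ∧ ∃ z > b,
      (LipOn ρ₀ I₀ → LipOn ρ₁ I₁ → LipOn v (C ∩ Icc b z)) := by
    by_cases h : ∃ z ∈ C, z ∈ Ioo b (b + ε)
    · obtain ⟨z, hzC, hz⟩ := h
      have hsub : Ioc b z ⊆ C \ S := fun u hu => ⟨hCord.out hbC hzC ⟨hu.1.le, hu.2⟩, fun hu' =>
        hu.1.ne' (hiso u hu' (by rw [abs_lt]; constructor <;> linarith [hz.2, hu.1, hu.2]))⟩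
      have hsubJ : Ioc b z ⊆ ordConnectedComponent (C \ S) z := fun u hu => by
        rw [mem_ordConnectedComponent, uIcc_of_ge hu.2]
        exact fun w hw => hsub ⟨hu.1.trans_le hw.1, hw.2⟩
      obtain ⟨h1, h2⟩ := (hvA z (hsub ⟨hz.1, le_rfl⟩)).end_right b hb.1 hb.2.1 hb.2.2 hne z hz.1
        hsubJ (hbJ z)
      exact ⟨h1.mono_left (nhdsWithin_mono _ inter_subset_right), z, hz.1, fun hL₀ hL₁ =>
        ((h2 hL₀ hL₁).Icc_of_tendsto_right (hvb.symm ▸ h1)).mono inter_subset_right⟩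
    · push Not at h
      refine ⟨tendsto_const_nhds.congr' ?_, b + ε / 2, by linarith, fun _ _ => htriv.mono ?_⟩
      · filter_upwards [self_mem_nhdsWithin, mem_nhdsWithin_of_mem_nhds (Iio_mem_nhds
          (lt_add_of_pos_right b hε))] with u hu hu' using absurd ⟨hu.2, hu'⟩ (h u hu.1)
      · rintro u ⟨huC, hu⟩
        by_contra hub
        exact h u huC ⟨lt_of_le_of_ne hu.1 (Ne.symm hub), by linarith [hu.2]⟩
  obtain ⟨hl, z, hz, hlL⟩ := hleft
  obtain ⟨hr, z', hz', hrL⟩ := hright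
  constructor
  · rw [← hvb] at hl hr
    refine (ContinuousWithinAt.union hl hr).insert.mono fun u hu => ?_
    rcases lt_trichotomy u b with h | h | h
    · exact Or.inr (Or.inl ⟨hu, h⟩)
    · exact Or.inl h
    · exact Or.inr (Or.inr ⟨hu, h⟩)
  · refine fun hL₀ hL₁ => ⟨C ∩ Icc z z', inter_mem self_mem_nhdsWithin
      (mem_nhdsWithin_of_mem_nhds (Icc_mem_nhds hz hz')), ?_⟩
    exact LipOn.glue (m := b) ⟨hbC, hz.le, hz'.le⟩
      ((hlL hL₀ hL₁).mono fun u hu => ⟨hu.1.1, hu.1.2.1, hu.2⟩)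
      ((hrL hL₀ hL₁).mono fun u hu => ⟨hu.1.1, hu.2, hu.1.2.2⟩)

/-- The main construction, in terms of distribution functions and densities. -/
theorem exists_velocity (p₀ : Profile I₀ F₀ ρ₀) (p₁ : Profile I₁ F₁ ρ₁) :
    ∃ (v : ℝ → ℝ) (φ : ℝ → ℝ → ℝ),
      (∀ x ∈ intervalHull I₀ I₁ \ coincidenceSet I₀ F₀ I₁ F₁, v x ≠ 0) ∧
      (∀ x ∈ coincidenceSet I₀ F₀ I₁ F₁, v x = 0) ∧
      (∀ x ∈ I₀, ∀ y ∈ I₁, F₀ x = F₁ y →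
        IsSolutionOn v (intervalHull I₀ I₁) x (Icc 0 1) (fun t => φ t x) ∧ φ 1 x = y) ∧
      (∀ x ∈ I₀, F₀ x = 1 → (∀ z, F₁ z < 1) →
        IsSolutionOn v (intervalHull I₀ I₁) x (Ico 0 1) (fun t => φ t x) ∧
          ∀ M, ∀ᶠ t in 𝓝[<] 1, M < φ t x) ∧
      (∀ x ∈ I₀, F₀ x = 0 → (∀ z, 0 < F₁ z) →
        IsSolutionOn v (intervalHull I₀ I₁) x (Ico 0 1) (fun t => φ t x) ∧
          ∀ M, ∀ᶠ t in 𝓝[<] 1, φ t x < M) ∧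
      (∀ x ∈ I₀, ∀ τ ≥ (0 : ℝ), ∀ γ : ℝ → ℝ,
        IsSolutionOn v (intervalHull I₀ I₁) x (Icc 0 τ) γ → ∀ t ∈ Icc 0 τ, γ t = φ t x) ∧
      ContinuousOn v (intervalHull I₀ I₁ \ frontier (coincidenceSet I₀ F₀ I₁ F₁)) ∧
      ((∀ x ∈ frontier (coincidenceSet I₀ F₀ I₁ F₁), ρ₀ x ≠ ρ₁ x) →
        ContinuousOn v (intervalHull I₀ I₁)) ∧
      ((∀ x ∈ frontier (coincidenceSet I₀ F₀ I₁ F₁), ρ₀ x ≠ ρ₁ x) → LipOn ρ₀ I₀ → LipOn ρ₁ I₁ →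
        ∀ x ∈ intervalHull I₀ I₁, ∃ t ∈ 𝓝[intervalHull I₀ I₁] x, LipOn v t) := by
  classical
  obtain ⟨v, A, hvS, hvA⟩ := p₀.fields_exist p₁
  set C := intervalHull I₀ I₁ with hC
  set S := coincidenceSet I₀ F₀ I₁ F₁ with hS
  have hCord : C.OrdConnected := ordConnected_intervalHull I₀ I₁
  have hSclosed : IsClosed S := p₀.isClosed_coincidenceSet p₁
  set J : ℝ → Set ℝ := fun z => ordConnectedComponent (C \ S) z with hJ
  have hJord : ∀ z, (J z).OrdConnected := fun z => inferInstance
  have hJsub : ∀ z, J z ⊆ C \ S := fun z => ordConnectedComponent_subset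
  have hself : ∀ z ∈ C \ S, z ∈ J z := fun z hz => self_mem_ordConnectedComponent.2 hz
  have hJeq : ∀ z, ∀ y ∈ J z, J z = J y := fun z y hy => ordConnectedComponent_eq hy
  have hopen : ∀ z, ∀ y ∈ J z, J z ∈ 𝓝[C] y := fun z y hy => by
    rw [hJeq z y hy]; exact p₀.component_mem_nhdsWithin p₁ (hJsub z hy)
  have hunb : ∀ z ∈ C \ S, ∀ b ∈ C, b ∉ J z →
      Tendsto (fun u => |A (J z) u|) (𝓝[J z] b) atTop := by
    intro z hz b hbC hbJ
    by_cases hbS : b ∈ S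
    · exact (hvA z hz).unbounded b hbS.1 hbS.2.1 hbS.2.2 hbJ
    · have hbot : 𝓝[J z] b = ⊥ := by
        rw [← Filter.empty_mem_iff_bot]
        have h1 : J b ∈ 𝓝[J z] b :=
          nhdsWithin_mono b ((hJsub z).trans sdiff_subset) (hopen b b (hself b ⟨hbC, hbS⟩))
        filter_upwards [h1, self_mem_nhdsWithin] with u hu hu'
        apply hbJ
        rw [hJeq z u hu', ← hJeq b u hu]
        exact hself b ⟨hbC, hbS⟩
      rw [hbot]
      exact tendsto_bot
  have hI₀C : I₀ ⊆ C := subset_intervalHull_left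
  have hmem₁ : ∀ x ∈ I₀, ∀ y ∈ I₁, F₀ x = F₁ y → x ∉ S → y ∈ J x := fun x hx y hy e hxS =>
    p₀.uIcc_subset p₁ hx hy e (Or.inl hxS)
  have hmem₀ : ∀ z, ∀ y ∈ J z, y ∈ I₁ → ∀ x ∈ I₀, F₀ x = F₁ y → x ∈ J z := by
    intro z y hy hyI x hx e
    rw [hJeq z y hy]
    have := p₀.uIcc_subset p₁ hx hyI e (Or.inr (hJsub z hy).2)
    rwa [uIcc_comm] at this
  set φ : ℝ → ℝ → ℝ := fun t x =>
    if x ∈ S then x else Function.invFunOn (A (J x)) (J x) (A (J x) x + t) with hφ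
  have hφS : ∀ x ∈ S, ∀ t, φ t x = x := fun x hx t => if_pos hx
  have hφJ : ∀ x, x ∉ S → ∀ t, φ t x = Function.invFunOn (A (J x)) (J x) (A (J x) x + t) :=
    fun x hx t => if_neg hx
  have hφmem : ∀ x, x ∉ S → ∀ t, A (J x) x + t ∈ A (J x) '' J x →
      φ t x ∈ J x ∧ A (J x) (φ t x) = A (J x) x + t := fun x hx t ht => by
    rw [hφJ x hx]
    exact ⟨Function.invFunOn_mem ht, Function.invFunOn_eq ht⟩
  have hsolJ : ∀ x ∈ C \ S, ∀ T : Set ℝ, (∀ t ∈ T, 0 ≤ t ∧ A (J x) x + t ∈ A (J x) '' J x) →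
      IsSolutionOn v C x T (fun t => φ t x) := by
    intro x hx T hT
    simp only [hφJ x hx.2]
    exact (hvA x hx).isSolutionOn (hJord x) ((hJsub x).trans sdiff_subset) (hself x hx) hT
  have hcontAt : ∀ z ∈ C \ S, ContinuousWithinAt v C z := fun z hz =>
    ((hvA z hz).cont z (hself z hz)).mono_of_mem_nhdsWithin (hopen z z (hself z hz))
  have hinterior : ∀ z ∈ S, z ∉ frontier S → v =ᶠ[𝓝 z] fun _ => 0 := by
    intro z hz hzf
    rw [hSclosed.frontier_eq] at hzf
    have hzi : z ∈ interior S := by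
      by_contra h
      exact hzf ⟨hz, h⟩
    filter_upwards [mem_interior_iff_mem_nhds.1 hzi] with u hu using hvS u hu
  have hcontInt : ∀ z ∈ S, z ∉ frontier S → ContinuousAt v z := fun z hz hzf =>
    continuousAt_const.congr (hinterior z hz hzf).symm
  refine ⟨v, φ, fun x hx => (hvA x hx).ne_zero (hself x hx), hvS, ?_, ?_, ?_, ?_, ?_, ?_, ?_⟩
  · intro x hx y hy e
    by_cases hxS : x ∈ S
    · have hxy : x = y := p₁.strict.injOn hxS.2.1 hy (hxS.2.2.symm.trans e)
      refine ⟨fun t _ => ?_, by rw [hφS x hxS, hxy]⟩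
      simp only [hφS x hxS, hvS x hxS]
      exact ⟨hI₀C hx, intervalIntegrable_const, by simp⟩
    · have hxU : x ∈ C \ S := ⟨hI₀C hx, hxS⟩
      have hyJ := hmem₁ x hx y hy e hxS
      have hAy := (hvA x hxU).pair x (hself x hxU) hx y hyJ hy e
      have himg : ∀ t ∈ Icc (0 : ℝ) 1, A (J x) x + t ∈ A (J x) '' J x := fun t ht =>
        ((hvA x hxU).ordConnected_image (hJord x)).out (mem_image_of_mem _ (hself x hxU))
          (mem_image_of_mem _ hyJ) ⟨by linarith [ht.1], by linarith [ht.2]⟩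
      refine ⟨hsolJ x hxU _ fun t ht => ⟨ht.1, himg t ht⟩, ?_⟩
      obtain ⟨h1, h2⟩ := hφmem x hxS 1 (himg 1 ⟨zero_le_one, le_rfl⟩)
      exact (hvA x hxU).injOn (hJord x) h1 hyJ (h2.trans hAy.symm)
  · intro x hx hFx hF₁
    have hxS : x ∉ S := fun h => (hF₁ x).ne (h.2.2.symm.trans hFx)
    have hxU : x ∈ C \ S := ⟨hI₀C hx, hxS⟩
    have hIci : Ici x ⊆ J x := by
      intro u hu
      change uIcc x u ⊆ C \ S
      rw [uIcc_of_le hu]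
      intro w hw
      refine ⟨?_, fun hwS => ?_⟩
      · by_contra hcon
        refine (hF₁ w).ne (p₁.top w fun y hy => ?_)
        by_contra! hlt
        exact hcon (hCord.out hxU.1 (subset_intervalHull_right hy) ⟨hw.1, hlt.le⟩)
      · linarith [p₀.mono hw.1, hF₁ w, hwS.2.2]
    obtain ⟨h1, h2⟩ := p₀.time_at_top p₁ (hJord x) (hvA x hxU).continuousOn_time
      ((hvA x hxU).strictMonoOn_or (hJord x)) (hmem₀ x) (hvA x hxU).pair hx hFx hF₁ hIci
    refine ⟨hsolJ x hxU _ fun t ht => ⟨ht.1, h1 t ht⟩, fun M => ?_⟩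
    obtain ⟨t₀, ht₀, h3⟩ := h2 M
    filter_upwards [Ioo_mem_nhdsLT ht₀, Ioo_mem_nhdsLT zero_lt_one] with t ht ht'
    obtain ⟨h4, h5⟩ := hφmem x hxS t (h1 t ⟨ht'.1.le, ht'.2⟩)
    exact h3 _ h4 (by linarith [ht.1])
  · intro x hx hFx hF₁
    have hxS : x ∉ S := fun h => (hF₁ x).ne (hFx.symm.trans h.2.2)
    have hxU : x ∈ C \ S := ⟨hI₀C hx, hxS⟩
    have hIic : Iic x ⊆ J x := by
      intro u hu
      change uIcc x u ⊆ C \ S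
      rw [uIcc_of_ge hu]
      intro w hw
      refine ⟨?_, fun hwS => ?_⟩
      · by_contra hcon
        refine (hF₁ w).ne (p₁.bot w fun y hy => ?_).symm
        by_contra! hlt
        exact hcon (hCord.out (subset_intervalHull_right hy) hxU.1 ⟨hlt.le, hw.2⟩)
      · linarith [p₀.mono hw.2, hF₁ w, hwS.2.2]
    obtain ⟨h1, h2⟩ := p₀.time_at_bot p₁ (hJord x) (hvA x hxU).continuousOn_time
      ((hvA x hxU).strictMonoOn_or (hJord x)) (hmem₀ x) (hvA x hxU).pair hx hFx hF₁ hIic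
    refine ⟨hsolJ x hxU _ fun t ht => ⟨ht.1, h1 t ht⟩, fun M => ?_⟩
    obtain ⟨t₀, ht₀, h3⟩ := h2 M
    filter_upwards [Ioo_mem_nhdsLT ht₀, Ioo_mem_nhdsLT zero_lt_one] with t ht ht'
    obtain ⟨h4, h5⟩ := hφmem x hxS t (h1 t ⟨ht'.1.le, ht'.2⟩)
    exact h3 _ h4 (by linarith [ht.1])
  · intro x hx τ hτ γ hγ t ht
    have hγ0 := hγ.apply_zero hτ
    have hγC : MapsTo γ (Icc 0 τ) C := fun s hs => (hγ s hs).1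
    have hstep : ∀ z ∈ C \ S, ∀ a ∈ Icc 0 τ, ∀ b ∈ Icc 0 τ, a < b →
        (∀ s ∈ Icc a b, γ s ∈ J z) → A (J z) (γ b) - A (J z) (γ a) = b - a :=
      fun z hz a ha b hb hab hs => hγ.sub_eq (hvA z hz).cont (fun y hy => (hvA z hz).ne_zero hy)
        (hvA z hz).deriv ha hb hab hs
    by_cases hxS : x ∈ S
    · have hγS : ∀ s ∈ Icc 0 τ, γ s ∈ S := by
        intro s hs
        by_contra hsS
        have hsU : γ s ∈ C \ S := ⟨hγC hs, hsS⟩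
        have hrev : MapsTo (fun r => s - r) (Icc 0 s) (Icc 0 τ) := fun r hr =>
          ⟨by linarith [hr.2], by linarith [hr.1, hs.2]⟩
        have := mem_and_eq_of_unbounded (γ := fun r => γ (s - r)) (κ := -1) (τ := s)
          (hvA _ hsU).continuousOn_time (hopen (γ s)) (hunb _ hsU)
          (hγ.continuousOn.comp (by fun_prop) hrev) (fun r hr => hγC (hrev hr))
          (fun a ha b hb hab hr => by
            have := hstep _ hsU (s - b) (hrev hb) (s - a) (hrev ha) (by linarith) fun r hr' => by
              have := hr (s - r) ⟨by linarith [hr'.2], by linarith [hr'.1]⟩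
              rwa [sub_sub_cancel] at this
            linarith)
          (by simp only [sub_zero]; exact hself _ hsU) s ⟨hs.1, le_rfl⟩
        simp only [sub_self, hγ0] at this
        exact (hJsub _ this.1).2 hxS
      rw [hφS x hxS, (hγ t ht).2.2, intervalIntegral.integral_congr (g := fun _ => 0)]
      · simp
      · intro s hs
        rw [uIcc_of_le ht.1] at hs
        exact hvS _ (hγS s ⟨hs.1, hs.2.trans ht.2⟩)
    · have hxU : x ∈ C \ S := ⟨hI₀C hx, hxS⟩
      obtain ⟨h1, h2⟩ := mem_and_eq_of_unbounded (κ := 1) (hvA x hxU).continuousOn_time (hopen x)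
        (hunb x hxU) hγ.continuousOn hγC
        (fun a ha b hb hab hs => by rw [one_mul]; exact hstep x hxU a ha b hb hab hs)
        (by rw [hγ0]; exact hself x hxU) t ht
      rw [hγ0, one_mul] at h2
      obtain ⟨h3, h4⟩ := hφmem x hxS t ⟨_, h1, h2⟩
      exact (hvA x hxU).injOn (hJord x) h1 h3 (h2.trans h4.symm)
  · rintro z ⟨hzC, hzf⟩
    by_cases hzS : z ∈ S
    · exact (hcontInt z hzS hzf).continuousWithinAt
    · exact (hcontAt z ⟨hzC, hzS⟩).mono sdiff_subset
  · intro hne z hzC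
    by_cases hzS : z ∈ S
    · by_cases hzf : z ∈ frontier S
      · exact (p₀.regular_at_isolated p₁ hvS hvA hzS (hne z hzf)).1
      · exact (hcontInt z hzS hzf).continuousWithinAt
    · exact hcontAt z ⟨hzC, hzS⟩
  · intro hne hL₀ hL₁ z hzC
    by_cases hzS : z ∈ S
    · by_cases hzf : z ∈ frontier S
      · exact (p₀.regular_at_isolated p₁ hvS hvA hzS (hne z hzf)).2 hL₀ hL₁
      · refine ⟨_, mem_nhdsWithin_of_mem_nhds (hinterior z hzS hzf), 0, le_rfl, ?_⟩
        intro x hx y hy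
        rw [show v x = 0 from hx, show v y = 0 from hy]
        simp
    · have hzU : z ∈ C \ S := ⟨hzC, hzS⟩
      obtain ⟨p, hp, q, hq, -, hn⟩ := exists_Icc_mem_nhdsWithin (hself z hzU)
      exact ⟨Icc p q, nhdsWithin_le_of_mem (hopen z z (hself z hzU)) hn,
        (hvA z hzU).lip hL₀ hL₁ p hp q hq⟩

end Profile

end

/-- A probability measure with convex support and a density that is continuous and positive there
gives a profile. -/
theorem profile_of_withDensity (μ : Measure ℝ) [IsProbabilityMeasure μ] (ρ : ℝ → ℝ)
    (hρm : Measurable ρ) (hμ : μ = volume.withDensity (fun x => ENNReal.ofReal (ρ x)))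
    (hρc : ContinuousOn ρ μ.support) (hconv : Convex ℝ μ.support)
    (hpos : ∀ x ∈ μ.support, 0 < ρ x) : Profile μ.support (fun x => μ.real (Iic x)) ρ := by
  set g : ℝ → ℝ := fun x => max (ρ x) 0 with hg
  have hgm : Measurable g := hρm.max measurable_const
  have hg0 : ∀ x, 0 ≤ g x := fun x => le_max_right _ _
  have hofReal : ∀ x, ENNReal.ofReal (g x) = ENNReal.ofReal (ρ x) := fun x => by
    rcases le_total (ρ x) 0 with h | h
    · simp [hg, h, ENNReal.ofReal_of_nonpos h]
    · simp [hg, h]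
  have hgint : Integrable g volume := by
    refine ⟨hgm.aestronglyMeasurable, ?_⟩
    rw [hasFiniteIntegral_iff_ofReal (Eventually.of_forall hg0)]
    have h1 : μ univ = ∫⁻ x, ENNReal.ofReal (ρ x) := by
      rw [hμ, withDensity_apply _ MeasurableSet.univ, Measure.restrict_univ]
    simp only [hofReal]
    rw [← h1]
    exact measure_lt_top μ univ
  have hreal : ∀ s, MeasurableSet s → μ.real s = ∫ x in s, g x := by
    intro s hs
    rw [integral_eq_lintegral_of_nonneg_ae (Eventually.of_forall hg0)
      hgm.aestronglyMeasurable, measureReal_def]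
    conv_lhs => rw [hμ, withDensity_apply _ hs]
    simp only [hofReal]
  have hF : ∀ x, μ.real (Iic x) = (∫ u in Iic (0 : ℝ), g u) + ∫ u in (0 : ℝ)..x, g u := by
    intro x
    rw [hreal _ measurableSet_Iic,
      ← intervalIntegral.integral_Iic_sub_Iic hgint.integrableOn hgint.integrableOn]
    ring
  have hcont : Continuous fun x => μ.real (Iic x) := by
    simp only [hF]
    exact continuous_const.add
      (intervalIntegral.continuous_primitive (fun a b => hgint.intervalIntegrable) 0)
  have hderiv : ∀ x ∈ interior μ.support, HasDerivAt (fun x => μ.real (Iic x)) (ρ x) x := by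
    intro x hx
    simp only [hF]
    have hxs := interior_subset hx
    have hgx : g x = ρ x := max_eq_left (hpos x hxs).le
    have hgc : ContinuousAt g x :=
      (hρc.continuousAt (mem_interior_iff_mem_nhds.1 hx)).max continuousAt_const
    rw [← hgx]
    exact (intervalIntegral.integral_hasDerivAt_right hgint.intervalIntegrable
      (hgm.stronglyMeasurable.stronglyMeasurableAtFilter) hgc).const_add _
  have hnull : μ μ.supportᶜ = 0 := Measure.measure_compl_support
  have hpt : ∀ x, μ {x} = 0 := fun x => by
    rw [hμ]
    exact withDensity_absolutelyContinuous _ _ (measure_singleton x)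
  have hbot : ∀ x ∈ lowerBounds μ.support, μ.real (Iic x) = 0 := by
    intro x hx
    rw [measureReal_eq_zero_iff]
    refine measure_mono_null (t := μ.supportᶜ ∪ {x}) (fun y hy => ?_)
      (measure_union_null hnull (hpt x))
    by_cases hyx : y = x
    · exact Or.inr hyx
    · exact Or.inl fun hys => hyx (le_antisymm hy (hx hys))
  have htop : ∀ x ∈ upperBounds μ.support, μ.real (Iic x) = 1 := by
    intro x hx
    have h1 : μ (Iic x)ᶜ = 0 := measure_mono_null
      (fun y hy hys => hy (hx hys)) hnull
    rw [measureReal_def, (prob_compl_eq_zero_iff measurableSet_Iic).1 h1, ENNReal.toReal_one]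
  have hmono : Monotone fun x => μ.real (Iic x) := fun x y h =>
    measureReal_mono (Iic_subset_Iic.2 h)
  have hord : μ.support.OrdConnected := hconv.ordConnected
  refine
    { closed := Measure.isClosed_support
      ord := hord
      cont := hcont
      mono := hmono
      strict := strictMonoOn_of_hasDerivWithinAt_pos hconv hcont.continuousOn
        (fun x hx => (hderiv x hx).hasDerivWithinAt) fun x hx => hpos x (interior_subset hx)
      deriv := hderiv
      contρ := hρc
      pos := hpos
      nonneg := fun x => measureReal_nonneg
      le_one := fun x => measureReal_le_one
      surj := fun m hm => ?_
      bot := hbot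
      top := htop }
  have hlim1 := (ProbabilityTheory.tendsto_cdf_atTop μ).congr (ProbabilityTheory.cdf_eq_real μ)
  have hlim0 := (ProbabilityTheory.tendsto_cdf_atBot μ).congr (ProbabilityTheory.cdf_eq_real μ)
  obtain ⟨a, ha⟩ := (hlim0.eventually (gt_mem_nhds hm.1)).exists
  obtain ⟨b, hb⟩ := (hlim1.eventually (lt_mem_nhds hm.2)).exists
  obtain ⟨x, hx⟩ := mem_range_of_exists_le_of_exists_ge hcont ⟨a, ha.le⟩ ⟨b, hb.le⟩
  simp only at hx
  have h0 : x ∉ lowerBounds μ.support := fun h => by linarith [hbot x h, hm.1]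
  have h1 : x ∉ upperBounds μ.support := fun h => by linarith [htop x h, hm.2]
  simp only [lowerBounds, upperBounds, mem_ofPred_eq, not_forall, not_le] at h0 h1
  obtain ⟨p, hp, hpx⟩ := h0
  obtain ⟨q, hq, hxq⟩ := h1
  exact ⟨x, hord.out hp hq ⟨hpx.le, hxq.le⟩, hx⟩

section

variable {μ₀ μ₁ : Measure ℝ} [IsProbabilityMeasure μ₀] [IsProbabilityMeasure μ₁] {ρ₀ ρ₁ : ℝ → ℝ}

theorem monotoneTransport_eq_sSup (μ₀ μ₁ : Measure ℝ) [IsProbabilityMeasure μ₀]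
    [IsProbabilityMeasure μ₁] (x : ℝ) :
    monotoneTransport μ₀ μ₁ x = sSup ((fun z : ℝ => (z : EReal)) ''
      {z : ℝ | z ∈ μ₁.support ∧ μ₁.real (Iic z) ≤ μ₀.real (Iic x)}) := by
  simp only [monotoneTransport, measureReal_def,
    ENNReal.toReal_le_toReal (measure_ne_top _ _) (measure_ne_top _ _)]

theorem Profile.monotoneTransport_eq (p₁ : Profile μ₁.support (fun x => μ₁.real (Iic x)) ρ₁)
    {x y : ℝ} (hy : y ∈ μ₁.support) (e : μ₀.real (Iic x) = μ₁.real (Iic y)) :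
    monotoneTransport μ₀ μ₁ x = (y : EReal) := by
  rw [monotoneTransport_eq_sSup]
  refine le_antisymm (sSup_le ?_) (le_sSup ⟨y, ⟨hy, e.ge⟩, rfl⟩)
  rintro _ ⟨z, ⟨hz, hle⟩, rfl⟩
  rw [e] at hle
  exact EReal.coe_le_coe_iff.2 ((p₁.strict.le_iff_le hz hy).1 hle)

/-- The three possible behaviours of the monotone transport. -/
theorem Profile.monotoneTransport_cases
    (p₀ : Profile μ₀.support (fun x => μ₀.real (Iic x)) ρ₀)
    (p₁ : Profile μ₁.support (fun x => μ₁.real (Iic x)) ρ₁) (x : ℝ) :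
    (∃ y ∈ μ₁.support, μ₀.real (Iic x) = μ₁.real (Iic y) ∧
      monotoneTransport μ₀ μ₁ x = (y : EReal)) ∨
    (μ₀.real (Iic x) = 1 ∧ (∀ z, μ₁.real (Iic z) < 1) ∧ monotoneTransport μ₀ μ₁ x = ⊤) ∨
    (μ₀.real (Iic x) = 0 ∧ (∀ z, 0 < μ₁.real (Iic z)) ∧ monotoneTransport μ₀ μ₁ x = ⊥) := by
  by_cases h : ∃ y ∈ μ₁.support, μ₀.real (Iic x) = μ₁.real (Iic y)
  · obtain ⟨y, hy, e⟩ := h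
    exact Or.inl ⟨y, hy, e, p₁.monotoneTransport_eq hy e⟩
  refine Or.inr ?_
  push Not at h
  have hsurj : ¬ (0 < μ₀.real (Iic x) ∧ μ₀.real (Iic x) < 1) := fun hm => by
    obtain ⟨y, hy, e⟩ := p₁.surj _ hm
    exact h y hy e.symm
  rcases (p₀.nonneg x).eq_or_lt with h0 | h0
  · have hF : ∀ z, 0 < μ₁.real (Iic z) := by
      intro z
      refine lt_of_le_of_ne (p₁.nonneg z) fun hz => ?_
      by_cases hzI : z ∈ μ₁.support
      · exact h z hzI (h0.symm.trans hz)
      rcases p₁.lt_or_gt_of_notMem hzI with hl | hl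
      · obtain ⟨y, hy, -, e⟩ := p₁.exists_eq_zero fun y hy => (hl y hy).le
        exact h y hy (h0.symm.trans e.symm)
      · exact zero_ne_one (hz.trans (p₁.top z fun y hy => (hl y hy).le))
    refine Or.inr ⟨h0.symm, hF, ?_⟩
    rw [monotoneTransport_eq_sSup, sSup_eq_bot]
    rintro _ ⟨z, ⟨-, hle⟩, rfl⟩
    exact absurd (hle.trans h0.symm.le) (hF z).not_ge
  · have h1 : μ₀.real (Iic x) = 1 :=
      le_antisymm (p₀.le_one x) (not_lt.1 fun hlt => hsurj ⟨h0, hlt⟩)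
    have hF : ∀ z, μ₁.real (Iic z) < 1 := by
      intro z
      refine lt_of_le_of_ne (p₁.le_one z) fun hz => ?_
      by_cases hzI : z ∈ μ₁.support
      · exact h z hzI (h1.trans hz.symm)
      rcases p₁.lt_or_gt_of_notMem hzI with hl | hl
      · exact zero_ne_one ((p₁.bot z fun y hy => (hl y hy).le).symm.trans hz)
      · obtain ⟨y, hy, -, e⟩ := p₁.exists_eq_one fun y hy => (hl y hy).le
        exact h y hy (h1.trans e.symm)
    refine Or.inl ⟨h1, hF, ?_⟩
    rw [monotoneTransport_eq_sSup, EReal.eq_top_iff_forall_lt]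
    intro M
    have hM : ∃ z ∈ μ₁.support, M < z := by
      by_contra! hcon
      exact (hF M).ne (p₁.top M fun y hy => hcon y hy)
    obtain ⟨z, hz, hMz⟩ := hM
    exact (EReal.coe_lt_coe_iff.2 hMz).trans_le (le_sSup ⟨z, ⟨hz, (hF z).le.trans h1.ge⟩, rfl⟩)

theorem Profile.fixedSet_eq (p₀ : Profile μ₀.support (fun x => μ₀.real (Iic x)) ρ₀)
    (p₁ : Profile μ₁.support (fun x => μ₁.real (Iic x)) ρ₁) :
    fixedSet μ₀ μ₁ = coincidenceSet μ₀.support (fun x => μ₀.real (Iic x)) μ₁.support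
      (fun x => μ₁.real (Iic x)) := by
  ext x
  constructor
  · rintro ⟨hx, hT⟩
    rcases p₀.monotoneTransport_cases p₁ x with ⟨y, hy, e, hTy⟩ | ⟨-, -, hT'⟩ | ⟨-, -, hT'⟩
    · obtain rfl : x = y := EReal.coe_injective (hT.symm.trans hTy)
      exact ⟨hx, hy, e⟩
    · exact absurd (hT.symm.trans hT') (EReal.coe_ne_top x)
    · exact absurd (hT.symm.trans hT') (EReal.coe_ne_bot x)
  · rintro ⟨h0, h1, e⟩
    exact ⟨h0, p₁.monotoneTransport_eq h1 e⟩

theorem transportHull_eq (μ₀ μ₁ : Measure ℝ) :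
    transportHull μ₀ μ₁ = intervalHull μ₀.support μ₁.support := by
  refine Subset.antisymm (convexHull_min ?_ (ordConnected_intervalHull _ _).convex) ?_
  · exact union_subset subset_intervalHull_left subset_intervalHull_right
  · rintro z ⟨⟨a, ha, haz⟩, b, hb, hzb⟩
    exact (convex_convexHull ℝ _).ordConnected.out (subset_convexHull ℝ _ ha)
      (subset_convexHull ℝ _ hb) ⟨haz, hzb⟩

end

theorem theorem2p2 (μ₀ μ₁ : Measure ℝ) [IsProbabilityMeasure μ₀] [IsProbabilityMeasure μ₁]
    (ρ₀ ρ₁ : ℝ → ℝ) (hρ₀m : Measurable ρ₀) (hρ₁m : Measurable ρ₁)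
    (hμ₀ : μ₀ = volume.withDensity (fun x => ENNReal.ofReal (ρ₀ x)))
    (hμ₁ : μ₁ = volume.withDensity (fun x => ENNReal.ofReal (ρ₁ x)))
    (hρ₀c : ContinuousOn ρ₀ μ₀.support) (hρ₁c : ContinuousOn ρ₁ μ₁.support)
    (hconv₀ : Convex ℝ μ₀.support) (hconv₁ : Convex ℝ μ₁.support)
    (hpos₀ : ∀ x ∈ μ₀.support, 0 < ρ₀ x) (hpos₁ : ∀ x ∈ μ₁.support, 0 < ρ₁ x) :
    ∃ (v : ℝ → ℝ) (φ : ℝ → ℝ → ℝ),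
      -- `v` vanishes exactly on the set of fixed points
      (∀ x ∈ transportHull μ₀ μ₁ \ fixedSet μ₀ μ₁, 0 < |v x|) ∧
      (∀ x ∈ fixedSet μ₀ μ₁, v x = 0) ∧
      -- existence of the flow up to time `1`, with time-`1` map `T`
      (∀ x ∈ μ₀.support, ∀ y : ℝ, monotoneTransport μ₀ μ₁ x = (y : EReal) →
        IsSolutionOn v (transportHull μ₀ μ₁) x (Icc 0 1) (fun t => φ t x) ∧ φ 1 x = y) ∧
      -- at an end point of `supp μ₀` sent by `T` to `±∞`, `φ(t, x) → T x` as `t ↑ 1`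
      (∀ x ∈ μ₀.support, monotoneTransport μ₀ μ₁ x = ⊤ ∨ monotoneTransport μ₀ μ₁ x = ⊥ →
        IsSolutionOn v (transportHull μ₀ μ₁) x (Ico 0 1) (fun t => φ t x) ∧
        Tendsto (fun t => (φ t x : EReal)) (𝓝[<] 1) (𝓝 (monotoneTransport μ₀ μ₁ x))) ∧
      -- uniqueness of the flow starting in `supp μ₀`, on every `[0, τ]` with `τ ≤ 1`
      (∀ x ∈ μ₀.support, ∀ τ ∈ Icc (0 : ℝ) 1, ∀ γ : ℝ → ℝ,
        IsSolutionOn v (transportHull μ₀ μ₁) x (Icc 0 τ) γ →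
          ∀ t ∈ Icc 0 τ, γ t = φ t x) ∧
      -- regularity of `v`
      ContinuousOn v (transportHull μ₀ μ₁ \ frontier (fixedSet μ₀ μ₁)) ∧
      ((∀ x ∈ frontier (fixedSet μ₀ μ₁), 0 < |ρ₀ x - ρ₁ x|) →
        ContinuousOn v (transportHull μ₀ μ₁)) ∧
      ((∀ x ∈ frontier (fixedSet μ₀ μ₁), 0 < |ρ₀ x - ρ₁ x|) →
        (∃ K₀, LipschitzOnWith K₀ ρ₀ μ₀.support) → (∃ K₁, LipschitzOnWith K₁ ρ₁ μ₁.support) →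
        LocallyLipschitzOn (transportHull μ₀ μ₁) v) := by

  have p₀ := profile_of_withDensity μ₀ ρ₀ hρ₀m hμ₀ hρ₀c hconv₀ hpos₀
  have p₁ := profile_of_withDensity μ₁ ρ₁ hρ₁m hμ₁ hρ₁c hconv₁ hpos₁
  obtain ⟨v, φ, hne, hzero, hfin, htop, hbot, huniq, hc1, hc2, hL⟩ := p₀.exists_velocity p₁
  rw [p₀.fixedSet_eq p₁, transportHull_eq]
  have hdens : ∀ {s : Set ℝ}, (∀ x ∈ s, 0 < |ρ₀ x - ρ₁ x|) → ∀ x ∈ s, ρ₀ x ≠ ρ₁ x :=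
    fun h x hx => sub_ne_zero.1 (abs_pos.1 (h x hx))
  refine ⟨v, φ, fun x hx => abs_pos.2 (hne x hx), hzero, ?_, ?_,
    fun x hx τ hτ γ hγ => huniq x hx τ hτ.1 γ hγ, hc1, fun h => hc2 (hdens h), ?_⟩
  · intro x hx y hT
    rcases p₀.monotoneTransport_cases p₁ x with ⟨z, hz, e, hTz⟩ | ⟨-, -, hT'⟩ | ⟨-, -, hT'⟩
    · obtain rfl : y = z := EReal.coe_injective (hT.symm.trans hTz)
      exact hfin x hx y hz e
    · exact absurd (hT.symm.trans hT') (EReal.coe_ne_top y)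
    · exact absurd (hT.symm.trans hT') (EReal.coe_ne_bot y)
  · intro x hx hT
    rcases p₀.monotoneTransport_cases p₁ x with ⟨z, -, -, hTz⟩ | ⟨hF, hF₁, hT'⟩ | ⟨hF, hF₁, hT'⟩
    · rw [hTz] at hT
      exact absurd hT (not_or.2 ⟨EReal.coe_ne_top z, EReal.coe_ne_bot z⟩)
    · obtain ⟨h1, h2⟩ := htop x hx hF hF₁
      refine ⟨h1, ?_⟩
      rw [hT', EReal.tendsto_nhds_top_iff_real]
      exact fun M => (h2 M).mono fun t ht => EReal.coe_lt_coe_iff.2 ht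
    · obtain ⟨h1, h2⟩ := hbot x hx hF hF₁
      refine ⟨h1, ?_⟩
      rw [hT', EReal.tendsto_nhds_bot_iff_real]
      exact fun M => (h2 M).mono fun t ht => EReal.coe_lt_coe_iff.2 ht
  · intro h hL₀ hL₁ x hx
    obtain ⟨t, ht, hLt⟩ := hL (hdens h) (LipOn.of_lipschitzOnWith hL₀)
      (LipOn.of_lipschitzOnWith hL₁) x hx
    obtain ⟨K, hK⟩ := hLt.exists_lipschitzOnWith
    exact ⟨K, t, ht, hK⟩
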